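/- Let $b\ge 0$ and let $\Lambda=\Lambda^*(\mathbb Z^b)$ be the exterior algebra with basis $e^I$ ($I\subset\{1,\dots,b\}$), identified with the normalized cubical cochains of the minimal torus (the quotient of the $b$-cube by gluing opposite faces; its cubes are the subsets $I$). It has zero differential and is a Hirsch algebra, with operations $E_{p,q}:\Lambda^{\otimes p}\otimes\Lambda^{\otimes q}\to\Lambda$ of degree $1-p-q$ ($p+q\ge 1$) defined as follows. Let $\Delta$ be the Cartan--Serre diagonal on cubical chains ($\Delta 0=0\otimes 0$, $\Delta 1=1\otimes 1$, $\Delta I=0\otimes I+I\otimes 1$, extended by the Koszul rule to strings in $\{0,1,I\}$) and $*$ the join, $x*y=(-1)^{|x|}\sum_i\varepsilon(y_{<i})\varepsilon(x_{>i})\,x_{<i}(x_i*y_i)y_{>i}$ with $0*1=I$, $1*0=-I$, $0*0=1*1=0$ and $I*x=x*I=0$. The chain operations $e^{p,q}:C\to C^{\otimes p}\otimes C^{\otimes q}$ are given by $e^{1,0}=e^{0,1}=\mathrm{id}$, $e^{p,0}=e^{0,p}=0$ for $p\ge 2$, and, for $p,q\ge1$, $e^{p,q}=\mathrm{low}(e^{p,q-1})+(-1)^{q-1}\mathrm{up}(e^{p-1,q})$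 (the second term being absent if $p=1$). Here $\mathrm{low}(G)$ splits the input by $\Delta$ into $y\otimes u\otimes v$, applies $G$ to $y$, joins $v$ from the right to the last of the first $p$ outputs, and makes $u$ the last output; $\mathrm{up}(G)$ splits the input into $y\otimes w$, applies $G$ to $y$, splits the last of the first $p-1$ outputs by $\Delta$ and joins $w$ from the right to the second part. Then $E_{p,q}(x_1,\dots,x_{p+q})=(-1)^{\epsilon}(x_1\otimes\cdots\otimes x_{p+q})\circ e^{p,q}$ with $\epsilon=|x_1|+|x_3|+\dots+|x_{p+q-1}|+1$ if $p+q$ is even and $\epsilon=|x_2|+|x_4|+\dots+|x_{p+q-1}|$ if $p+q$ is odd. Let $B\Lambda=\bigoplus_n\overline\Lambda[-1]^{\otimes n}$ be the bar construction, $\overline\Lambda$ the augmentation ideal, and let $\mu:B\Lambda\otimes B\Lambda\to B\Lambda$ be the coalgebra map whose $(B\Lambda)_1$-component is given by the $E_{p,q}$. Put $\mu_1(a)=[a]$, $\mu_n(a_1,\dots,a_n)=\mu([a_1],\mu_{n-1}(a_2,\dots,a_n))$, and let $\mu_n^1$ be the component of $\mu_n$ in $(B\Lambda)_1\cong\overline\Lambda\subset\Lambda$.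 For subsets $I_1,\dots,I_n$ of odd cardinality let $R(I_1,\dots,I_n)$ be the multigraph with vertex set $\bigcup I_j$ in which each $I_j$ contributes the path through its elements in increasing order; the family is *1-regular* if $R$ is a tree. The insertion product $j_n$ is the multilinear map on elements of odd degree with $j_n(e^{I_1},\dots,e^{I_n})=0$ if the family is not 1-regular; if it is 1-regular, order the sets so that each meets the union of the previous ones in exactly one point, and let $j_n(e^{I_1},\dots,e^{I_n})$ be the result of inserting successively, where the insertion of $e^I$ into $e^J$ with $J\cap I=\{k\}$, $J=J_0<\{k\}<J_1$, is $e^{J_0}\wedge e^I\wedge e^{J_1}$. For $a=\sum a_Ie^I$ put $a^{\circ n}=\sum_{\{I_1,\dots,I_n\}\ \text{1-regular}}a_{I_1}\cdots a_{I_n}\,j_n(e^{I_1},\dots,e^{I_n})$, the sum over unordered families of $n$ distinct subsets. **Theorem.** (1) $j_n$ is well defined: every 1-regular family of $n\ge1$ sets of odd cardinality has such an order, for every such order the result is the same, equals the iterated cup-1 product $E_{1,1}(\cdots E_{1,1}(E_{1,1}(e^{I_1};e^{I_2});e^{I_3})\cdots;e^{I_n})$, and is $\pm e^{I_1\cup\dots\cup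 I_n}$. On elements of odd degree, $j_n$ is symmetric. (2) For all $n\ge 1$ and all $a_1,\dots,a_n\in\Lambda^{\mathrm{odd}}$, $\mu_n^1(a_1,\dots,a_n)=j_n(a_1,\dots,a_n)$. (3) Let $a\in\Lambda^3(\mathbb Z^b)$, and let $K(a)$ be the Kraines construction over $\mathbb Q$: $K(a)_{2n+1}$ is the coefficient of $T^n$ in the $(B\Lambda_{\mathbb Q})_1$-component of $\exp(a)=\sum_{m\ge0}\frac{a_m}{m!}T^m$, with $a_0=1$, $a_m=\mu([a],a_{m-1})$. Then for all $n\ge1$, $n!\,a^{\circ n}=j_n(a,\dots,a)$ and $K(a)_{2n+1}=a^{\circ n}$. The sequence $K(a)$ is a twisting sequence in $\Lambda_{\mathbb Q}$, and it is defined over $\mathbb Z$: $(a^{\circ n})_{n\ge1}$ is a twisting sequence in $\Lambda$, that is, $a^{\circ n}\in\Lambda^{2n+1}$ and $d\,a^{\circ n}+\sum_{i+k=n,\ i,k\ge1}a^{\circ i}a^{\circ k}=0$ for all $n\geq 1$. -/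

import Mathlib

noncomputable section

namespace MinimalTorus

open scoped BigOperators

/-! ### Cubical chains on the standard cube

The faces of the `b`-cube are the strings of length `b` in the letters `0`, `1`, `I`. They form a
basis of the (normalized) cubical chains of the `b`-cube; all chains below are finitely supported
`ℤ`-valued functions on faces, or on tuples of faces for tensor powers of the chain complex. -/

/-- The letters `0`, `1`, `I`. -/
inductive Letter
  | zero
  | one
  | full
  deriving DecidableEq

/-- A face of the `b`-cube, as a string of letters. -/
abbrev Face (b : ℕ) := Fin b → Letter

/-- The positions of the letter `I` in a face. -/
def Face.dirs {b : ℕ} (F : Face b) : Finset (Fin b) :=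
  Finset.univ.filter fun i => F i = Letter.full

/-- The dimension of a face. -/
def Face.dim {b : ℕ} (F : Face b) : ℕ := F.dirs.card

/-- The cubical boundary. -/
def boundary {b : ℕ} (F : Face b) : Face b →₀ ℤ :=
  ∑ i ∈ F.dirs, (-1 : ℤ) ^ (F.dirs.filter (· < i)).card •
    (Finsupp.single (Function.update F i Letter.one) 1
      - Finsupp.single (Function.update F i Letter.zero) 1)

/-- The Cartan–Serre diagonal: the Koszul-signed tensor product of `Δ 0 = 0 ⊗ 0`, `Δ 1 = 1 ⊗ 1`,
`Δ I = 0 ⊗ I + I ⊗ 1`. The set `T` records the positions of `I` at which the term `I ⊗ 1` is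
chosen; moving the first factors to the front, an `I` at `j ∈ T` passes the `I`s of the second
factor at the positions `i < j`. -/
def diag {b : ℕ} (F : Face b) : (Face b × Face b) →₀ ℤ :=
  ∑ T ∈ F.dirs.powerset,
    Finsupp.single
      (fun i => if i ∈ F.dirs \ T then Letter.zero else F i,
        fun i => if i ∈ T then Letter.one else F i)
      ((-1 : ℤ) ^ (((F.dirs \ T) ×ˢ T).filter fun ij => ij.1 < ij.2).card)

/-- The join of two letters is this multiple of `I`: `0 * 1 = I`, `1 * 0 = -I`, and all other joins
vanish. -/
def letterJoin : Letter → Letter → ℤ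
  | Letter.zero, Letter.one => 1
  | Letter.one, Letter.zero => -1
  | _, _ => 0

/-- The join `x * y = (-1)^{|x|} ∑ᵢ ε(y_{<i}) ε(x_{>i}) x_{<i} (xᵢ * yᵢ) y_{>i}`. -/
def join {b : ℕ} (x y : Face b) : Face b →₀ ℤ :=
  ∑ i : Fin b,
    if (∀ k, k < i → y k ≠ Letter.full) ∧ (∀ k, i < k → x k ≠ Letter.full) then
      Finsupp.single (fun k => if k < i then x k else if k = i then Letter.full else y k)
        ((-1 : ℤ) ^ x.dim * letterJoin (x i) (y i))
    else 0

/-! ### The chain operations `e^{p,q}`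

An operation `C → C^{⊗ p} ⊗ C^{⊗ q}` is given by its values on faces. All signs are Koszul signs:
permuting tensor factors, and applying the join, which has degree one, to later tensor factors. -/

/-- An operation with one input and `p` (black) plus `q` (grey) outputs. -/
abbrev ChainOp (b p q : ℕ) := Face b → ((Fin p → Face b) × (Fin q → Face b)) →₀ ℤ

/-- The lower descendant of `G`: the input is split as `y ⊗ u ⊗ v`, then `G` is applied to `y`, the
strand `u` becomes a new last grey output, and `v` is joined from the right to the last black
output of `G`. -/
def lowerDescendant {b p q : ℕ} (G : ChainOp b (p + 1) q) : ChainOp b (p + 1) (q + 1) := fun F =>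
  (diag F).sum fun yw c₁ =>
  (diag yw.2).sum fun uv c₂ =>
  (G yw.1).sum fun o c₃ =>
  (join (o.1 (Fin.last p)) uv.2).sum fun z c₄ =>
    Finsupp.single
      ((Fin.snoc (Fin.init o.1) z : Fin (p + 1) → Face b),
        (Fin.snoc o.2 uv.1 : Fin (q + 1) → Face b))
      (c₁ * c₂ * c₃ * c₄ *
        (-1) ^ (uv.2.dim * (uv.1.dim + ∑ j, (o.2 j).dim) + ∑ i : Fin p, (o.1 i.castSucc).dim))

/-- The upper descendant of `G`: the input is split as `y ⊗ w`, then `G` is applied to `y`, the last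
black output of `G` is split as `u ⊗ v`, and `w` is joined from the right to `v`, which gives a new
last black output. -/
def upperDescendant {b p q : ℕ} (G : ChainOp b (p + 1) q) : ChainOp b (p + 2) q := fun F =>
  (diag F).sum fun yw c₁ =>
  (G yw.1).sum fun o c₂ =>
  (diag (o.1 (Fin.last p))).sum fun uv c₃ =>
  (join uv.2 yw.2).sum fun z c₄ =>
    Finsupp.single
      ((Fin.snoc (Fin.snoc (Fin.init o.1) uv.1 : Fin (p + 1) → Face b) z : Fin (p + 2) → Face b),
        o.2)
      (c₁ * c₂ * c₃ * c₄ *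
        (-1) ^ (yw.2.dim * (∑ j, (o.2 j).dim) + ∑ i : Fin p, (o.1 i.castSucc).dim + uv.1.dim))

/-- The operations `e^{p,q}`: the sum of the lower descendants of `e^{p,q-1}` and `(-1)^{q-1}` times
the upper descendants of `e^{p-1,q}`, starting from `e^{1,0} = e^{0,1} = id`. In particular
`e^{1,1} = (* ⊗ 1)(1 ⊗ τ)(Δ ⊗ 1)Δ`. -/
def chainOp (b : ℕ) : (p q : ℕ) → ChainOp b p q
  | 0, 0 => fun _ => 0
  | 0, 1 => fun F => Finsupp.single (Fin.elim0, fun _ => F) 1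
  | 0, _ + 2 => fun _ => 0
  | 1, 0 => fun F => Finsupp.single (fun _ => F, Fin.elim0) 1
  | _ + 2, 0 => fun _ => 0
  | 1, q + 1 => lowerDescendant (chainOp b 1 q)
  | p + 2, q + 1 => fun F =>
      lowerDescendant (chainOp b (p + 2) q) F
        + (-1 : ℤ) ^ q • upperDescendant (chainOp b (p + 1) (q + 1)) F

/-- The exponent of the sign relating `E_{p,q}` to the dual of `e^{p,q}`, for inputs of degrees
`d 0, …, d (p + q - 1)`: `1 + d 0 + d 2 + ⋯` if `p + q` is even, and `d 1 + d 3 + ⋯` if `p + q` is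
odd. -/
def hirschExponent (n : ℕ) (d : Fin n → ℕ) : ℕ :=
  if Even n then 1 + ∑ k ∈ Finset.univ.filter (fun k : Fin n => Even (k : ℕ)), d k
  else ∑ k ∈ Finset.univ.filter (fun k : Fin n => Odd (k : ℕ)), d k

/-! ### The exterior algebra as the cochains of the minimal torus -/

/-- The exterior algebra `Λ = Λ^*(R^b)`. -/
abbrev Lam (b : ℕ) (R : Type*) [CommRing R] := ExteriorAlgebra R (Fin b → R)

/-- The basis `e^I`, with `e^I` the ordered product of the `e^i`, `i ∈ I`. The subsets `I` of
`{1, …, b}` are the nondegenerate cubes of the minimal torus (the quotient of the `b`-cube by the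
identification of opposite faces), and `e^I` is identified with the cochain dual to the cube `I`. -/
def stdBasis (b : ℕ) (R : Type*) [CommRing R] : Module.Basis (Finset (Fin b)) R (Lam b R) :=
  (Pi.basisFun R (Fin b)).ExteriorAlgebra

section Cochains

variable {b : ℕ} {R : Type*} [CommRing R]

/-- The value of `x` on the cube `I` of the minimal torus, that is, the coefficient of `e^I`. -/
def coeffOn (I : Finset (Fin b)) : Lam b R →ₗ[R] R := (stdBasis b R).coord I

/-- A face of the `b`-cube which the quotient map, `F ↦ F.dirs`, sends to the cube `S`. (The chain
operations are natural for inclusions of faces, so another choice of such a face has no effect.) -/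
def faceOf (S : Finset (Fin b)) : Face b := fun i => if i ∈ S then Letter.full else Letter.zero

/-- The cubical coboundary of the minimal torus, `(d x)(S) = x(∂ S)`. -/
def coboundary : Lam b R →ₗ[R] Lam b R :=
  ∑ S : Finset (Fin b),
    ((boundary (faceOf S)).sum fun F c => (c : R) • coeffOn F.dirs).smulRight (stdBasis b R S)

/-- The Hirsch algebra operations
`E_{p,q}(x₁, …, x_p; y₁, …, y_q) = (-1)^ε (x₁ ⊗ ⋯ ⊗ x_p ⊗ y₁ ⊗ ⋯ ⊗ y_q) ∘ e^{p,q}`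
on the cochains of the minimal torus. -/
def hirschE (p q : ℕ) (x : Fin p → Lam b R) (y : Fin q → Lam b R) : Lam b R :=
  ∑ S : Finset (Fin b),
    ((chainOp b p q (faceOf S)).sum fun o c =>
      ((c * (-1) ^ hirschExponent (p + q)
          (Fin.append (fun i => (o.1 i).dim) (fun j => (o.2 j).dim)) : ℤ) : R) *
        ((∏ i, coeffOn (o.1 i).dirs (x i)) * ∏ j, coeffOn (o.2 j).dirs (y j))) •
      stdBasis b R S

/-- The cup-1 product `E_{1,1}`. -/
def cupOne (x y : Lam b R) : Lam b R := hirschE 1 1 (fun _ => x) (fun _ => y)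

/-- The part `Λ^odd` of odd degree. -/
def oddPart (b : ℕ) (R : Type*) [CommRing R] : Submodule R (Lam b R) :=
  ⨆ k : ℕ, ⋀[R]^(2 * k + 1) (Fin b → R)

end Cochains

/-! ### The bar construction and its product -/

/-- The augmentation ideal of `Λ`. -/
def augIdeal (b : ℕ) (R : Type*) [CommRing R] : Submodule R (Lam b R) :=
  LinearMap.ker (ExteriorAlgebra.algebraMapInv : Lam b R →ₐ[R] R).toLinearMap

/-- The cubes of positive dimension. -/
abbrev PosCube (b : ℕ) := {I : Finset (Fin b) // I.Nonempty}

section Bar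

variable (b : ℕ) (R : Type*) [CommRing R]

theorem stdBasis_mem_augIdeal (I : PosCube b) : stdBasis b R I.1 ∈ augIdeal b R := by
  have h : I.1.card = (I.1.card - 1) + 1 := (Nat.succ_pred_eq_of_pos I.2.card_pos).symm
  rw [augIdeal, LinearMap.mem_ker, stdBasis, ExteriorAlgebra.basis_apply_ofCard _ h,
    ExteriorAlgebra.ιMulti_family, ExteriorAlgebra.ιMulti_succ_apply]
  simp [ExteriorAlgebra.algebraMapInv]

theorem stdBasis_empty : stdBasis b R ∅ = 1 := by
  rw [stdBasis, ExteriorAlgebra.basis_apply_ofCard _ Finset.card_empty,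
    ExteriorAlgebra.ιMulti_family, ExteriorAlgebra.ιMulti_zero_apply]

/-- The `e^I` with `I` nonempty form a basis of the augmentation ideal. -/
def augBasis : Module.Basis (PosCube b) R (augIdeal b R) :=
  Module.Basis.mk (v := fun I => ⟨stdBasis b R I.1, stdBasis_mem_augIdeal b R I⟩)
    (LinearIndependent.of_comp (augIdeal b R).subtype
      ((stdBasis b R).linearIndependent.comp Subtype.val Subtype.val_injective))
    (by
      rintro ⟨x, hx⟩ -
      have key : x = ∑ I : PosCube b, (stdBasis b R).repr x I.1 • stdBasis b R I.1 := by
        have hs : x = ∑ I : Finset (Fin b), (stdBasis b R).repr x I • stdBasis b R I :=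
          ((stdBasis b R).sum_repr x).symm
        have hsplit : ∑ I : Finset (Fin b), (stdBasis b R).repr x I • stdBasis b R I =
            (stdBasis b R).repr x ∅ • (1 : Lam b R) +
              ∑ I : PosCube b, (stdBasis b R).repr x I.1 • stdBasis b R I.1 := by
          rw [← Finset.add_sum_erase _ _ (Finset.mem_univ ∅), stdBasis_empty]
          congr 1
          refine Finset.sum_subtype _ (fun I => ?_) _
          simp [Finset.nonempty_iff_ne_empty]
        have h0 : (stdBasis b R).repr x ∅ = 0 := by
          have h1 : ExteriorAlgebra.algebraMapInv x = (0 : R) := hx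
          have h2 : ∀ I : PosCube b,
              ExteriorAlgebra.algebraMapInv (stdBasis b R I.1) = (0 : R) :=
            fun I => stdBasis_mem_augIdeal b R I
          rw [hs, hsplit] at h1
          simpa [h2] using h1
        rw [h0, zero_smul, zero_add] at hsplit
        exact hs.trans hsplit
      have : (⟨x, hx⟩ : augIdeal b R) = ∑ I : PosCube b, (stdBasis b R).repr x I.1 •
          (⟨stdBasis b R I.1, stdBasis_mem_augIdeal b R I⟩ : augIdeal b R) :=
        Subtype.ext (by simpa using key)
      rw [this]
      exact Submodule.sum_mem _ fun I _ =>
        Submodule.smul_mem _ _ (Submodule.subset_span ⟨I, rfl⟩))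

/-- The bar construction `BΛ = ⨁ₙ Λ̄[-1]^{⊗ n}`, with `[a₁ | ⋯ | aₙ]` the product of the `aᵢ` in
the tensor algebra. -/
abbrev Bar := TensorAlgebra R (augIdeal b R)

/-- The basis of `BΛ` given by the `[e^{I₁} | ⋯ | e^{Iₙ}]`. -/
def barBasis : Module.Basis (FreeMonoid (PosCube b)) R (Bar b R) := (augBasis b R).tensorAlgebra

variable {b R}

/-- The element `[a]` of `(BΛ)₁`; here `a` is replaced by its image under the projection of `Λ` onto
the augmentation ideal along the span of the unit. -/
def bracket : Lam b R →ₗ[R] Bar b R :=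
  ∑ I : PosCube b, (coeffOn I.1).smulRight (TensorAlgebra.ι R (augBasis b R I))

/-- The `(BΛ)₁`-component of an element of `BΛ`, as an element of `Λ`. -/
def barOne : Bar b R →ₗ[R] Lam b R := (augIdeal b R).subtype ∘ₗ TensorAlgebra.ιInv

/-- The parity of the degree of `[e^{I₁} | ⋯ | e^{Iₙ}]` in `BΛ`, in which `[a]` has degree
`|a| - 1`. -/
def wordParity (u : List (PosCube b)) : ℕ := (u.map fun I => I.1.card + 1).sum

/-- `E_{p,q}` on basis elements given as two lists, of lengths `p` and `q`. -/
def hirschWord (u v : List (PosCube b)) : Lam b R :=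
  hirschE u.length v.length (fun i => stdBasis b R (u.get i).1) (fun j => stdBasis b R (v.get j).1)

variable (R)

/-- The component in `(BΛ)_k` of `μ([u] ⊗ [v])`. It is obtained by cutting both words into `k`
consecutive (possibly empty) pieces, moving the pieces of `v` into place with the Koszul sign, and
applying the operations `E_{p,q}` (with `E_{0,0} = 0`) to the `k` pairs of pieces. -/
def mulComponent : ℕ → List (PosCube b) → List (PosCube b) → Bar b R
  | 0, u, v => if u = [] ∧ v = [] then 1 else 0
  | k + 1, u, v =>
      ∑ i ∈ Finset.range (u.length + 1), ∑ j ∈ Finset.range (v.length + 1),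
        (-1 : R) ^ (wordParity (v.take j) * wordParity (u.drop i)) •
          (bracket (hirschWord (u.take i) (v.take j)) * mulComponent k (u.drop i) (v.drop j))

variable {R}

/-- The product `μ : BΛ ⊗ BΛ → BΛ`, as a bilinear map. (For words `u` and `v` the component in
`(BΛ)_k` vanishes if `k` exceeds the sum of the lengths.) -/
def barMul : Bar b R →ₗ[R] Bar b R →ₗ[R] Bar b R :=
  (barBasis b R).constr R fun u => (barBasis b R).constr R fun v =>
    ∑ k ∈ Finset.range (u.toList.length + v.toList.length + 1),
      mulComponent R k u.toList v.toList

/-- Iterated left multiplication: `μ₁(a) = [a]` and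
`μₙ(a₁, …, aₙ) = μ([a₁], μₙ₋₁(a₂, …, aₙ))`, with value the unit for `n = 0`. -/
def iterMul : List (Lam b R) → Bar b R
  | [] => 1
  | [a] => bracket a
  | a :: a' :: l => barMul (bracket a) (iterMul (a' :: l))

end Bar

/-! ### The insertion product -/

section Insertion

variable {b : ℕ}

/-- `u < v` are consecutive elements of `I`. -/
def Consecutive (I : Finset (Fin b)) (u v : Fin b) : Prop :=
  u ∈ I ∧ v ∈ I ∧ u < v ∧ ∀ w ∈ I, ¬ (u < w ∧ w < v)

/-- The simple graph underlying the graph realization of a family of subsets `I j`: the vertices are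
the elements of the union, and each `I j` contributes the path through its elements in increasing
order. -/
def realization {ι : Type*} (I : ι → Finset (Fin b)) : SimpleGraph {x : Fin b // ∃ j, x ∈ I j} :=
  SimpleGraph.fromRel fun u v => ∃ j, Consecutive (I j) u.1 v.1

/-- A family is 1-regular if its graph realization is a tree. The graph realization is a multigraph,
with one edge for each `j` and each pair of consecutive elements of `I j`; it is a tree if and only
if the underlying simple graph is a tree and no two edges are parallel. -/
def OneRegular {ι : Type*} (I : ι → Finset (Fin b)) : Prop :=
  (realization I).IsTree ∧
    ∀ j k u v, Consecutive (I j) u v → Consecutive (I k) u v → j = k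

/-- Each member of the list meets the union of `U` and the earlier members in exactly one point. -/
def MeetsOnceFrom : Finset (Fin b) → List (Finset (Fin b)) → Prop
  | _, [] => True
  | U, I :: l => (U ∩ I).card = 1 ∧ MeetsOnceFrom (U ∪ I) l

/-- Each member of the list but the first meets the union of the earlier ones in exactly one
point. -/
def MeetsOnce : List (Finset (Fin b)) → Prop
  | [] => True
  | I :: l => MeetsOnceFrom I l

/-- `l` lists the indices of the family `I`, without repetition, in an order for which each member
of the family meets the union of the earlier ones in exactly one point. -/
def IsInsertionOrder {ι : Type*} (I : ι → Finset (Fin b)) (l : List ι) : Prop :=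
  l.Nodup ∧ (∀ j, j ∈ l) ∧ MeetsOnce (l.map I)

variable {R : Type*} [CommRing R]

/-- The insertion of `e^I` into `e^J`, where `I` and `J` have odd cardinality: if `J ∩ I` is a
singleton `{k}` and `J = J₀ < {k} < J₁`, it is `e^{J₀} ∧ e^I ∧ e^{J₁}`; otherwise it is zero. -/
def insertBasis (J I : Finset (Fin b)) : Lam b R :=
  if (J ∩ I).card = 1 then
    ∑ k ∈ J ∩ I,
      stdBasis b R (J.filter (· < k)) * stdBasis b R I * stdBasis b R (J.filter (k < ·))
  else 0

/-- The bilinear extension of `insertBasis`. -/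
def insertion (x y : Lam b R) : Lam b R :=
  ∑ J : Finset (Fin b), ∑ I : Finset (Fin b), (coeffOn J x * coeffOn I y) • insertBasis J I

/-- The iterated product `(⋯((e^{I₁} ∘ e^{I₂}) ∘ e^{I₃}) ∘ ⋯) ∘ e^{Iₘ}` for a binary operation. -/
def iterProd (op : Lam b R → Lam b R → Lam b R) : List (Finset (Fin b)) → Lam b R
  | [] => 0
  | I :: l => l.foldl (fun x K => op x (stdBasis b R K)) (stdBasis b R I)

open Classical in
/-- The insertion product of the `e^{I j}`, for a finite family of sets `I j` of odd cardinality: if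
the family is 1-regular, reorder it so that each set meets the union of the earlier ones in one
point, and insert the sets successively (the result does not depend on the order); otherwise it
is zero. -/
def insertionOnBasis (R : Type*) [CommRing R] {ι : Type*} (I : ι → Finset (Fin b)) : Lam b R :=
  if OneRegular I then
    iterProd insertion ((Classical.epsilon fun l : List ι => IsInsertionOrder I l).map I)
  else 0

/-- The insertion product `jₙ`, extended multilinearly from basis elements. -/
def insertionProduct (b : ℕ) (R : Type*) [CommRing R] (n : ℕ) :
    MultilinearMap R (fun _ : Fin n => Lam b R) (Lam b R) :=
  ∑ I : Fin n → Finset (Fin b),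
    ((MultilinearMap.mkPiAlgebra R (Fin n) R).compLinearMap fun k => coeffOn (I k)).smulRight
      (insertionOnBasis R I)

/-- The insertion power `a^{∘ n}`: the sum of `a_{I₁} ⋯ a_{Iₙ} jₙ(e^{I₁}, …, e^{Iₙ})` over all
unordered 1-regular families `{I₁, …, Iₙ}` of `n` distinct subsets. -/
def insertionPower (a : Lam b R) (n : ℕ) : Lam b R :=
  ∑ s ∈ (Finset.univ : Finset (Finset (Fin b))).powersetCard n,
    (∏ I ∈ s, coeffOn I a) • insertionOnBasis R (fun I : {I // I ∈ s} => I.1)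

end Insertion

/-! ### Twisting sequences and the Kraines construction -/

/-- A twisting sequence in a graded algebra with differential `d`; the term `x n` is the element
`x_{2n+1}` of degree `2n+1`, for `n ≥ 1`. -/
def IsTwistingSequence {R A : Type*} [CommRing R] [Ring A] [Algebra R A] (𝒜 : ℕ → Submodule R A)
    (d : A →ₗ[R] A) (x : ℕ → A) : Prop :=
  ∀ n, 1 ≤ n → x n ∈ 𝒜 (2 * n + 1) ∧
    d (x n) + ∑ ij ∈ (Finset.HasAntidiagonal.antidiagonal n).filter (fun ij => 1 ≤ ij.1 ∧ 1 ≤ ij.2),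
      x ij.1 * x ij.2 = 0

section Kraines

variable {b : ℕ}

/-- For `a` of degree `2n+1`, `n ≥ 1`, the element `exp(a) = ∑ₘ (aₘ / m!) T^{nm}` of `BΛ[[T]]`, where
`a₀ = 1` and `aₘ = μ([a], aₘ₋₁)`. -/
def krainesExp (n : ℕ) (a : Lam b ℚ) : PowerSeries (Bar b ℚ) :=
  PowerSeries.mk fun k =>
    if n ∣ k then ((k / n).factorial : ℚ)⁻¹ • iterMul (List.replicate (k / n) a) else 0

/-- The Kraines construction on `a` of degree `2n+1`: `kraines n a k` is `K(a)_{2k+1}`, the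
coefficient of `T^k` in the `(BΛ)₁`-component of `exp(a)`. -/
def kraines (n : ℕ) (a : Lam b ℚ) (k : ℕ) : Lam b ℚ :=
  barOne (PowerSeries.coeff k (krainesExp n a))

/-- The inclusion of the exterior algebra over `ℤ` into the exterior algebra over `ℚ`. -/
def rationalize (x : Lam b ℤ) : Lam b ℚ :=
  ∑ I : Finset (Fin b), ((coeffOn I x : ℤ) : ℚ) • stdBasis b ℚ I

end Kraines

end MinimalTorus

end

/-!
On odd basis elements every operation in sight is a signed sum of words obtained by inserting some
`e^B` into others, and the theorem says that the combinatorics of these insertions is that of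
hypertrees: families of sets which can be listed so that each set meets the union of the earlier
ones in exactly one point.

*Well-definedness.* For `|I|` odd and `J ∩ I` a point, the insertion of `e^I` into `e^J` is
`± e^{J ∪ I}`, with the sign of the shuffle of `I \ J` and `J \ I` (`insertBasis_eq`). As `I \ J`
has an even number of elements, two insertions which are independent of each other commute, and the
sign of a successive insertion does not depend on the order (`attachSign_perm`), nor on the set or
point from which it starts (`rootedSign_change_root`). A family of nonempty sets is a hypertree if and
only if it is connected and has as many points as connectedness permits (`attachesTo_iff`); a graph
is a tree if and only if it is connected and has one edge less than vertices. Each set contributes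
one edge less than it has points, so that 1-regular families are the same as hypertrees
(`oneRegular_iff`).

*The operations.* In left multiplication by `[e^A]` only the operations `E_{0,1}` and `E_{1,q}`
occur. The recursion for `e^{1,q}` has lower descendants only, and shows that on odd basis elements
`E_{1,q}(e^A; e^{B₁}, …, e^{B_q})` is the sum over all `i₁ < ⋯ < i_q` in `A` with `i_k ∈ B_k` of the
word in which the letter `i_k` of `e^A` is replaced by `e^{B_k}` (`hirschE_one_stdBasis`); the sign
`(-1)^ε` cancels all signs of the chain operation. In particular `E_{1,1}` is insertion.

*Iterated multiplication.* By induction `μ([e^{I₁}], μ([e^{I₂}], ⋯))` is the sum of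
`± [e^{⋃ S₁} | ⋯ | e^{⋃ S_q}]` over all ordered partitions of the index set into hypertrees
(`iterMul_stdBasis`). The new set `A` either is not joined to the first hypertree, which then
stays the first letter, or belongs to the first letter itself together with the hypertrees inserted
into it. The latter terms add up to the hypertrees containing `A` (`forestSum_simInsert`), because a
hypertree with root `A` is decomposed uniquely at the first point of `A` to which something is
attached (`sum_branches`). The component in `(BΛ)₁` is contributed by the forests with a single
hypertree, which gives the insertion product.

*The Kraines construction.* In the multilinear expansion of `j_n(a, …, a)` with `a` of degree three,
two equal sets are never part of a 1-regular family, and each unordered family is listed `n!` times,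
with the same value; hence `j_n(a, …, a) = n! a^{∘ n}`. A hypertree of `n` triples has `2n + 1`
points. The twisting equation holds because the differential vanishes and odd elements anticommute.
-/

set_option linter.unusedSectionVars false

namespace MinimalTorus

/-! ### Shuffle signs -/

/-- The sign of the shuffle which sorts the concatenation of two disjoint increasing words with
letters `A` and `C`. As a product over `A × C` it is defined without disjointness, and it is
multiplicative in disjoint unions. -/
def shuffleSign {b : ℕ} (A C : Finset (Fin b)) : ℤ :=
  ∏ a ∈ A, ∏ c ∈ C, if c < a then -1 else 1

section ShuffleSign

variable {b : ℕ} {A A' C C' : Finset (Fin b)}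

theorem shuffleSign_union_left (h : Disjoint A A') :
    shuffleSign (A ∪ A') C = shuffleSign A C * shuffleSign A' C :=
  Finset.prod_union h

theorem shuffleSign_union_right (h : Disjoint C C') :
    shuffleSign A (C ∪ C') = shuffleSign A C * shuffleSign A C' := by
  simp only [shuffleSign, Finset.prod_union h, Finset.prod_mul_distrib]

@[simp] theorem shuffleSign_empty_left : shuffleSign ∅ C = 1 := by simp [shuffleSign]

@[simp] theorem shuffleSign_empty_right : shuffleSign A ∅ = 1 := by simp [shuffleSign]

theorem shuffleSign_eq_one_of_lt (h : ∀ a ∈ A, ∀ c ∈ C, a ≤ c) : shuffleSign A C = 1 :=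
  Finset.prod_eq_one fun a ha => Finset.prod_eq_one fun c hc => if_neg (h a ha c hc).not_gt

theorem shuffleSign_eq_neg_one_pow :
    shuffleSign A C = (-1) ^ ((A ×ˢ C).filter fun ac => ac.2 < ac.1).card := by
  rw [shuffleSign, ← Finset.prod_product', Finset.prod_ite, Finset.prod_const,
    Finset.prod_const_one, mul_one]

theorem shuffleSign_mul_self : shuffleSign A C * shuffleSign A C = 1 := by
  rw [shuffleSign_eq_neg_one_pow, ← mul_pow]; simp

theorem shuffleSign_mul_swap (h : Disjoint A C) :
    shuffleSign A C * shuffleSign C A = (-1) ^ (A.card * C.card) := by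
  rw [shuffleSign, shuffleSign, Finset.prod_comm (s := C), ← Finset.prod_mul_distrib, pow_mul',
    ← Finset.prod_const]
  refine Finset.prod_congr rfl fun a ha => ?_
  rw [← Finset.prod_mul_distrib, ← Finset.prod_const]
  refine Finset.prod_congr rfl fun c hc => ?_
  rcases lt_trichotomy a c with h1 | h1 | h1
  · simp [h1, h1.not_gt]
  · exact absurd (h1 ▸ hc) (Finset.disjoint_left.1 h ha)
  · simp [h1, h1.not_gt]

theorem shuffleSign_comm (h : Disjoint A C) (hA : Even A.card) :
    shuffleSign A C = shuffleSign C A := by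
  have h1 := shuffleSign_mul_swap h
  rw [(hA.mul_right _).neg_one_pow] at h1
  calc shuffleSign A C = shuffleSign A C * (shuffleSign C A * shuffleSign C A) := by
        rw [shuffleSign_mul_self, mul_one]
    _ = shuffleSign C A := by rw [← mul_assoc, h1, one_mul]

theorem isUnit_shuffleSign : IsUnit (shuffleSign A C) := .of_mul_eq_one _ shuffleSign_mul_self

end ShuffleSign

/-! ### Products of basis elements -/

section StdBasis

variable {b : ℕ} {R : Type*} [CommRing R]

theorem stdBasis_eq_prod (I : Finset (Fin b)) :
    stdBasis b R I =
      ((I.sort (· ≤ ·)).map fun i => ExteriorAlgebra.ι R (Pi.single i (1 : R))).prod := by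
  rw [stdBasis, ExteriorAlgebra.basis_apply_ofCard _ rfl, ExteriorAlgebra.ιMulti_family,
    ExteriorAlgebra.ιMulti_apply,
    ← Finset.listMap_orderEmbOfFin_finRange I rfl, List.map_map, List.ofFn_eq_map]
  congr 1
  refine List.map_congr_left fun k _ => ?_
  simp [Set.powersetCard.ofFinEmbEquiv_symm_apply, Pi.basisFun_apply]

theorem stdBasis_insert_min {i : Fin b} {J : Finset (Fin b)} (h : ∀ j ∈ J, i < j) :
    stdBasis b R (insert i J) = stdBasis b R {i} * stdBasis b R J := by
  have hi : i ∉ J := fun hi => lt_irrefl _ (h i hi)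
  rw [stdBasis_eq_prod, stdBasis_eq_prod, stdBasis_eq_prod,
    Finset.sort_insert (r := (· ≤ ·)) (fun j hj => (h j hj).le) hi]
  simp

theorem stdBasis_singleton_mul_comm (i j : Fin b) :
    stdBasis b R {i} * stdBasis b R {j} = - (stdBasis b R {j} * stdBasis b R {i}) := by
  simp only [stdBasis_eq_prod, Finset.sort_singleton, List.map_singleton, List.prod_singleton]
  exact eq_neg_of_add_eq_zero_left (ExteriorAlgebra.ι_add_mul_swap _ _)

theorem stdBasis_singleton_mul {i : Fin b} {J : Finset (Fin b)} (h : i ∉ J) :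
    stdBasis b R {i} * stdBasis b R J = shuffleSign {i} J • stdBasis b R (insert i J) := by
  induction J using Finset.induction_on_min with
  | empty => simp [stdBasis_empty]
  | insert j J hj ih =>
    have hjJ : j ∉ J := fun hi => lt_irrefl _ (hj j hi)
    have hij : i ≠ j := fun e => h (e ▸ Finset.mem_insert_self _ _)
    have hiJ : i ∉ J := fun e => h (Finset.mem_insert_of_mem e)
    rcases lt_or_gt_of_ne hij with hlt | hgt
    · have hall : ∀ k ∈ insert j J, i < k := by
        intro k hk
        rcases Finset.mem_insert.1 hk with rfl | hk
        · exact hlt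
        · exact hlt.trans (hj k hk)
      rw [← stdBasis_insert_min hall, shuffleSign_eq_one_of_lt, one_smul]
      intro a ha c hc
      rw [Finset.mem_singleton.1 ha]
      exact (hall c hc).le
    · have hall : ∀ k ∈ insert i J, j < k := by
        intro k hk
        rcases Finset.mem_insert.1 hk with rfl | hk
        · exact hgt
        · exact hj k hk
      have hs : shuffleSign {i} (insert j J) = - shuffleSign {i} J := by
        simp [shuffleSign, Finset.prod_insert hjJ, hgt]
      rw [stdBasis_insert_min hj, ← mul_assoc, stdBasis_singleton_mul_comm, neg_mul, mul_assoc,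
        ih hiJ, mul_smul_comm, ← stdBasis_insert_min hall, hs, neg_smul, Finset.insert_comm]

theorem stdBasis_mul_of_disjoint {I J : Finset (Fin b)} (h : Disjoint I J) :
    stdBasis b R I * stdBasis b R J = shuffleSign I J • stdBasis b R (I ∪ J) := by
  induction I using Finset.induction_on_min with
  | empty => simp [stdBasis_empty]
  | insert i I hi ih =>
    have hiI : i ∉ I := fun h => lt_irrefl _ (hi i h)
    rw [Finset.disjoint_insert_left] at h
    have hs1 : shuffleSign {i} (I ∪ J) = shuffleSign {i} J := by
      rw [shuffleSign_union_right h.2, shuffleSign_eq_one_of_lt, one_mul]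
      intro a ha c hc
      rw [Finset.mem_singleton.1 ha]
      exact (hi c hc).le
    have hs2 : shuffleSign (insert i I) J = shuffleSign {i} J * shuffleSign I J := by
      rw [Finset.insert_eq, shuffleSign_union_left (Finset.disjoint_singleton_left.2 hiI)]
    rw [stdBasis_insert_min hi, mul_assoc, ih h.2, mul_smul_comm,
      stdBasis_singleton_mul (by simp [hiI, h.1]), hs1, hs2, smul_smul, mul_comm,
      Finset.insert_union]

theorem stdBasis_mul_of_not_disjoint {I J : Finset (Fin b)} (h : ¬ Disjoint I J) :
    stdBasis b R I * stdBasis b R J = 0 :=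
  ExteriorAlgebra.basis_mul_of_not_disjoint (Pi.basisFun R (Fin b)) ⟨I, rfl⟩ ⟨J, rfl⟩ h

@[simp] theorem coeffOn_stdBasis (I J : Finset (Fin b)) :
    coeffOn I (stdBasis b R J) = if J = I then 1 else 0 := by
  simp [coeffOn, Finsupp.single_apply]

theorem sum_coeffOn (x : Lam b R) : ∑ I, coeffOn I x • stdBasis b R I = x :=
  (stdBasis b R).sum_repr x

/-- For `|I|` odd, the sign of the insertion of `e^I` into `e^J` at `k` depends on `I` and `J` only
through `I \ {k}` and `J \ {k}`, because the sets `I \ {k}` and `J_{<k}` commute. -/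
theorem insertBasis_eq {I J : Finset (Fin b)} (hI : Odd I.card) (h1 : (J ∩ I).card = 1) :
    (insertBasis J I : Lam b R) = shuffleSign (I \ J) (J \ I) • stdBasis b R (J ∪ I) := by
  obtain ⟨k, hk⟩ := Finset.card_eq_one.1 h1
  have hsd1 : I \ J = I.erase k := by
    rw [← Finset.sdiff_inter_self_left, Finset.inter_comm, hk, Finset.sdiff_singleton_eq_erase]
  have hsd2 : J \ I = J.erase k := by
    rw [← Finset.sdiff_inter_self_left, hk, Finset.sdiff_singleton_eq_erase]
  rw [hsd1, hsd2]
  have hkJ : k ∈ J := Finset.mem_of_mem_inter_left (hk ▸ Finset.mem_singleton_self k)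
  have hkI : k ∈ I := Finset.mem_of_mem_inter_right (hk ▸ Finset.mem_singleton_self k)
  have hout : ∀ x ∈ J, x ∈ I → x = k := fun x h1 h2 =>
    Finset.mem_singleton.1 (hk ▸ Finset.mem_inter.2 ⟨h1, h2⟩)
  set J0 := J.filter (· < k) with hJ0
  set J1 := J.filter (k < ·) with hJ1
  have hJe : J.erase k = J0 ∪ J1 := by
    ext x; simp only [hJ0, hJ1, Finset.mem_erase, Finset.mem_union, Finset.mem_filter, ne_eq]
    constructor
    · rintro ⟨h1, h2⟩; exact (lt_or_gt_of_ne h1).imp (fun h => ⟨h2, h⟩) (fun h => ⟨h2, h⟩)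
    · rintro (⟨h1, h2⟩ | ⟨h1, h2⟩)
      · exact ⟨h2.ne, h1⟩
      · exact ⟨h2.ne', h1⟩
  have d01 : Disjoint J0 J1 := Finset.disjoint_left.2 fun x h1 h2 =>
    lt_asymm (Finset.mem_filter.1 h1).2 (Finset.mem_filter.1 h2).2
  have d0I : Disjoint J0 I := Finset.disjoint_left.2 fun x h1 h2 =>
    (Finset.mem_filter.1 h1).2.ne (hout x (Finset.mem_filter.1 h1).1 h2)
  have d1I : Disjoint I J1 := Finset.disjoint_left.2 fun x h2 h1 =>
    (Finset.mem_filter.1 h1).2.ne' (hout x (Finset.mem_filter.1 h1).1 h2)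
  have hev : Even (I.erase k).card := by
    rw [Finset.card_erase_of_mem hkI]; exact Nat.Odd.sub_odd hI odd_one
  have hIe : I = {k} ∪ I.erase k := by rw [← Finset.insert_eq, Finset.insert_erase hkI]
  have dke : Disjoint {k} (I.erase k) := by simp
  have e1 : shuffleSign J0 I = shuffleSign (I.erase k) J0 := by
    conv_lhs => rw [hIe]
    rw [shuffleSign_union_right dke, shuffleSign_eq_one_of_lt, one_mul]
    · exact (shuffleSign_comm (d0I.symm.mono_left (Finset.erase_subset _ _)) hev).symm
    · intro a ha c hc
      rw [Finset.mem_singleton.1 hc]; exact (Finset.mem_filter.1 ha).2.le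
  have e2 : shuffleSign I J1 = shuffleSign (I.erase k) J1 := by
    conv_lhs => rw [hIe]
    rw [shuffleSign_union_left dke, shuffleSign_eq_one_of_lt, one_mul]
    intro a ha c hc
    rw [Finset.mem_singleton.1 ha]; exact (Finset.mem_filter.1 hc).2.le
  have e3 : shuffleSign J0 J1 = 1 := shuffleSign_eq_one_of_lt fun a ha c hc =>
    ((Finset.mem_filter.1 ha).2.trans (Finset.mem_filter.1 hc).2).le
  have hU : J0 ∪ I ∪ J1 = J ∪ I := by
    rw [Finset.union_right_comm, ← hJe]
    ext x; simp only [Finset.mem_union, Finset.mem_erase]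
    by_cases hx : x = k
    · simp [hx, hkI]
    · simp [hx]
  rw [insertBasis, hk, Finset.card_singleton, if_pos rfl, Finset.sum_singleton,
    stdBasis_mul_of_disjoint d0I, smul_mul_assoc,
    stdBasis_mul_of_disjoint (Finset.disjoint_union_left.2 ⟨d01, d1I⟩), smul_smul, hU,
    shuffleSign_union_left d0I, e1, e2, e3, hJe, shuffleSign_union_right d01, one_mul]

@[simp] theorem insertion_smul_left (s : ℤ) (x y : Lam b R) :
    insertion (s • x) y = s • insertion x y := by
  simp only [insertion, map_zsmul, smul_mul_assoc, Finset.smul_sum, smul_assoc]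

theorem insertion_stdBasis (I J : Finset (Fin b)) :
    insertion (stdBasis b R J) (stdBasis b R I) = insertBasis J I := by
  simp only [insertion, coeffOn_stdBasis]
  rw [Finset.sum_eq_single J, Finset.sum_eq_single I] <;> simp +contextual [eq_comm]

end StdBasis
/-! ### Successive insertions and their signs -/

section Lists

variable {b : ℕ}

/-- The union of `A` and the members of a list of sets. -/
def cover (A : Finset (Fin b)) (l : List (Finset (Fin b))) : Finset (Fin b) := l.foldl (· ∪ ·) A

@[simp] theorem cover_nil (A : Finset (Fin b)) : cover A [] = A := rfl

@[simp] theorem cover_cons (A X : Finset (Fin b)) (l : List (Finset (Fin b))) :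
    cover A (X :: l) = cover (A ∪ X) l := rfl

theorem cover_append (A : Finset (Fin b)) (l m : List (Finset (Fin b))) :
    cover A (l ++ m) = cover (cover A l) m := List.foldl_append

theorem mem_cover {A : Finset (Fin b)} {l : List (Finset (Fin b))} {x : Fin b} :
    x ∈ cover A l ↔ x ∈ A ∨ ∃ X ∈ l, x ∈ X := by
  induction l generalizing A with
  | nil => simp
  | cons X l ih => simp [ih, or_assoc]

theorem subset_cover (A : Finset (Fin b)) (l : List (Finset (Fin b))) : A ⊆ cover A l :=
  fun _ hx => mem_cover.2 (Or.inl hx)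

theorem cover_perm (A : Finset (Fin b)) {l m : List (Finset (Fin b))} (h : l.Perm m) :
    cover A l = cover A m := by
  ext x; simp [mem_cover, h.mem_iff]

/-- The sign of the successive insertion of the members of a list of odd sets into `e^A`, if each
of them meets the union of `A` and the earlier ones in exactly one point. -/
def attachSign : Finset (Fin b) → List (Finset (Fin b)) → ℤ
  | _, [] => 1
  | A, X :: l => shuffleSign (X \ A) (A \ X) * attachSign (A ∪ X) l

theorem attachSign_append (A : Finset (Fin b)) (l m : List (Finset (Fin b))) :
    attachSign A (l ++ m) = attachSign A l * attachSign (cover A l) m := by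
  induction l generalizing A with
  | nil => simp [attachSign]
  | cons X l ih => simp [attachSign, ih, mul_assoc]

theorem meetsOnceFrom_append {A : Finset (Fin b)} {l m : List (Finset (Fin b))} :
    MeetsOnceFrom A (l ++ m) ↔ MeetsOnceFrom A l ∧ MeetsOnceFrom (cover A l) m := by
  induction l generalizing A with
  | nil => simp [MeetsOnceFrom]
  | cons X l ih => simp [MeetsOnceFrom, ih, and_assoc]

theorem isUnit_attachSign (A : Finset (Fin b)) (l : List (Finset (Fin b))) :
    IsUnit (attachSign A l) := by
  induction l generalizing A with
  | nil => exact isUnit_one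
  | cons X l ih => exact isUnit_shuffleSign.mul (ih _)

theorem meetsOnceFrom_union_iff {A D : Finset (Fin b)} {l : List (Finset (Fin b))}
    (h : ∀ X ∈ l, Disjoint D X) : MeetsOnceFrom (A ∪ D) l ↔ MeetsOnceFrom A l := by
  induction l generalizing A with
  | nil => simp [MeetsOnceFrom]
  | cons X l ih =>
    have hX : (A ∪ D) ∩ X = A ∩ X := by
      rw [Finset.union_inter_distrib_right, Finset.disjoint_iff_inter_eq_empty.1 (h X (by simp)),
        Finset.union_empty]
    rw [MeetsOnceFrom, MeetsOnceFrom, hX, Finset.union_right_comm,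
      ih fun Y hY => h Y (List.mem_cons_of_mem _ hY)]

/-- Enlarging the root of an insertion by a set `D` which the insertion does not touch changes the
sign by moving the inserted points past `D`. -/
theorem attachSign_union {A D : Finset (Fin b)} {l : List (Finset (Fin b))}
    (h : Disjoint (cover A l) D) :
    attachSign (A ∪ D) l = attachSign A l * shuffleSign (cover A l \ A) D := by
  induction l generalizing A with
  | nil => simp [attachSign]
  | cons X l ih =>
    have hAX : A ∪ X ⊆ cover A (X :: l) := subset_cover (A ∪ X) l
    have hXD : Disjoint X D := h.mono_left (Finset.subset_union_right.trans hAX)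
    have hAD : Disjoint A D := h.mono_left (Finset.subset_union_left.trans hAX)
    have e1 : X \ (A ∪ D) = X \ A := by
      ext x
      have : x ∈ X → x ∉ D := fun h1 h2 => Finset.disjoint_left.1 hXD h1 h2
      simp only [Finset.mem_sdiff, Finset.mem_union]; tauto
    have e2 : (A ∪ D) \ X = A \ X ∪ D := by
      rw [Finset.union_sdiff_distrib, Finset.sdiff_eq_self_of_disjoint hXD.symm]
    have e3 : cover A (X :: l) \ A = X \ A ∪ (cover (A ∪ X) l \ (A ∪ X)) := by
      ext x
      have := @hAX x
      simp only [cover_cons, Finset.mem_sdiff, Finset.mem_union] at this ⊢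
      tauto
    rw [attachSign, attachSign, e1, e2, Finset.union_right_comm, ih h, e3,
      shuffleSign_union_right (hAD.mono_left Finset.sdiff_subset), shuffleSign_union_left]
    · ring
    · exact Finset.disjoint_left.2 fun x h1 h2 =>
        (Finset.mem_sdiff.1 h2).2 (Finset.mem_union_right _ (Finset.mem_sdiff.1 h1).1)

theorem even_card_sdiff {A X : Finset (Fin b)} (hX : Odd X.card) (h : (A ∩ X).card = 1) :
    Even (X \ A).card := by
  have h1 := Finset.card_sdiff_add_card_inter X A
  rw [Finset.inter_comm, h] at h1
  rw [← h1] at hX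
  rcases hX with ⟨m, hm⟩
  exact ⟨m, by omega⟩

/-- Two insertions at points of the root commute. -/
theorem attachSign_swap {A X Y : Finset (Fin b)} {l : List (Finset (Fin b))} (hY : Odd Y.card)
    (h : MeetsOnceFrom A (X :: Y :: l)) (hXY : (X ∩ (A ∪ Y)).card ≤ 1) :
    MeetsOnceFrom A (Y :: X :: l) ∧ attachSign A (X :: Y :: l) = attachSign A (Y :: X :: l) := by
  obtain ⟨h1, h2, h3⟩ := h
  have hsub : X ∩ Y ⊆ A := by
    have : A ∩ X = X ∩ (A ∪ Y) := Finset.eq_of_subset_of_card_le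
      (fun x hx => by simp only [Finset.mem_inter, Finset.mem_union] at hx ⊢; tauto) (by omega)
    intro x hx
    have hx' : x ∈ X ∩ (A ∪ Y) := by
      simp only [Finset.mem_inter, Finset.mem_union] at hx ⊢; tauto
    rw [← this] at hx'
    exact Finset.mem_of_mem_inter_left hx'
  have hsub' : ∀ x, x ∈ X → x ∈ Y → x ∈ A := fun x hx hy => hsub (Finset.mem_inter.2 ⟨hx, hy⟩)
  have e1 : (A ∪ X) ∩ Y = A ∩ Y := by
    ext x; have := hsub' x; simp only [Finset.mem_inter, Finset.mem_union]; tauto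
  have e2 : (A ∪ Y) ∩ X = A ∩ X := by
    ext x; have := hsub' x; simp only [Finset.mem_inter, Finset.mem_union]; tauto
  rw [e1] at h2
  refine ⟨⟨h2, by rw [e2]; exact h1, by rwa [Finset.union_right_comm]⟩, ?_⟩
  have e3 : Y \ (A ∪ X) = Y \ A := by
    ext x; have := hsub' x; simp only [Finset.mem_sdiff, Finset.mem_union]; tauto
  have e4 : X \ (A ∪ Y) = X \ A := by
    ext x; have := hsub' x; simp only [Finset.mem_sdiff, Finset.mem_union]; tauto
  have e5 : (A ∪ X) \ Y = A \ Y ∪ X \ A := by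
    ext x; have := hsub' x; simp only [Finset.mem_sdiff, Finset.mem_union]; tauto
  have e6 : (A ∪ Y) \ X = A \ X ∪ Y \ A := by
    ext x; have := hsub' x; simp only [Finset.mem_sdiff, Finset.mem_union]; tauto
  have d (B C : Finset (Fin b)) : Disjoint (A \ B) (C \ A) := Finset.disjoint_left.2
    fun x h1 h2 => (Finset.mem_sdiff.1 h2).2 (Finset.mem_sdiff.1 h1).1
  have d' : Disjoint (Y \ A) (X \ A) := Finset.disjoint_left.2 fun x h1 h2 =>
    (Finset.mem_sdiff.1 h2).2 (hsub' x (Finset.mem_sdiff.1 h2).1 (Finset.mem_sdiff.1 h1).1)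
  simp only [attachSign]
  rw [e3, e4, e5, e6, shuffleSign_union_right (d _ _), shuffleSign_union_right (d _ _),
    shuffleSign_comm d' (even_card_sdiff hY h2), Finset.union_right_comm]
  ring

theorem attachSign_move_last {A X : Finset (Fin b)} {l : List (Finset (Fin b))}
    (hl : ∀ Y ∈ l, Odd Y.card) (h : MeetsOnceFrom A (X :: l)) (hX : (X ∩ cover A l).card ≤ 1) :
    MeetsOnceFrom A (l ++ [X]) ∧ attachSign A (X :: l) = attachSign A (l ++ [X]) := by
  induction l generalizing A with
  | nil => exact ⟨h, rfl⟩
  | cons Y l ih =>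
    have hXY : (X ∩ (A ∪ Y)).card ≤ 1 :=
      (Finset.card_le_card (Finset.inter_subset_inter_left (subset_cover _ _))).trans hX
    obtain ⟨h1, h2⟩ := attachSign_swap (hl Y (by simp)) h hXY
    obtain ⟨h3, h4⟩ := ih (A := A ∪ Y) (fun Z hZ => hl Z (by simp [hZ])) h1.2 hX
    refine ⟨⟨h1.1, h3⟩, ?_⟩
    rw [h2, attachSign, h4]
    rfl

/-- The sign of a successive insertion does not depend on the order: the last set of one order can
be moved to the end of the other, since it meets the union of the root and all other sets in one
point only. -/
theorem attachSign_perm {A : Finset (Fin b)} {l m : List (Finset (Fin b))} (hlm : l.Perm m)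
    (hodd : ∀ X ∈ l, Odd X.card) (hl : MeetsOnceFrom A l) (hm : MeetsOnceFrom A m) :
    attachSign A l = attachSign A m := by
  induction l using List.reverseRecOn generalizing m with
  | nil => rw [List.nil_perm.1 hlm]
  | append_singleton l X ih =>
    have hXm : X ∈ m := hlm.subset (by simp)
    obtain ⟨p, q, rfl⟩ := List.append_of_mem hXm
    have hperm : l.Perm (p ++ q) := by
      have h1 : (X :: l).Perm (X :: (p ++ q)) :=
        (List.perm_append_singleton X l).symm.trans (hlm.trans List.perm_middle)
      exact h1.cons_inv
    have hl' := meetsOnceFrom_append.1 hl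
    have hm' := meetsOnceFrom_append.1 hm
    have hcov : cover (cover A p) q = cover A l := by
      rw [← cover_append, cover_perm A hperm]
    have hXc : (X ∩ cover (cover A p) q).card ≤ 1 := by
      rw [hcov, Finset.inter_comm]; exact hl'.2.1.le
    obtain ⟨h1, h2⟩ := attachSign_move_last (A := cover A p) (l := q)
      (fun Y hY => hodd Y (by simp [hperm.mem_iff, hY])) hm'.2 hXc
    have h3 := meetsOnceFrom_append.1 h1
    have h4 := ih hperm (fun Y hY => hodd Y (by simp [hY])) hl'.1
      (meetsOnceFrom_append.2 ⟨hm'.1, h3.1⟩)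
    rw [attachSign_append, attachSign_append, h2, attachSign_append, h4, attachSign_append, hcov,
      mul_assoc]

/-- Successive application of a binary operation which agrees with insertion on odd basis elements
meeting in one point; besides insertion itself this applies to the cup-1 product. -/
theorem foldl_insertion {R : Type*} [CommRing R] {op : Lam b R → Lam b R → Lam b R}
    (hop : ∀ (s : ℤ) (J I : Finset (Fin b)), Odd J.card → Odd I.card → (J ∩ I).card = 1 →
      op (s • stdBasis b R J) (stdBasis b R I) = s • insertBasis J I)
    {A : Finset (Fin b)} {l : List (Finset (Fin b))} (s : ℤ) (hA : Odd A.card)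
    (hodd : ∀ X ∈ l, Odd X.card) (hl : MeetsOnceFrom A l) :
    l.foldl (fun x K => op x (stdBasis b R K)) (s • stdBasis b R A) =
      (s * attachSign A l) • stdBasis b R (cover A l) := by
  induction l generalizing A s with
  | nil => simp [attachSign]
  | cons X l ih =>
    have hX := hodd X (by simp)
    rw [List.foldl_cons, hop s A X hA hX hl.1, insertBasis_eq hX hl.1, smul_smul,
      ih _ _ (fun Y hY => hodd Y (by simp [hY])) hl.2, attachSign, cover_cons, mul_assoc]
    rw [← Finset.union_sdiff_self_eq_union,
      Finset.card_union_of_disjoint Finset.disjoint_sdiff]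
    exact hA.add_even (even_card_sdiff hX hl.1)

end Lists
/-! ### Rooted hypertrees -/

section Rooted

variable {b : ℕ} {ι : Type*} [DecidableEq ι] (I : ι → Finset (Fin b))

theorem cover_map (A : Finset (Fin b)) (l : List ι) :
    cover A (l.map I) = A ∪ l.toFinset.biUnion I := by
  ext x; simp [mem_cover]

/-- The sets `I j`, `j ∈ S`, can be attached successively to the root `A`, each in exactly one
point: together with `A` they form a hypertree. -/
def AttachesTo (A : Finset (Fin b)) (S : Finset ι) : Prop :=
  ∃ l : List ι, l.Nodup ∧ l.toFinset = S ∧ MeetsOnceFrom A (l.map I)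

/-- The sets `I j`, `j ∈ S`, are connected to `A`: every set of points which contains `A`, and
contains each `I j` which it meets, contains all of them. -/
def ConnectedTo (A : Finset (Fin b)) (S : Finset ι) : Prop :=
  ∀ Z : Finset (Fin b), A ⊆ Z → (∀ j ∈ S, I j ⊆ Z ∨ Disjoint (I j) Z) → ∀ j ∈ S, I j ⊆ Z

variable {I}

theorem ConnectedTo.exists_inter_nonempty {A : Finset (Fin b)} {S : Finset ι}
    (h : ConnectedTo I A S) (hne : ∀ j, (I j).Nonempty) (hS : S.Nonempty) :
    ∃ j ∈ S, (A ∩ I j).Nonempty := by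
  by_contra! hcon
  obtain ⟨j, hj⟩ := hS
  have hd : ∀ j ∈ S, Disjoint (I j) A := fun j hj =>
    (Finset.disjoint_iff_inter_eq_empty.2 (hcon j hj)).symm
  have := h A subset_rfl (fun j hj => Or.inr (hd j hj)) j hj
  exact (hne j).ne_empty (disjoint_self.1 ((hd j hj).mono_right this))

theorem ConnectedTo.erase {A : Finset (Fin b)} {S : Finset ι} (h : ConnectedTo I A S) {j : ι} :
    ConnectedTo I (A ∪ I j) (S.erase j) := fun Z hZ hsat k hk =>
  h Z (Finset.subset_union_left.trans hZ)
    (fun i hi => by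
      by_cases hij : i = j
      · exact Or.inl (hij ▸ Finset.subset_union_right.trans hZ)
      · exact hsat i (Finset.mem_erase.2 ⟨hij, hi⟩))
    k (Finset.mem_of_mem_erase hk)

theorem union_biUnion_erase (A : Finset (Fin b)) {S : Finset ι} {j : ι} (hj : j ∈ S) :
    A ∪ I j ∪ (S.erase j).biUnion I = A ∪ S.biUnion I := by
  rw [← Finset.insert_erase hj, Finset.biUnion_insert, Finset.union_assoc,
    Finset.erase_insert_eq_erase, Finset.erase_idem]

/-- Connectedness bounds the number of points. -/
theorem ConnectedTo.card_le {A : Finset (Fin b)} {S : Finset ι} (h : ConnectedTo I A S)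
    (hne : ∀ j, (I j).Nonempty) :
    (A ∪ S.biUnion I).card + S.card ≤ A.card + ∑ j ∈ S, (I j).card := by
  induction hn : S.card generalizing A S with
  | zero => simp [Finset.card_eq_zero.1 hn]
  | succ n ih =>
    obtain ⟨j, hj, hAj⟩ := h.exists_inter_nonempty hne (Finset.card_pos.1 (by omega))
    have h1 := ih h.erase (by rw [Finset.card_erase_of_mem hj, hn]; rfl)
    rw [union_biUnion_erase A hj] at h1
    have h2 := Finset.card_union_add_card_inter A (I j)
    have h3 := Finset.add_sum_erase S (fun j => (I j).card) hj
    have h4 := hAj.card_pos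
    omega

/-- A hypertree is a connected hypergraph with as many points as connectedness permits. -/
theorem attachesTo_iff {A : Finset (Fin b)} {S : Finset ι} (hne : ∀ j, (I j).Nonempty) :
    AttachesTo I A S ↔ ConnectedTo I A S ∧
      (A ∪ S.biUnion I).card + S.card = A.card + ∑ j ∈ S, (I j).card := by
  constructor
  · rintro ⟨l, hnd, rfl, hl⟩
    induction l generalizing A with
    | nil => simp [ConnectedTo]
    | cons j l ih =>
      obtain ⟨hj, hl⟩ := hl
      obtain ⟨hjl, hnd⟩ := List.nodup_cons.1 hnd
      obtain ⟨h1, h2⟩ := ih hnd hl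
      have hjl' : j ∉ l.toFinset := by simpa using hjl
      have hjm : j ∈ (j :: l).toFinset := by simp
      have he : (j :: l).toFinset.erase j = l.toFinset := by
        rw [List.toFinset_cons, Finset.erase_insert hjl']
      have key : ∀ Z : Finset (Fin b), A ⊆ Z → (I j ⊆ Z ∨ Disjoint (I j) Z) → I j ⊆ Z := by
        intro Z hA hZ
        refine hZ.resolve_right fun hd => ?_
        have hpos : (A ∩ I j).Nonempty := Finset.card_pos.1 (by omega)
        obtain ⟨x, hx⟩ := hpos
        exact Finset.disjoint_left.1 hd (Finset.mem_of_mem_inter_right hx)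
          (hA (Finset.mem_of_mem_inter_left hx))
      constructor
      · intro Z hA hZ k hk
        have hjZ := key Z hA (hZ j hjm)
        rw [List.toFinset_cons, Finset.mem_insert] at hk
        rcases hk with rfl | hk
        · exact hjZ
        · exact h1 Z (Finset.union_subset hA hjZ)
            (fun i hi => hZ i (by rw [List.toFinset_cons]; exact Finset.mem_insert_of_mem hi)) k hk
      · have h3 := union_biUnion_erase (I := I) A hjm
        rw [he] at h3
        have h4 := Finset.card_union_add_card_inter A (I j)
        rw [← h3, List.toFinset_cons, Finset.card_insert_of_notMem hjl',
          Finset.sum_insert hjl']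
        omega
  · rintro ⟨h, hc⟩
    induction hn : S.card generalizing A S with
    | zero => exact ⟨[], List.nodup_nil, by simp [Finset.card_eq_zero.1 hn], trivial⟩
    | succ n ih =>
      obtain ⟨j, hj, hAj⟩ := h.exists_inter_nonempty hne (Finset.card_pos.1 (by omega))
      have h1 := (h.erase (j := j)).card_le hne
      have h2 := Finset.card_union_add_card_inter A (I j)
      have h3 := Finset.add_sum_erase S (fun j => (I j).card) hj
      have h4 := hAj.card_pos
      have h5 := Finset.card_erase_of_mem hj
      obtain ⟨l, hl1, hl2, hl3⟩ := ih (A := A ∪ I j) (S := S.erase j) h.erase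
        (by rw [union_biUnion_erase A hj] at h1 ⊢; omega) (by omega)
      rw [union_biUnion_erase A hj] at h1
      refine ⟨j :: l, List.nodup_cons.2 ⟨?_, hl1⟩, ?_, ?_, hl3⟩
      · intro hjl
        have : j ∈ l.toFinset := by simpa using hjl
        rw [hl2] at this
        exact Finset.notMem_erase j S this
      · rw [List.toFinset_cons, hl2, Finset.insert_erase hj]
      · omega

theorem attachesTo_empty (A : Finset (Fin b)) : AttachesTo I A ∅ :=
  ⟨[], List.nodup_nil, rfl, trivial⟩

/-- Points of the root at which nothing is attached are irrelevant. -/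
theorem attachesTo_union_iff {A D : Finset (Fin b)} {S : Finset ι}
    (h : Disjoint D (S.biUnion I)) : AttachesTo I (A ∪ D) S ↔ AttachesTo I A S := by
  have key : ∀ l : List ι, l.toFinset = S → ∀ X ∈ l.map I, Disjoint D X := by
    rintro l rfl X hX
    obtain ⟨j, hj, rfl⟩ := List.mem_map.1 hX
    exact h.mono_right (Finset.subset_biUnion_of_mem I (by simpa using hj))
  constructor
  · rintro ⟨l, h1, h2, h3⟩
    exact ⟨l, h1, h2, (meetsOnceFrom_union_iff (key l h2)).1 h3⟩
  · rintro ⟨l, h1, h2, h3⟩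
    exact ⟨l, h1, h2, (meetsOnceFrom_union_iff (key l h2)).2 h3⟩

variable (I)

open Classical in
/-- The sign of the insertion of all `I j`, `j ∈ S`, into `e^A`, or zero if the `I j` and `A` do not
form a hypertree. -/
noncomputable def rootedSign (A : Finset (Fin b)) (S : Finset ι) : ℤ :=
  if h : AttachesTo I A S then attachSign A (h.choose.map I) else 0

variable {I}

theorem rootedSign_eq_zero {A : Finset (Fin b)} {S : Finset ι} (h : ¬ AttachesTo I A S) :
    rootedSign I A S = 0 := dif_neg h

theorem rootedSign_eq (hodd : ∀ j, Odd (I j).card) {A : Finset (Fin b)} {l : List ι}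
    (hnd : l.Nodup) (hl : MeetsOnceFrom A (l.map I)) :
    rootedSign I A l.toFinset = attachSign A (l.map I) := by
  have h : AttachesTo I A l.toFinset := ⟨l, hnd, rfl, hl⟩
  obtain ⟨h1, h2, h3⟩ := h.choose_spec
  rw [rootedSign, dif_pos h]
  refine attachSign_perm ((List.perm_of_nodup_nodup_toFinset_eq h1 hnd h2).map I) ?_ h3 hl
  intro X hX
  obtain ⟨j, _, rfl⟩ := List.mem_map.1 hX
  exact hodd j

theorem isUnit_rootedSign {A : Finset (Fin b)} {S : Finset ι} (h : AttachesTo I A S) :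
    IsUnit (rootedSign I A S) := by
  rw [rootedSign, dif_pos h]; exact isUnit_attachSign _ _

theorem rootedSign_ne_zero_iff {A : Finset (Fin b)} {S : Finset ι} :
    rootedSign I A S ≠ 0 ↔ AttachesTo I A S :=
  ⟨fun h => by_contra fun h' => h (rootedSign_eq_zero h'), fun h => (isUnit_rootedSign h).ne_zero⟩

@[simp] theorem rootedSign_empty (A : Finset (Fin b)) : rootedSign I A ∅ = 1 := by
  have h := attachesTo_empty (I := I) A
  rw [rootedSign, dif_pos h]
  have h2 : h.choose = [] := by simpa using h.choose_spec.2.1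
  rw [h2]; rfl

theorem meetsOnceFrom_singleton_cons {i : Fin b} {a : ι} (hi : i ∈ I a) (l : List ι) :
    MeetsOnceFrom {i} ((a :: l).map I) ↔ MeetsOnceFrom (I a) (l.map I) := by
  have h1 : ({i} ∩ I a : Finset (Fin b)) = {i} := by simpa using hi
  have h2 : ({i} ∪ I a : Finset (Fin b)) = I a := by simpa using hi
  rw [List.map_cons, MeetsOnceFrom, h1, h2, Finset.card_singleton]
  simp

theorem attachSign_singleton_cons {i : Fin b} {a : ι} (hi : i ∈ I a) (l : List ι) :
    attachSign {i} ((a :: l).map I) = attachSign (I a) (l.map I) := by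
  have h1 : ({i} \ I a : Finset (Fin b)) = ∅ := by simpa using hi
  have h2 : ({i} ∪ I a : Finset (Fin b)) = I a := by simpa using hi
  rw [List.map_cons, attachSign, h1, h2, shuffleSign_empty_right, one_mul]

theorem nonempty_of_odd (hodd : ∀ j, Odd (I j).card) (j : ι) : (I j).Nonempty :=
  Finset.card_pos.1 (hodd j).pos

/-- The root of a hypertree may be enlarged from a point to a set of the family containing it. -/
theorem rootedSign_singleton (hodd : ∀ j, Odd (I j).card) {S : Finset ι} {i : Fin b} {a : ι}
    (ha : a ∈ S) (hi : i ∈ I a) : rootedSign I {i} S = rootedSign I (I a) (S.erase a) := by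
  have hne := nonempty_of_odd hodd
  have hiff : AttachesTo I {i} S → AttachesTo I (I a) (S.erase a) := by
    rw [attachesTo_iff hne, attachesTo_iff hne]
    rintro ⟨h1, h2⟩
    have h3 := h1.erase (j := a)
    have h4 : ({i} ∪ I a : Finset (Fin b)) = I a := by simpa using hi
    have h5 := union_biUnion_erase (I := I) {i} ha
    rw [h4] at h3 h5
    refine ⟨h3, ?_⟩
    have h6 := Finset.add_sum_erase S (fun j => (I j).card) ha
    have h7 := Finset.card_erase_of_mem ha
    have h8 := Finset.card_pos.2 ⟨a, ha⟩
    rw [h5]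
    simp only [Finset.card_singleton] at h2
    omega
  by_cases h : AttachesTo I (I a) (S.erase a)
  · obtain ⟨l, hnd, hl, hm⟩ := h
    have hal : a ∉ l := by
      intro h; have : a ∈ l.toFinset := by simpa using h
      rw [hl] at this; exact Finset.notMem_erase a S this
    have hS : (a :: l).toFinset = S := by rw [List.toFinset_cons, hl, Finset.insert_erase ha]
    rw [← hl, rootedSign_eq hodd hnd hm, ← attachSign_singleton_cons hi, ← hS,
      rootedSign_eq hodd (List.nodup_cons.2 ⟨hal, hnd⟩)
        ((meetsOnceFrom_singleton_cons hi l).2 hm)]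
  · rw [rootedSign_eq_zero h, rootedSign_eq_zero fun h' => h (hiff h')]

/-- The root may be moved freely: within one set of the family by `rootedSign_singleton`, and
hence, the family being connected, to any other point. -/
theorem rootedSign_change_root (hodd : ∀ j, Odd (I j).card) {S : Finset ι} {i i' : Fin b}
    (hi : i ∈ S.biUnion I) (hi' : i' ∈ S.biUnion I) :
    rootedSign I {i} S = rootedSign I {i'} S := by
  have key : ∀ i i', i' ∈ S.biUnion I → AttachesTo I {i} S →
      rootedSign I {i'} S = rootedSign I {i} S := by
    intro i i' hi' h
    obtain ⟨h1, -⟩ := (attachesTo_iff (nonempty_of_odd hodd)).1 h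
    obtain ⟨j, hj, hij⟩ := Finset.mem_biUnion.1 hi'
    have := h1 (Finset.univ.filter fun x => rootedSign I {x} S = rootedSign I {i} S) (by simp)
      (fun k hk => by
        by_cases hd : Disjoint (I k)
          (Finset.univ.filter fun x => rootedSign I {x} S = rootedSign I {i} S)
        · exact Or.inr hd
        · left
          obtain ⟨x, hx, hx'⟩ := Finset.not_disjoint_iff.1 hd
          intro y hy
          rw [Finset.mem_filter] at hx' ⊢
          exact ⟨Finset.mem_univ _, by
            rw [rootedSign_singleton hodd hk hy, ← hx'.2, rootedSign_singleton hodd hk hx]⟩)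
      j hj hij
    exact (Finset.mem_filter.1 this).2
  by_cases h : AttachesTo I {i} S
  · exact (key i i' hi' h).symm
  · by_cases h' : AttachesTo I {i'} S
    · exact key i' i hi h'
    · rw [rootedSign_eq_zero h, rootedSign_eq_zero h']

variable (I)

open Classical in
/-- The sign of the insertion product of the `e^{I j}`, `j ∈ S`, or zero if they do not form a
(nonempty) hypertree. -/
noncomputable def treeSign (S : Finset ι) : ℤ :=
  if h : (S.biUnion I).Nonempty then rootedSign I {h.choose} S else 0

variable {I}

theorem treeSign_eq (hodd : ∀ j, Odd (I j).card) {S : Finset ι} {i : Fin b}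
    (hi : i ∈ S.biUnion I) : treeSign I S = rootedSign I {i} S := by
  have h : (S.biUnion I).Nonempty := ⟨i, hi⟩
  rw [treeSign, dif_pos h]
  exact rootedSign_change_root hodd h.choose_spec hi

@[simp] theorem treeSign_empty : treeSign I ∅ = 0 := by simp [treeSign]

theorem treeSign_insert (hodd : ∀ j, Odd (I j).card) {S : Finset ι} {a : ι} (ha : a ∉ S) :
    treeSign I (insert a S) = rootedSign I (I a) S := by
  obtain ⟨i, hi⟩ := nonempty_of_odd hodd a
  have hm : a ∈ insert a S := Finset.mem_insert_self a S
  rw [treeSign_eq hodd (Finset.mem_biUnion.2 ⟨a, hm, hi⟩), rootedSign_singleton hodd hm hi,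
    Finset.erase_insert ha]

theorem nonempty_of_treeSign_ne_zero {S : Finset ι} (h : treeSign I S ≠ 0) :
    (S.biUnion I).Nonempty := by
  by_contra h'; exact h (dif_neg h')

/-- The number of points of a hypertree of odd sets is odd. -/
theorem odd_card_biUnion (hodd : ∀ j, Odd (I j).card) {S : Finset ι} (h : treeSign I S ≠ 0) :
    Odd (S.biUnion I).card := by
  obtain ⟨i, hi⟩ := nonempty_of_treeSign_ne_zero h
  rw [treeSign_eq hodd hi, rootedSign_ne_zero_iff, attachesTo_iff (nonempty_of_odd hodd)] at h
  have h2 := h.2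
  have h1 : ({i} ∪ S.biUnion I : Finset (Fin b)) = S.biUnion I := by simpa using hi
  rw [h1, Finset.card_singleton] at h2
  have h3 : ∀ S : Finset ι, Even (S.card + ∑ j ∈ S, (I j).card) := by
    intro S
    induction S using Finset.induction_on with
    | empty => simp
    | insert a S ha ih =>
      rw [Finset.card_insert_of_notMem ha, Finset.sum_insert ha]
      obtain ⟨m, hm⟩ := hodd a
      obtain ⟨k, hk⟩ := ih
      exact ⟨m + k + 1, by omega⟩
  obtain ⟨m, hm⟩ := h3 S
  refine ⟨m - S.card, ?_⟩
  have h5 : S.card ≤ ∑ j ∈ S, (I j).card := by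
    rw [Finset.card_eq_sum_ones]
    exact Finset.sum_le_sum fun j _ => (hodd j).pos
  omega

end Rooted
/-! ### Decomposition of a rooted hypertree at the first attaching point -/

section Decomposition

variable {b : ℕ} {ι : Type*} [DecidableEq ι] {I : ι → Finset (Fin b)}

/-- The data obtained from a hypertree with root `A` by looking at the first point `i` of the root
to which something is attached: the branch `T` at `i` and the rest of the hypertree, which is
attached to `A_{>i}`. -/
structure IsFirstBranch (I : ι → Finset (Fin b)) (A : Finset (Fin b)) (S T : Finset ι)
    (i : Fin b) : Prop where
  subset : T ⊆ S
  mem_root : i ∈ A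
  mem_branch : i ∈ T.biUnion I
  branch : AttachesTo I {i} T
  rest : AttachesTo I (A.filter (i < ·)) (S \ T)
  disjoint_left : Disjoint (A.filter (· < i)) (T.biUnion I)
  disjoint_right : Disjoint (T.biUnion I) (A.filter (i < ·) ∪ (S \ T).biUnion I)
  disjoint_left_right : Disjoint (A.filter (· < i)) (A.filter (i < ·) ∪ (S \ T).biUnion I)

namespace IsFirstBranch

variable {A : Finset (Fin b)} {S T : Finset ι} {i : Fin b}

theorem eq_union (h : IsFirstBranch I A S T i) : A = {i} ∪ A.erase i := by
  rw [← Finset.insert_eq, Finset.insert_erase h.mem_root]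

theorem erase_eq (A : Finset (Fin b)) (i : Fin b) :
    A.erase i = A.filter (· < i) ∪ A.filter (i < ·) := by
  ext x; simp only [Finset.mem_erase, Finset.mem_union, Finset.mem_filter]
  constructor
  · rintro ⟨h1, h2⟩
    exact (lt_or_gt_of_ne h1).imp (fun h => ⟨h2, h⟩) (fun h => ⟨h2, h⟩)
  · rintro (⟨h1, h2⟩ | ⟨h1, h2⟩)
    · exact ⟨h2.ne, h1⟩
    · exact ⟨h2.ne', h1⟩

theorem disjoint_erase (h : IsFirstBranch I A S T i) : Disjoint (T.biUnion I) (A.erase i) := by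
  rw [erase_eq, Finset.disjoint_union_right]
  exact ⟨h.disjoint_left.symm, h.disjoint_right.mono_right Finset.subset_union_left⟩

theorem sets_disjoint (h : IsFirstBranch I A S T i) {j : ι} (hj : j ∈ S \ T) :
    Disjoint (I j) (T.biUnion I) :=
  (h.disjoint_right.mono_right ((Finset.subset_biUnion_of_mem I hj).trans
    Finset.subset_union_right)).symm

/-- A hypertree is reassembled by attaching the branch and then the rest; in the exterior algebra
this is multiplication of the three factors. -/
theorem attachesTo_and_sign (hodd : ∀ j, Odd (I j).card) (h : IsFirstBranch I A S T i) :
    AttachesTo I A S ∧ rootedSign I A S =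
      rootedSign I {i} T * rootedSign I (A.filter (i < ·)) (S \ T) *
        (shuffleSign (A.filter (· < i)) (T.biUnion I) *
          shuffleSign (A.filter (· < i) ∪ T.biUnion I)
            (A.filter (i < ·) ∪ (S \ T).biUnion I)) := by
  obtain ⟨l₁, hn₁, hl₁, hm₁⟩ := h.branch
  obtain ⟨l₂, hn₂, hl₂, hm₂⟩ := h.rest
  set A0 := A.filter (· < i)
  set A1 := A.filter (i < ·)
  set B := T.biUnion I with hB
  set C := (S \ T).biUnion I with hC
  have hiB : ({i} ∪ B : Finset (Fin b)) = B :=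
    Finset.union_eq_right.2 (Finset.singleton_subset_iff.2 h.mem_branch)
  have hc₁ : cover {i} (l₁.map I) = B := by rw [cover_map, hl₁, hiB]
  have hc₂ : cover A1 (l₂.map I) = A1 ∪ C := by rw [cover_map, hl₂]
  have hA : A = {i} ∪ A.erase i := h.eq_union
  have hAe : A.erase i = A0 ∪ A1 := erase_eq A i
  have hm₁' : MeetsOnceFrom A (l₁.map I) := by
    rw [hA]
    refine (meetsOnceFrom_union_iff fun X hX => ?_).2 hm₁
    obtain ⟨j, hj, rfl⟩ := List.mem_map.1 hX
    exact (h.disjoint_erase.mono_left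
      (Finset.subset_biUnion_of_mem I (by rw [← hl₁]; simpa using hj))).symm
  have hcA : cover A (l₁.map I) = A1 ∪ (A0 ∪ B) := by
    rw [cover_map, hl₁, hA, Finset.union_right_comm, hiB, hAe]
    ext x; simp only [Finset.mem_union]; tauto
  have hD : Disjoint (A1 ∪ C) (A0 ∪ B) := Finset.disjoint_union_right.2
    ⟨h.disjoint_left_right.symm, h.disjoint_right.symm⟩
  have hm₂' : MeetsOnceFrom (cover A (l₁.map I)) (l₂.map I) := by
    rw [hcA]
    refine (meetsOnceFrom_union_iff fun X hX => ?_).2 hm₂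
    obtain ⟨j, hj, rfl⟩ := List.mem_map.1 hX
    exact (hD.mono_left ((Finset.subset_biUnion_of_mem I
      (by rw [← hl₂]; simpa using hj)).trans Finset.subset_union_right)).symm
  have hnd : (l₁ ++ l₂).Nodup := by
    refine List.nodup_append.2 ⟨hn₁, hn₂, fun x hx y hy hxy => ?_⟩
    have h1 : x ∈ T := by rw [← hl₁]; simpa using hx
    have h2 : y ∈ S \ T := by rw [← hl₂]; simpa using hy
    exact (Finset.mem_sdiff.1 h2).2 (hxy ▸ h1)
  have hS : (l₁ ++ l₂).toFinset = S := by
    rw [List.toFinset_append, hl₁, hl₂, Finset.union_sdiff_of_subset h.subset]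
  have hm : MeetsOnceFrom A ((l₁ ++ l₂).map I) := by
    rw [List.map_append, meetsOnceFrom_append]; exact ⟨hm₁', hm₂'⟩
  refine ⟨⟨_, hnd, hS, hm⟩, ?_⟩
  have s₁ : attachSign A (l₁.map I) =
      attachSign {i} (l₁.map I) * shuffleSign (B \ {i}) (A0 ∪ A1) := by
    have := attachSign_union (A := {i}) (D := A.erase i) (l := l₁.map I)
      (by rw [hc₁]; exact h.disjoint_erase)
    rwa [← hA, hc₁, hAe] at this
  have s₂ : attachSign (cover A (l₁.map I)) (l₂.map I) =
      attachSign A1 (l₂.map I) * shuffleSign ((A1 ∪ C) \ A1) (A0 ∪ B) := by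
    have := attachSign_union (A := A1) (D := A0 ∪ B) (l := l₂.map I) (by rw [hc₂]; exact hD)
    rwa [hc₂, ← hcA] at this
  have r : rootedSign I A S =
      rootedSign I {i} T * rootedSign I A1 (S \ T) *
        (shuffleSign (B \ {i}) (A0 ∪ A1) * shuffleSign ((A1 ∪ C) \ A1) (A0 ∪ B)) := by
    rw [← hl₂, ← hl₁, ← hS, rootedSign_eq hodd hnd hm, rootedSign_eq hodd hn₁ hm₁,
      rootedSign_eq hodd hn₂ hm₂, List.map_append, attachSign_append, s₁, s₂]
    ring
  -- Both `B \ {i}` and `(A1 ∪ C) \ A1` have an even number of points, so they can be moved around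
  -- freely.
  have hevB : Even (B \ {i}).card := by
    have hoB : Odd B.card := odd_card_biUnion hodd (by
      rw [treeSign_eq hodd h.mem_branch]; exact rootedSign_ne_zero_iff.2 h.branch)
    exact even_card_sdiff hoB (by
      rw [Finset.inter_comm, Finset.inter_singleton_of_mem h.mem_branch, Finset.card_singleton])
  have hevC : Even ((A1 ∪ C) \ A1).card := by
    rw [← hc₂]
    clear_value C B A0
    clear s₁ s₂ r hc₂ hm₂' hn₂ hl₂ hnd hS hm hC hcA
    generalize A1 = U at hm₂
    induction l₂ generalizing U with
    | nil => simp
    | cons j l ih =>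
      have e : cover U ((j :: l).map I) \ U =
          (I j \ U) ∪ (cover (U ∪ I j) (l.map I) \ (U ∪ I j)) := by
        have hs := subset_cover (U ∪ I j) (l.map I)
        ext x
        have := @hs x
        simp only [List.map_cons, cover_cons, Finset.mem_sdiff, Finset.mem_union] at this ⊢
        tauto
      rw [e, Finset.card_union_of_disjoint]
      · exact (even_card_sdiff (hodd j) hm₂.1).add (ih _ hm₂.2)
      · exact Finset.disjoint_left.2 fun x h1 h2 =>
          (Finset.mem_sdiff.1 h2).2 (Finset.mem_union_right _ (Finset.mem_sdiff.1 h1).1)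
  have dA : Disjoint A0 A1 := h.disjoint_left_right.mono_right Finset.subset_union_left
  have hBi : B = {i} ∪ B \ {i} := by
    rw [Finset.union_sdiff_of_subset (Finset.singleton_subset_iff.2 h.mem_branch)]
  have dBi : Disjoint {i} (B \ {i}) := Finset.disjoint_sdiff
  have hACs : A1 ∪ C = A1 ∪ (A1 ∪ C) \ A1 := by
    rw [Finset.union_sdiff_of_subset Finset.subset_union_left]
  have dACs : Disjoint A1 ((A1 ∪ C) \ A1) := Finset.disjoint_sdiff
  have t1 : shuffleSign A0 B = shuffleSign (B \ {i}) A0 := by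
    conv_lhs => rw [hBi]
    rw [shuffleSign_union_right dBi, shuffleSign_eq_one_of_lt, one_mul, shuffleSign_comm _ hevB]
    · exact h.disjoint_left.symm.mono_left Finset.sdiff_subset
    · intro a ha c hc
      rw [Finset.mem_singleton.1 hc]; exact (Finset.mem_filter.1 ha).2.le
  have t2 : shuffleSign B A1 = shuffleSign (B \ {i}) A1 := by
    conv_lhs => rw [hBi]
    rw [shuffleSign_union_left dBi, shuffleSign_eq_one_of_lt, one_mul]
    intro a ha c hc
    rw [Finset.mem_singleton.1 ha]; exact (Finset.mem_filter.1 hc).2.le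
  have t3 : shuffleSign A0 A1 = 1 := shuffleSign_eq_one_of_lt fun a ha c hc =>
    ((Finset.mem_filter.1 ha).2.trans (Finset.mem_filter.1 hc).2).le
  have t4 : shuffleSign (A0 ∪ B) (A1 ∪ C) =
      shuffleSign (B \ {i}) A1 * shuffleSign ((A1 ∪ C) \ A1) (A0 ∪ B) := by
    rw [shuffleSign_comm ((hD.mono_left Finset.sdiff_subset)) hevC]
    conv_lhs => rw [hACs]
    rw [shuffleSign_union_right dACs, shuffleSign_union_left h.disjoint_left, t2, t3, one_mul]
  rw [r, t1, t4, shuffleSign_union_right dA]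
  ring

/-- The branch is connected to `i`, while the rest is disjoint from it. -/
theorem subset_of (h : IsFirstBranch I A S T i) {T' : Finset ι} {i' : Fin b}
    (hodd : ∀ j, Odd (I j).card) (h' : IsFirstBranch I A S T' i') (hi : i = i') : T ⊆ T' := by
  have h1 := ((attachesTo_iff (nonempty_of_odd hodd)).1 h.branch).1
  intro j hj
  by_contra hjT'
  have hsub := h1 (T'.biUnion I) (Finset.singleton_subset_iff.2 (hi ▸ h'.mem_branch))
    (fun k hk => by
      by_cases hkT : k ∈ T'
      · exact Or.inl (Finset.subset_biUnion_of_mem I hkT)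
      · exact Or.inr (h'.sets_disjoint (Finset.mem_sdiff.2 ⟨h.subset hk, hkT⟩))) j hj
  have hd := h'.sets_disjoint (Finset.mem_sdiff.2 ⟨h.subset hj, hjT'⟩)
  exact (nonempty_of_odd hodd j).ne_empty (disjoint_self.1 (hd.mono_right hsub))

theorem not_lt (h : IsFirstBranch I A S T i) {x : Fin b} (hxA : x ∈ A) (hxS : x ∈ S.biUnion I) :
    ¬ x < i := by
  intro hlt
  have hx : x ∈ A.filter (· < i) := Finset.mem_filter.2 ⟨hxA, hlt⟩
  obtain ⟨j, hj, hxj⟩ := Finset.mem_biUnion.1 hxS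
  by_cases hjT : j ∈ T
  · exact Finset.disjoint_left.1 h.disjoint_left hx (Finset.mem_biUnion.2 ⟨j, hjT, hxj⟩)
  · exact Finset.disjoint_left.1 h.disjoint_left_right hx (Finset.mem_union_right _
      (Finset.mem_biUnion.2 ⟨j, Finset.mem_sdiff.2 ⟨hj, hjT⟩, hxj⟩))

theorem unique (hodd : ∀ j, Odd (I j).card) (h : IsFirstBranch I A S T i) {T' : Finset ι}
    {i' : Fin b} (h' : IsFirstBranch I A S T' i') : T = T' ∧ i = i' := by
  have hi : i = i' := by
    have h1 := h.not_lt h'.mem_root (Finset.biUnion_subset_biUnion_of_subset_left I h'.subset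
      h'.mem_branch)
    have h2 := h'.not_lt h.mem_root (Finset.biUnion_subset_biUnion_of_subset_left I h.subset
      h.mem_branch)
    exact le_antisymm (_root_.not_lt.1 h1) (_root_.not_lt.1 h2)
  exact ⟨(h.subset_of hodd h' hi).antisymm (h'.subset_of hodd h hi.symm), hi⟩

/-- The branch at the first point `i` of the root which is attached to something is the connected
component of `i`; that it is a hypertree, meeting the root in `i` only, follows by counting
points. -/
theorem exists_of_attachesTo (hodd : ∀ j, Odd (I j).card) (hS : S.Nonempty)
    (h : AttachesTo I A S) : ∃ T i, IsFirstBranch I A S T i := by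
  classical
  have hne := nonempty_of_odd hodd
  obtain ⟨hconn, hcard⟩ := (attachesTo_iff hne).1 h
  have hnonempty : (A ∩ S.biUnion I).Nonempty := by
    obtain ⟨j, hj, x, hx⟩ := hconn.exists_inter_nonempty hne hS
    exact ⟨x, Finset.mem_inter.2 ⟨Finset.mem_of_mem_inter_left hx,
      Finset.mem_biUnion.2 ⟨j, hj, Finset.mem_of_mem_inter_right hx⟩⟩⟩
  set i := (A ∩ S.biUnion I).min' hnonempty
  have hi : i ∈ A ∩ S.biUnion I := Finset.min'_mem _ _
  have hmin : ∀ x ∈ A, x ∈ S.biUnion I → i ≤ x := fun x h1 h2 =>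
    Finset.min'_le _ _ (Finset.mem_inter.2 ⟨h1, h2⟩)
  obtain ⟨hiA, hiS⟩ := Finset.mem_inter.1 hi
  obtain ⟨T, hT, hTmax⟩ := Finset.exists_max_image
    (S.powerset.filter fun T => i ∈ T.biUnion I ∧ ConnectedTo I {i} T) Finset.card (by
      obtain ⟨a, ha, hia⟩ := Finset.mem_biUnion.1 hiS
      refine ⟨{a}, Finset.mem_filter.2 ⟨by simpa using ha, by simpa using hia, ?_⟩⟩
      intro Z hZ hsat j hj
      refine (hsat j hj).resolve_right fun hd => ?_
      rw [Finset.mem_singleton.1 hj] at hd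
      exact Finset.disjoint_left.1 hd hia (hZ (Finset.mem_singleton_self i)))
  obtain ⟨hTS, hiT, hTc⟩ := Finset.mem_filter.1 hT
  rw [Finset.mem_powerset] at hTS
  have hclosed : ∀ j ∈ S \ T, Disjoint (I j) (T.biUnion I) := by
    intro j hj
    by_contra hd
    obtain ⟨hjS, hjT⟩ := Finset.mem_sdiff.1 hj
    have hmem : insert j T ∈
        S.powerset.filter fun T => i ∈ T.biUnion I ∧ ConnectedTo I {i} T := by
      refine Finset.mem_filter.2 ⟨Finset.mem_powerset.2 (Finset.insert_subset hjS hTS), ?_, ?_⟩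
      · rw [Finset.biUnion_insert]; exact Finset.mem_union_right _ hiT
      · intro Z hZ hsat k hk
        have hTZ := hTc Z hZ fun k hk => hsat k (Finset.mem_insert_of_mem hk)
        rcases Finset.mem_insert.1 hk with rfl | hk
        · refine (hsat k (Finset.mem_insert_self _ _)).resolve_right fun hdZ => hd ?_
          exact hdZ.mono_right (Finset.biUnion_subset.2 hTZ)
        · exact hTZ k hk
    have := hTmax _ hmem
    rw [Finset.card_insert_of_notMem hjT] at this
    omega
  set B := T.biUnion I with hB
  set C := (S \ T).biUnion I with hC
  have hBC : Disjoint B C := by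
    rw [hC, Finset.disjoint_biUnion_right]
    exact fun j hj => (hclosed j hj).symm
  have hSBC : S.biUnion I = B ∪ C := by
    rw [hB, hC, ← Finset.union_biUnion, Finset.union_sdiff_of_subset hTS]
  have hrest : ConnectedTo I (A \ B) (S \ T) := by
    intro Z hZ hsat j hj
    have := hconn (Z ∪ B) (fun x hx => by
        by_cases hxB : x ∈ B
        · exact Finset.mem_union_right _ hxB
        · exact Finset.mem_union_left _ (hZ (Finset.mem_sdiff.2 ⟨hx, hxB⟩)))
      (fun k hk => by
        by_cases hkT : k ∈ T
        · exact Or.inl ((Finset.subset_biUnion_of_mem I hkT).trans Finset.subset_union_right)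
        · have hk' := Finset.mem_sdiff.2 ⟨hk, hkT⟩
          exact (hsat k hk').imp (fun h => h.trans Finset.subset_union_left)
            (fun h => Finset.disjoint_union_right.2 ⟨h, hclosed k hk'⟩))
      j (Finset.sdiff_subset hj)
    intro x hx
    exact (Finset.mem_union.1 (this hx)).resolve_right
      (Finset.disjoint_left.1 (hclosed j hj) hx)
  have c1 := hTc.card_le hne
  have c2 := hrest.card_le hne
  rw [← hC] at c2
  have hiB : ({i} ∪ B : Finset (Fin b)) = B := by simpa using hiT
  rw [← hB, hiB, Finset.card_singleton] at c1
  have c3 : (A ∪ S.biUnion I).card = B.card + (A \ B ∪ C).card := by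
    rw [← Finset.card_union_of_disjoint, hSBC]
    · congr 1
      ext x; simp only [Finset.mem_union, Finset.mem_sdiff]; tauto
    · exact Finset.disjoint_union_right.2 ⟨Finset.disjoint_sdiff, hBC⟩
  have c4 : S.card = T.card + (S \ T).card := by
    rw [Finset.card_sdiff_of_subset hTS]; have := Finset.card_le_card hTS; omega
  have c5 : ∑ j ∈ S, (I j).card = ∑ j ∈ T, (I j).card + ∑ j ∈ S \ T, (I j).card := by
    rw [add_comm]; exact (Finset.sum_sdiff hTS).symm
  have c6 := Finset.card_sdiff_add_card_inter A B
  have c7 : 1 ≤ (A ∩ B).card := Finset.card_pos.2 ⟨i, Finset.mem_inter.2 ⟨hiA, hiT⟩⟩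
  have hAB : A ∩ B = {i} := by
    obtain ⟨x, hx⟩ := Finset.card_eq_one.1 (show (A ∩ B).card = 1 by omega)
    have : i ∈ A ∩ B := Finset.mem_inter.2 ⟨hiA, hiT⟩
    rw [hx, Finset.mem_singleton] at this
    rw [hx, this]
  have hABe : A \ B = A.filter (i < ·) ∪ A.filter (· < i) := by
    rw [← Finset.sdiff_inter_self_left, hAB, Finset.sdiff_singleton_eq_erase, erase_eq,
      Finset.union_comm]
  have hA0 : Disjoint (A.filter (· < i)) (B ∪ C) := Finset.disjoint_left.2 fun x h1 h2 => by
    rw [Finset.mem_filter] at h1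
    exact (hmin x h1.1 (hSBC ▸ h2)).not_gt h1.2
  have hA1B : Disjoint (A.filter (i < ·)) B := Finset.disjoint_left.2 fun x h1 h2 => by
    rw [Finset.mem_filter] at h1
    have : x ∈ A ∩ B := Finset.mem_inter.2 ⟨h1.1, h2⟩
    rw [hAB, Finset.mem_singleton] at this
    exact h1.2.ne' this
  refine ⟨T, i, hTS, hiA, hiT, (attachesTo_iff hne).2 ⟨hTc, ?_⟩, ?_,
    hA0.mono_right Finset.subset_union_left,
    Finset.disjoint_union_right.2 ⟨hA1B.symm, hBC⟩,
    Finset.disjoint_union_right.2 ⟨?_, hA0.mono_right Finset.subset_union_right⟩⟩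
  · rw [← hB, hiB, Finset.card_singleton]; omega
  · rw [← attachesTo_union_iff (hA0.mono_right Finset.subset_union_right), ← hABe]
    exact (attachesTo_iff hne).2 ⟨hrest, by rw [← hC]; omega⟩
  · exact Finset.disjoint_left.2 fun x h1 h2 =>
      lt_asymm (Finset.mem_filter.1 h1).2 (Finset.mem_filter.1 h2).2

end IsFirstBranch

theorem stdBasis_mul_mul {R : Type*} [CommRing R] (A B C : Finset (Fin b)) :
    stdBasis b R A * (stdBasis b R B * stdBasis b R C) =
      if Disjoint A B ∧ Disjoint B C ∧ Disjoint A C then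
        (shuffleSign A B * shuffleSign (A ∪ B) C) • stdBasis b R (A ∪ B ∪ C) else 0 := by
  split_ifs with h
  · rw [← mul_assoc, stdBasis_mul_of_disjoint h.1, smul_mul_assoc, stdBasis_mul_of_disjoint
      (Finset.disjoint_union_left.2 ⟨h.2.2, h.2.1⟩), smul_smul]
  · by_cases h1 : Disjoint A B
    · rw [← mul_assoc, stdBasis_mul_of_disjoint h1, smul_mul_assoc,
        stdBasis_mul_of_not_disjoint, smul_zero]
      rw [Finset.disjoint_union_left]; tauto
    · rw [← mul_assoc, stdBasis_mul_of_not_disjoint h1, zero_mul]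

/-- The signed sum over all ways of splitting off a branch at a point of the root has at most one
nonzero term, and it computes the sign of the hypertree. -/
theorem sum_branches {R : Type*} [CommRing R] (hodd : ∀ j, Odd (I j).card) (A : Finset (Fin b))
    {S : Finset ι} (hS : S.Nonempty) :
    ∑ T ∈ S.powerset, treeSign I T • ∑ i ∈ A ∩ T.biUnion I,
      stdBasis b R (A.filter (· < i)) * (stdBasis b R (T.biUnion I) *
        (rootedSign I (A.filter (i < ·)) (S \ T) •
          stdBasis b R (A.filter (i < ·) ∪ (S \ T).biUnion I))) =
      rootedSign I A S • stdBasis b R (A ∪ S.biUnion I) := by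
  classical
  have hterm : ∀ T ∈ S.powerset, ∀ i ∈ A ∩ T.biUnion I,
      treeSign I T • (stdBasis b R (A.filter (· < i)) * (stdBasis b R (T.biUnion I) *
        (rootedSign I (A.filter (i < ·)) (S \ T) •
          stdBasis b R (A.filter (i < ·) ∪ (S \ T).biUnion I)))) =
      if IsFirstBranch I A S T i then rootedSign I A S • stdBasis b R (A ∪ S.biUnion I) else 0 := by
    intro T hT i hi
    rw [Finset.mem_powerset] at hT
    obtain ⟨hiA, hiT⟩ := Finset.mem_inter.1 hi
    rw [treeSign_eq hodd hiT, mul_smul_comm, mul_smul_comm, smul_smul, stdBasis_mul_mul]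
    split_ifs with h1 h2 h2
    · rw [smul_smul, (h2.attachesTo_and_sign hodd).2]
      congr 2
      rw [← Finset.union_sdiff_of_subset hT, Finset.union_biUnion]
      rw [Finset.union_sdiff_of_subset hT]
      have := IsFirstBranch.erase_eq A i
      ext x
      have h3 := Finset.ext_iff.1 this x
      by_cases hx : x = i
      · subst hx; simp [hiA, hiT]
      · simp only [Finset.mem_erase, ne_eq, hx, not_false_eq_true, true_and] at h3
        simp only [Finset.mem_union, h3]; tauto
    · have : rootedSign I {i} T * rootedSign I (A.filter (i < ·)) (S \ T) = 0 := by
        by_contra h3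
        exact h2 ⟨hT, hiA, hiT, rootedSign_ne_zero_iff.1 (left_ne_zero_of_mul h3),
          rootedSign_ne_zero_iff.1 (right_ne_zero_of_mul h3), h1.1, h1.2.1, h1.2.2⟩
      rw [this, zero_smul]
    · exact absurd ⟨h2.disjoint_left, h2.disjoint_right, h2.disjoint_left_right⟩ h1
    · rw [smul_zero]
  rw [Finset.sum_congr rfl fun T hT => by
    rw [Finset.smul_sum, Finset.sum_congr rfl (hterm T hT)]]
  by_cases h : AttachesTo I A S
  · obtain ⟨T, i, hTi⟩ := IsFirstBranch.exists_of_attachesTo hodd hS h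
    rw [Finset.sum_eq_single T, Finset.sum_eq_single i, if_pos hTi]
    · intro i' _ hi'
      exact if_neg fun h' => hi' (h'.unique hodd hTi).2
    · intro h'; exact absurd (Finset.mem_inter.2 ⟨hTi.mem_root, hTi.mem_branch⟩) h'
    · intro T' _ hT'
      exact Finset.sum_eq_zero fun i' _ => if_neg fun h' => hT' (h'.unique hodd hTi).1
    · intro h'; exact absurd (Finset.mem_powerset.2 hTi.subset) h'
  · rw [rootedSign_eq_zero h, zero_smul]
    exact Finset.sum_eq_zero fun T _ => Finset.sum_eq_zero fun i _ =>
      if_neg fun h' => h (h'.attachesTo_and_sign hodd).1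

end Decomposition
/-! ### 1-regular families are hypertrees -/

section Regular

variable {b : ℕ}

open Classical in
/-- The pairs of consecutive elements of `X`. -/
noncomputable def consecutivePairs (X : Finset (Fin b)) : Finset (Fin b × Fin b) :=
  Finset.univ.filter fun p => Consecutive X p.1 p.2

theorem mem_consecutivePairs {X : Finset (Fin b)} {p : Fin b × Fin b} :
    p ∈ consecutivePairs X ↔ Consecutive X p.1 p.2 := by
  simp [consecutivePairs]

theorem exists_consecutive {X : Finset (Fin b)} {x y : Fin b} (hx : x ∈ X) (hy : y ∈ X)
    (hxy : x < y) : ∃ z, Consecutive X x z := by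
  have hne : (X.filter (x < ·)).Nonempty := ⟨y, Finset.mem_filter.2 ⟨hy, hxy⟩⟩
  have h := Finset.mem_filter.1 (Finset.min'_mem _ hne)
  exact ⟨_, hx, h.1, h.2, fun w hw hlt =>
    (Finset.min'_le _ _ (Finset.mem_filter.2 ⟨hw, hlt.1⟩)).not_gt hlt.2⟩

theorem card_consecutivePairs {X : Finset (Fin b)} (h : X.Nonempty) :
    (consecutivePairs X).card + 1 = X.card := by
  rw [← Finset.card_erase_add_one (X.max'_mem h)]
  congr 1
  refine Finset.card_bij (fun p _ => p.1) ?_ ?_ ?_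
  · intro p hp
    have hp := mem_consecutivePairs.1 hp
    exact Finset.mem_erase.2 ⟨(hp.2.2.1.trans_le (X.le_max' _ hp.2.1)).ne, hp.1⟩
  · rintro ⟨p1, p2⟩ hp ⟨q1, q2⟩ hq (rfl : p1 = q1)
    have hp := mem_consecutivePairs.1 hp
    have hq := mem_consecutivePairs.1 hq
    rcases lt_trichotomy p2 q2 with h1 | h1 | h1
    · exact absurd ⟨hp.2.2.1, h1⟩ (hq.2.2.2 p2 hp.2.1)
    · rw [h1]
    · exact absurd ⟨hq.2.2.1, h1⟩ (hp.2.2.2 q2 hq.2.1)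
  · intro x hx
    obtain ⟨hx1, hx2⟩ := Finset.mem_erase.1 hx
    obtain ⟨z, hz⟩ := exists_consecutive hx2 (X.max'_mem h) (lt_of_le_of_ne (X.le_max' _ hx2) hx1)
    exact ⟨(x, z), mem_consecutivePairs.2 hz, rfl⟩

variable {ι : Type*} [DecidableEq ι] {I : ι → Finset (Fin b)}

theorem realization_adj_of_consecutive {u v : {x : Fin b // ∃ j, x ∈ I j}} {j : ι}
    (h : Consecutive (I j) u.1 v.1) : (realization I).Adj u v :=
  (SimpleGraph.fromRel_adj _ _ _).2
    ⟨fun e => h.2.2.1.ne (congrArg Subtype.val e), Or.inl ⟨j, h⟩⟩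

theorem realization_reachable {j : ι} {x y : Fin b} (hx : x ∈ I j) (hy : y ∈ I j) :
    (realization I).Reachable ⟨x, j, hx⟩ ⟨y, j, hy⟩ := by
  have key : ∀ n : ℕ, ∀ x y (hx : x ∈ I j) (hy : y ∈ I j), x ≤ y → (y : ℕ) - x = n →
      (realization I).Reachable ⟨x, j, hx⟩ ⟨y, j, hy⟩ := by
    intro n
    induction n using Nat.strong_induction_on with
    | _ n ih =>
      intro x y hx hy hle hn
      rcases hle.eq_or_lt with rfl | hlt
      · exact SimpleGraph.Reachable.refl _
      · obtain ⟨z, hz⟩ := exists_consecutive hx hy hlt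
        have hzy : z ≤ y := not_lt.1 fun h => hz.2.2.2 y hy ⟨hlt, h⟩
        have h1 : (realization I).Adj ⟨x, j, hx⟩ ⟨z, j, hz.2.1⟩ :=
          realization_adj_of_consecutive hz
        have h2 := hz.2.2.1
        rw [Fin.lt_def] at h2 hlt
        rw [Fin.le_def] at hzy
        exact h1.reachable.trans (ih (y - z) (by omega) z y hz.2.1 hy hzy rfl)
  rcases le_total x y with h | h
  · exact key _ x y hx hy h rfl
  · exact (key _ y x hy hx h rfl).symm

variable [Fintype ι]

theorem realization_connected_iff {i : Fin b} (hi : i ∈ Finset.univ.biUnion I) :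
    (realization I).Connected ↔ ConnectedTo I {i} Finset.univ := by
  classical
  have hi' : ∃ j, i ∈ I j := by simpa using hi
  constructor
  · intro h Z hiZ hsat j _ x hx
    have h1 := h.preconnected ⟨i, hi'⟩ ⟨x, j, hx⟩
    rw [SimpleGraph.reachable_iff_reflTransGen] at h1
    have key : ∀ v : {x : Fin b // ∃ j, x ∈ I j},
        Relation.ReflTransGen (realization I).Adj ⟨i, hi'⟩ v → v.1 ∈ Z := by
      intro v hv
      induction hv with
      | refl => exact hiZ (Finset.mem_singleton_self i)
      | @tail u w _ huw ih =>
        have : ∃ k, u.1 ∈ I k ∧ w.1 ∈ I k := by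
          rcases ((SimpleGraph.fromRel_adj _ _ _).1 huw).2 with ⟨k, hk⟩ | ⟨k, hk⟩
          · exact ⟨k, hk.1, hk.2.1⟩
          · exact ⟨k, hk.2.1, hk.1⟩
        obtain ⟨k, hu, hw⟩ := this
        exact (hsat k (Finset.mem_univ k)).resolve_right
          (fun hd => Finset.disjoint_left.1 hd hu ih) hw
    exact key _ h1
  · intro h
    have key : ∀ x : {x : Fin b // ∃ j, x ∈ I j}, (realization I).Reachable ⟨i, hi'⟩ x := by
      rintro ⟨x, j, hx⟩
      have := h (Finset.univ.filter fun x =>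
          ∃ hx : ∃ j, x ∈ I j, (realization I).Reachable ⟨i, hi'⟩ ⟨x, hx⟩)
        (by
          rw [Finset.singleton_subset_iff, Finset.mem_filter]
          exact ⟨Finset.mem_univ _, hi', SimpleGraph.Reachable.refl _⟩)
        (fun k _ => by
          by_cases hd : Disjoint (I k) (Finset.univ.filter fun x =>
            ∃ hx : ∃ j, x ∈ I j, (realization I).Reachable ⟨i, hi'⟩ ⟨x, hx⟩)
          · exact Or.inr hd
          · left
            obtain ⟨z, hz, hz'⟩ := Finset.not_disjoint_iff.1 hd
            obtain ⟨-, _, hr⟩ := Finset.mem_filter.1 hz'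
            exact fun y hy => Finset.mem_filter.2
              ⟨Finset.mem_univ _, ⟨k, hy⟩, hr.trans (realization_reachable hz hy)⟩)
        j (Finset.mem_univ j) hx
      obtain ⟨-, _, hr⟩ := Finset.mem_filter.1 this
      exact hr
    have : Nonempty {x : Fin b // ∃ j, x ∈ I j} := ⟨⟨i, hi'⟩⟩
    exact SimpleGraph.Connected.mk fun u v => (key u).symm.trans (key v)

/-- The edges of the simple graph underlying the realization are the pairs which are consecutive in
some member of the family. -/
theorem card_realization_edgeSet :
    Nat.card (realization I).edgeSet =
      ((Finset.univ.sigma fun j => consecutivePairs (I j)).image Sigma.snd).card := by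
  classical
  set E := (Finset.univ.sigma fun j => consecutivePairs (I j)).image Sigma.snd
  have hE : ∀ p : E, ∃ j, Consecutive (I j) p.1.1 p.1.2 := by
    rintro ⟨p, hp⟩
    obtain ⟨⟨j, q⟩, hq, rfl⟩ := Finset.mem_image.1 hp
    exact ⟨j, mem_consecutivePairs.1 (Finset.mem_sigma.1 hq).2⟩
  rw [← Fintype.card_coe E, ← Nat.card_eq_fintype_card]
  refine (Nat.card_eq_of_bijective (fun p : E =>
    (⟨s(⟨p.1.1, (hE p).imp fun _ h => h.1⟩, ⟨p.1.2, (hE p).imp fun _ h => h.2.1⟩),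
      realization_adj_of_consecutive (hE p).choose_spec⟩ : (realization I).edgeSet)) ⟨?_, ?_⟩).symm
  · intro p q hpq
    obtain ⟨j, hj⟩ := hE p
    obtain ⟨k, hk⟩ := hE q
    have h := Sym2.eq_iff.1 (congrArg Subtype.val hpq)
    simp only [Subtype.mk.injEq] at h
    rcases h with ⟨h1, h2⟩ | ⟨h1, h2⟩
    · exact Subtype.ext (Prod.ext h1 h2)
    · have := hj.2.2.1
      rw [h1, h2] at this
      exact absurd this hk.2.2.1.not_gt
  · rintro ⟨e, he⟩
    induction e using Sym2.ind with
    | _ u v =>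
      have huv : (realization I).Adj u v := he
      rcases ((SimpleGraph.fromRel_adj _ _ _).1 huv).2 with ⟨k, hk⟩ | ⟨k, hk⟩
      · exact ⟨⟨(u.1, v.1), Finset.mem_image.2 ⟨⟨k, (u.1, v.1)⟩, Finset.mem_sigma.2
          ⟨Finset.mem_univ _, mem_consecutivePairs.2 hk⟩, rfl⟩⟩, rfl⟩
      · exact ⟨⟨(v.1, u.1), Finset.mem_image.2 ⟨⟨k, (v.1, u.1)⟩, Finset.mem_sigma.2
          ⟨Finset.mem_univ _, mem_consecutivePairs.2 hk⟩, rfl⟩⟩, Subtype.ext Sym2.eq_swap⟩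

/-- A connected graph has at least as many edges as a tree. Hence a connected realization is a tree
without parallel edges exactly if the total number of edges of the paths is that of a tree. -/
theorem oneRegular_iff (hne : ∀ j, (I j).Nonempty) {i : Fin b}
    (hi : i ∈ Finset.univ.biUnion I) : OneRegular I ↔ AttachesTo I {i} Finset.univ := by
  classical
  have hV : Nat.card {x : Fin b // ∃ j, x ∈ I j} = (Finset.univ.biUnion I).card := by
    rw [← Fintype.card_coe, ← Nat.card_eq_fintype_card]
    refine Nat.card_congr (Equiv.subtypeEquivRight fun x => ?_)
    simp
  have hU : ({i} ∪ Finset.univ.biUnion I : Finset (Fin b)) = Finset.univ.biUnion I :=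
    Finset.union_eq_right.2 (Finset.singleton_subset_iff.2 hi)
  have hsum : (Finset.univ.sigma fun j => consecutivePairs (I j)).card + Fintype.card ι =
      ∑ j, (I j).card := by
    rw [Finset.card_sigma, Fintype.card, Finset.card_eq_sum_ones Finset.univ,
      ← Finset.sum_add_distrib]
    exact Finset.sum_congr rfl fun j _ => card_consecutivePairs (hne j)
  have hinj : (∀ j k u v, Consecutive (I j) u v → Consecutive (I k) u v → j = k) ↔
      Set.InjOn Sigma.snd
        ((Finset.univ.sigma fun j => consecutivePairs (I j) : Finset _) :
          Set (Σ _ : ι, Fin b × Fin b)) := by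
    constructor
    · rintro h ⟨j, p⟩ hp ⟨k, q⟩ hq (rfl : p = q)
      have h1 := mem_consecutivePairs.1 (Finset.mem_sigma.1 (Finset.mem_coe.1 hp)).2
      have h2 := mem_consecutivePairs.1 (Finset.mem_sigma.1 (Finset.mem_coe.1 hq)).2
      obtain rfl := h j k _ _ h1 h2
      rfl
    · intro h j k u v hj hk
      have h1 : (⟨j, (u, v)⟩ : Σ _ : ι, Fin b × Fin b) ∈
          Finset.univ.sigma fun j => consecutivePairs (I j) :=
        Finset.mem_sigma.2 ⟨Finset.mem_univ _, mem_consecutivePairs.2 hj⟩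
      have h2 : (⟨k, (u, v)⟩ : Σ _ : ι, Fin b × Fin b) ∈
          Finset.univ.sigma fun j => consecutivePairs (I j) :=
        Finset.mem_sigma.2 ⟨Finset.mem_univ _, mem_consecutivePairs.2 hk⟩
      exact congrArg Sigma.fst (h h1 h2 rfl)
  rw [OneRegular, SimpleGraph.isTree_iff_connected_and_card, card_realization_edgeSet, hV, hinj,
    ← Finset.card_image_iff, realization_connected_iff hi, attachesTo_iff hne, hU,
    Finset.card_singleton, Finset.card_univ]
  have hle := Finset.card_image_le (s := Finset.univ.sigma fun j => consecutivePairs (I j))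
    (f := Sigma.snd)
  constructor
  · rintro ⟨⟨h1, h2⟩, h3⟩
    exact ⟨h1, by omega⟩
  · rintro ⟨h1, h2⟩
    have h3 := (realization_connected_iff hi).2 h1
    have h4 := h3.card_vert_le_card_edgeSet_add_one
    rw [card_realization_edgeSet, hV] at h4
    exact ⟨⟨h1, by omega⟩, by omega⟩

/-- The 1-regular families are the hypertrees. -/
theorem treeSign_univ_ne_zero_iff (hodd : ∀ j, Odd (I j).card) :
    treeSign I Finset.univ ≠ 0 ↔ OneRegular I := by
  constructor
  · intro h
    obtain ⟨i, hi⟩ := nonempty_of_treeSign_ne_zero h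
    rw [oneRegular_iff (nonempty_of_odd hodd) hi, ← rootedSign_ne_zero_iff, ← treeSign_eq hodd hi]
    exact h
  · intro h
    obtain ⟨i, j, hj⟩ := h.1.1.nonempty.some
    have hi : i ∈ Finset.univ.biUnion I := Finset.mem_biUnion.2 ⟨j, Finset.mem_univ j, hj⟩
    rw [treeSign_eq hodd hi, rootedSign_ne_zero_iff, ← oneRegular_iff (nonempty_of_odd hodd) hi]
    exact h

theorem exists_isInsertionOrder (hodd : ∀ j, Odd (I j).card) (h : OneRegular I) :
    ∃ l : List ι, IsInsertionOrder I l := by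
  obtain ⟨i, j, hj⟩ := h.1.1.nonempty.some
  have hi : i ∈ Finset.univ.biUnion I := Finset.mem_biUnion.2 ⟨j, Finset.mem_univ j, hj⟩
  obtain ⟨l, h1, h2, h3⟩ := (oneRegular_iff (nonempty_of_odd hodd) hi).1 h
  have hmem : ∀ j, j ∈ l := fun j => by
    rw [← List.mem_toFinset, h2]; exact Finset.mem_univ j
  refine ⟨l, h1, hmem, ?_⟩
  cases l with
  | nil => trivial
  | cons a l =>
    have hia : i ∈ I a := by
      have h4 := h3.1
      by_contra hia
      rw [Finset.singleton_inter_of_notMem hia] at h4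
      simp at h4
    exact (meetsOnceFrom_singleton_cons hia l).1 h3

/-- Successive insertion along any admissible order computes the sign of the hypertree. -/
theorem iterProd_eq [Nonempty ι] {R : Type*} [CommRing R] {op : Lam b R → Lam b R → Lam b R}
    (hop : ∀ (s : ℤ) (J I : Finset (Fin b)), Odd J.card → Odd I.card → (J ∩ I).card = 1 →
      op (s • stdBasis b R J) (stdBasis b R I) = s • insertBasis J I)
    (hodd : ∀ j, Odd (I j).card) {l : List ι} (hl : IsInsertionOrder I l) :
    iterProd op (l.map I) =
      treeSign I Finset.univ • stdBasis b R (Finset.univ.biUnion I) := by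
  obtain ⟨h1, h2, h3⟩ := hl
  have huniv : l.toFinset = Finset.univ := by
    ext j; simp [h2]
  cases l with
  | nil => exact absurd (h2 (Classical.arbitrary ι)) (by simp)
  | cons a l =>
    obtain ⟨hal, hnd⟩ := List.nodup_cons.1 h1
    have hal' : a ∉ l.toFinset := by simpa using hal
    have h4 := foldl_insertion hop 1 (hodd a) (fun X hX => by
      obtain ⟨j, _, rfl⟩ := List.mem_map.1 hX
      exact hodd j) h3
    have h5 : I a ∪ l.toFinset.biUnion I = Finset.univ.biUnion I := by
      rw [← huniv, List.toFinset_cons, Finset.biUnion_insert]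
    rw [← h5, ← huniv, List.toFinset_cons, treeSign_insert hodd hal', rootedSign_eq hodd hnd h3,
      ← cover_map]
    rw [one_smul, one_mul] at h4
    exact h4

theorem insertion_zsmul_stdBasis {R : Type*} [CommRing R] (s : ℤ) (J K : Finset (Fin b)) :
    insertion (s • stdBasis b R J) (stdBasis b R K) = s • insertBasis J K := by
  rw [insertion_smul_left, insertion_stdBasis]

/-- The insertion product of odd basis elements as a sign times a basis element; by
`treeSign_univ_ne_zero_iff` the sign vanishes exactly if the family is not 1-regular. -/
theorem insertionOnBasis_eq [Nonempty ι] {R : Type*} [CommRing R] (hodd : ∀ j, Odd (I j).card) :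
    insertionOnBasis R I = treeSign I Finset.univ • stdBasis b R (Finset.univ.biUnion I) := by
  rw [insertionOnBasis]
  split_ifs with h
  · exact iterProd_eq (fun s J K _ _ _ => insertion_zsmul_stdBasis s J K) hodd
      (Classical.epsilon_spec (exists_isInsertionOrder hodd h))
  · have : treeSign I Finset.univ = 0 :=
      not_not.1 fun h' => h ((treeSign_univ_ne_zero_iff hodd).1 h')
    rw [this, zero_smul]

theorem insertionProduct_stdBasis {R : Type*} [CommRing R] {n : ℕ} (I : Fin n → Finset (Fin b)) :
    insertionProduct b R n (fun k => stdBasis b R (I k)) = insertionOnBasis R I := by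
  simp only [insertionProduct, _root_.sum_apply, MultilinearMap.smulRight_apply,
    MultilinearMap.compLinearMap_apply, MultilinearMap.mkPiAlgebra_apply, coeffOn_stdBasis]
  rw [Finset.sum_eq_single I]
  · simp
  · intro J _ hJ
    obtain ⟨k, hk⟩ := Function.ne_iff.1 hJ
    rw [Finset.prod_eq_zero (Finset.mem_univ k) (if_neg (Ne.symm hk)), zero_smul]
  · simp

end Regular
/-! ### Simultaneous insertion -/

section SimInsert

variable {b : ℕ} (R : Type*) [CommRing R]

/-- The sum of all words obtained from `e^A` by replacing letters `i₁ < ⋯ < i_q` of `A`, where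
`i_k ∈ B_k`, by `e^{B₁}, …, e^{B_q}`. -/
noncomputable def simInsert : Finset (Fin b) → List (Finset (Fin b)) → Lam b R
  | A, [] => stdBasis b R A
  | A, B :: l => ∑ i ∈ A ∩ B, stdBasis b R (A.filter (· < i)) *
      (stdBasis b R B * simInsert (A.filter (i < ·)) l)

theorem simInsert_append_singleton (A : Finset (Fin b)) (l : List (Finset (Fin b)))
    (C : Finset (Fin b)) :
    simInsert R A (l ++ [C]) = ∑ i ∈ A ∩ C, simInsert R (A.filter (· < i)) l *
      (stdBasis b R C * stdBasis b R (A.filter (i < ·))) := by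
  induction l generalizing A with
  | nil => simp [simInsert]
  | cons B l ih =>
    simp only [List.cons_append, simInsert, ih, Finset.mul_sum, Finset.sum_mul]
    rw [Finset.sum_comm' (t' := A ∩ C) (s' := fun k => A.filter (· < k) ∩ B)]
    · refine Finset.sum_congr rfl fun k hk => Finset.sum_congr rfl fun i hi => ?_
      have hik : i < k := (Finset.mem_filter.1 (Finset.mem_of_mem_inter_left hi)).2
      have e1 : (A.filter (· < k)).filter (· < i) = A.filter (· < i) := by
        ext x; simp only [Finset.mem_filter]
        exact ⟨fun h => ⟨h.1.1, h.2⟩, fun h => ⟨⟨h.1, h.2.trans hik⟩, h.2⟩⟩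
      have e2 : (A.filter (i < ·)).filter (k < ·) = A.filter (k < ·) := by
        ext x; simp only [Finset.mem_filter]
        exact ⟨fun h => ⟨h.1.1, h.2⟩, fun h => ⟨⟨h.1, hik.trans h.2⟩, h.2⟩⟩
      rw [e1, e2, Finset.filter_comm]
      simp only [mul_assoc]
    · intro i k
      simp only [Finset.mem_inter, Finset.mem_filter]
      tauto

end SimInsert

/-! ### The operations with one black output -/

section ChainOp

variable {b : ℕ}

/-- The face with the letter `I` on `V`, the letter `1` on the rest of `S`, and `0` elsewhere. -/
def onesFace (S V : Finset (Fin b)) : Face b :=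
  fun i => if i ∈ V then Letter.full else if i ∈ S then Letter.one else Letter.zero

/-- The first factor of the term of the diagonal of `F` belonging to `T`. -/
def firstFactor (F : Face b) (T : Finset (Fin b)) : Face b :=
  fun i => if i ∈ F.dirs \ T then Letter.zero else F i

theorem mem_dirs {F : Face b} {i : Fin b} : i ∈ F.dirs ↔ F i = Letter.full := by
  simp [Face.dirs]

@[simp] theorem dirs_faceOf (S : Finset (Fin b)) : (faceOf S).dirs = S := by
  ext i; simp [Face.dirs, faceOf]

@[simp] theorem dirs_onesFace (S V : Finset (Fin b)) : (onesFace S V).dirs = V := by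
  ext i
  rw [mem_dirs, onesFace]
  split_ifs <;> simp [*]

theorem dirs_firstFactor {F : Face b} {T : Finset (Fin b)} (h : T ⊆ F.dirs) :
    (firstFactor F T).dirs = T := by
  ext i
  have := @h i
  simp only [firstFactor, mem_dirs, Finset.mem_sdiff] at this ⊢
  split_ifs with h1
  · simp [h1.2]
  · tauto

theorem firstFactor_faceOf {S T : Finset (Fin b)} (h : T ⊆ S) :
    firstFactor (faceOf S) T = faceOf T := by
  funext i
  have := @h i
  simp only [firstFactor, dirs_faceOf, Finset.mem_sdiff, faceOf]
  split_ifs <;> tauto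

theorem diag_sum {M : Type*} [AddCommGroup M] (F : Face b) (g : Face b × Face b → M) :
    ((diag F).sum fun p c => c • g p) = ∑ T ∈ F.dirs.powerset,
      shuffleSign T (F.dirs \ T) •
        g (firstFactor F T, fun i => if i ∈ T then Letter.one else F i) := by
  have h : ((diag F).sum fun p c => c • g p) = Finsupp.linearCombination ℤ g (diag F) := rfl
  rw [h, diag, map_sum]
  refine Finset.sum_congr rfl fun T _ => ?_
  rw [Finsupp.linearCombination_single, shuffleSign_eq_neg_one_pow]
  congr 2
  refine Finset.card_bij (fun p _ => (p.2, p.1)) ?_ ?_ ?_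
  · rintro ⟨i, j⟩ h
    simpa [and_comm, and_assoc, and_left_comm] using h
  · rintro ⟨i, j⟩ _ ⟨i', j'⟩ _ h
    simpa [and_comm] using h
  · rintro ⟨i, j⟩ h
    refine ⟨(j, i), ?_, rfl⟩
    simpa [and_comm, and_assoc, and_left_comm] using h

theorem join_sum {M : Type*} [AddCommGroup M] (x y : Face b) (g : Face b → M) :
    ((join x y).sum fun z c => c • g z) = ∑ i : Fin b,
      if (∀ k, k < i → y k ≠ Letter.full) ∧ (∀ k, i < k → x k ≠ Letter.full) then
        ((-1 : ℤ) ^ x.dim * letterJoin (x i) (y i)) •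
          g (fun k => if k < i then x k else if k = i then Letter.full else y k)
      else 0 := by
  have h : ((join x y).sum fun z c => c • g z) = Finsupp.linearCombination ℤ g (join x y) := rfl
  rw [h, join, map_sum]
  refine Finset.sum_congr rfl fun i _ => ?_
  split_ifs
  · rw [Finsupp.linearCombination_single]
  · rw [map_zero]

theorem lowerDescendant_eq {q : ℕ} (G : ChainOp b 1 q) (F : Face b) :
    lowerDescendant (p := 0) G F =
      (diag F).sum fun yw c₁ => c₁ • (diag yw.2).sum fun uv c₂ => c₂ •
        (G yw.1).sum fun o c₃ => c₃ • (join (o.1 0) uv.2).sum fun z c₄ => c₄ •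
          (((-1 : ℤ) ^ (uv.2.dim * (uv.1.dim + ∑ j, (o.2 j).dim))) •
            Finsupp.single ((fun _ => z : Fin (0 + 1) → Face b),
              (Fin.snoc o.2 uv.1 : Fin (q + 1) → Face b)) 1) := by
  have hsnoc : ∀ (f : Fin 0 → Face b) (z : Face b),
      (Fin.snoc f z : Fin (0 + 1) → Face b) = fun _ => z := fun f z => by
    funext k
    rw [Fin.fin_one_eq_zero k]
    rfl
  have hlast : (Fin.last 0 : Fin (0 + 1)) = 0 := rfl
  simp only [lowerDescendant, Finsupp.smul_sum, Finsupp.smul_single, smul_eq_mul, mul_one,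
    mul_assoc, Finset.univ_eq_empty, Finset.sum_empty, add_zero, hsnoc, hlast]

theorem diag_faceOf_sum {M : Type*} [AddCommGroup M] (S : Finset (Fin b))
    (g : Face b → Face b → M) :
    ((diag (faceOf S)).sum fun p c => c • g p.1 p.2) =
      ∑ T ∈ S.powerset, shuffleSign T (S \ T) • g (faceOf T) (onesFace S (S \ T)) := by
  rw [diag_sum (faceOf S) fun p => g p.1 p.2, dirs_faceOf]
  refine Finset.sum_congr rfl fun T hT => ?_
  rw [Finset.mem_powerset] at hT
  have h2 : (fun i => if i ∈ T then Letter.one else faceOf S i) = onesFace S (S \ T) := by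
    funext i
    have := @hT i
    simp only [faceOf, onesFace, Finset.mem_sdiff]
    split_ifs <;> tauto
  rw [h2, firstFactor_faceOf hT]

theorem diag_onesFace_sum {M : Type*} [AddCommGroup M] (S W : Finset (Fin b))
    (g : Face b → Face b → M) (hW : W ⊆ S) :
    ((diag (onesFace S W)).sum fun p c => c • g p.1 p.2) =
      ∑ U ∈ W.powerset, shuffleSign U (W \ U) •
        g (firstFactor (onesFace S W) U) (onesFace S (W \ U)) := by
  rw [diag_sum (onesFace S W) fun p => g p.1 p.2, dirs_onesFace]
  refine Finset.sum_congr rfl fun U hU => ?_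
  rw [Finset.mem_powerset] at hU
  have h3 : (fun i => if i ∈ U then Letter.one else onesFace S W i) = onesFace S (W \ U) := by
    funext i
    have h1 := @hU i
    have h2 := @hW i
    simp only [onesFace, Finset.mem_sdiff]
    split_ifs <;> tauto
  rw [h3]

theorem lowerDescendant_faceOf {q : ℕ} (G : ChainOp b 1 q) (S : Finset (Fin b)) :
    lowerDescendant (p := 0) G (faceOf S) =
      ∑ T ∈ S.powerset, shuffleSign T (S \ T) • ∑ U ∈ (S \ T).powerset,
        shuffleSign U ((S \ T) \ U) • (G (faceOf T)).sum fun o c => c •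
          (join (o.1 0) (onesFace S ((S \ T) \ U))).sum fun z c' => c' •
            (((-1 : ℤ) ^ ((onesFace S ((S \ T) \ U)).dim *
                ((firstFactor (onesFace S (S \ T)) U).dim + ∑ j, (o.2 j).dim))) •
              Finsupp.single ((fun _ => z : Fin (0 + 1) → Face b),
                (Fin.snoc o.2 (firstFactor (onesFace S (S \ T)) U) : Fin (q + 1) → Face b)) 1) := by
  rw [lowerDescendant_eq]
  refine (diag_faceOf_sum S fun y w => (diag w).sum fun uv c₂ => c₂ •
        (G y).sum fun o c₃ => c₃ • (join (o.1 0) uv.2).sum fun z c₄ => c₄ •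
          (((-1 : ℤ) ^ (uv.2.dim * (uv.1.dim + ∑ j, (o.2 j).dim))) •
            Finsupp.single ((fun _ => z : Fin (0 + 1) → Face b),
              (Fin.snoc o.2 uv.1 : Fin (q + 1) → Face b)) 1)).trans ?_
  refine Finset.sum_congr rfl fun T _ => congrArg _ ?_
  exact diag_onesFace_sum S (S \ T) (fun u v =>
        (G (faceOf T)).sum fun o c₃ => c₃ • (join (o.1 0) v).sum fun z c₄ => c₄ •
          (((-1 : ℤ) ^ (v.dim * (u.dim + ∑ j, (o.2 j).dim))) •
            Finsupp.single ((fun _ => z : Fin (0 + 1) → Face b),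
              (Fin.snoc o.2 u : Fin (q + 1) → Face b)) (1 : ℤ))) Finset.sdiff_subset

theorem dim_onesFace (S V : Finset (Fin b)) : (onesFace S V).dim = V.card := by
  rw [Face.dim, dirs_onesFace]

theorem dim_firstFactor {S V U : Finset (Fin b)} (h : U ⊆ V) :
    (firstFactor (onesFace S V) U).dim = U.card := by
  rw [Face.dim, dirs_firstFactor (by rwa [dirs_onesFace])]

theorem chainOp_one_succ (q : ℕ) :
    chainOp b 1 (q + 1) = lowerDescendant (p := 0) (chainOp b 1 q) := by
  rw [chainOp]

theorem chainOp_one_zero (F : Face b) :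
    chainOp b 1 0 F = Finsupp.single (fun _ => F, Fin.elim0) 1 := by
  rw [chainOp]

/-- The shape of the black output `x` of `e^{1,q}` on the face spanned by `T`: its letters outside
`T` are `0`, and its letters on `T` beyond the last letter `I` are `1`. Hence a later join cannot
take place at a position in `T`. -/
def IsOutputOf (T : Finset (Fin b)) (x : Face b) : Prop :=
  (∀ k, k ∉ T → x k = Letter.zero) ∧
    ∀ k ∈ T, (∀ m, k ≤ m → x m ≠ Letter.full) → x k = Letter.one

/-- The black outputs of `e^{1,q}` have the shape `IsOutputOf`. -/
theorem isOutputOf_of_mem_support {q : ℕ} (S : Finset (Fin b)) :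
    chainOp b 1 q (faceOf S) ∈ Finsupp.supported ℤ ℤ
      {o : (Fin 1 → Face b) × (Fin q → Face b) | IsOutputOf S (o.1 0)} := by
  induction q generalizing S with
  | zero =>
    rw [chainOp_one_zero]
    refine Finsupp.single_mem_supported _ _ (show IsOutputOf S (faceOf S) from
      ⟨fun k hk => ?_, fun k hk h => ?_⟩)
    · simp [faceOf, hk]
    · exact absurd (by simp [faceOf, hk]) (h k le_rfl)
  | succ q ih =>
    rw [chainOp_one_succ, lowerDescendant_faceOf]
    refine Submodule.sum_mem _ fun T hT => Submodule.smul_mem _ _ (Submodule.sum_mem _ fun U hU =>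
      Submodule.smul_mem _ _ (Submodule.sum_mem _ fun o ho => Submodule.smul_mem _ _ ?_))
    rw [Finset.mem_powerset] at hT hU
    have ho' : IsOutputOf T (o.1 0) := ih T ho
    rw [join_sum]
    refine Submodule.sum_mem _ fun i _ => ?_
    split_ifs with hi
    · by_cases hj : letterJoin (o.1 0 i) (onesFace S ((S \ T) \ U) i) = 0
      · rw [hj, mul_zero, zero_smul]; exact Submodule.zero_mem _
      refine Submodule.smul_mem _ _ (Submodule.smul_mem _ _
        (Finsupp.single_mem_supported _ _ ⟨fun k hk => ?_, fun k hk h => ?_⟩))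
      · have hkT : k ∉ T := fun h => hk (hT h)
        have hv : onesFace S ((S \ T) \ U) k = Letter.zero := by
          simp [onesFace, hk]
        have hki : k ≠ i := by
          rintro rfl
          rw [hv, ho'.1 k hkT] at hj
          exact hj rfl
        simp only [hki, if_false, hv, ho'.1 k hkT, ite_self]
      · have hik : i < k := by
          by_contra hle
          exact h i (not_lt.1 hle) (by simp)
        have hv := h k le_rfl
        simp only [hik.not_gt, hik.ne', if_false] at hv ⊢
        simp only [onesFace, hk, if_true] at hv ⊢
        split_ifs at hv ⊢
        · exact absurd rfl hv
        · rfl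
    · exact Submodule.zero_mem _

/-- The terms of the join of an output `x` as above with a face `v` which has letter `1` on `T ∪ U`,
letter `I` on `V` and `0` elsewhere: `x` and `v` are joined at a position in `U`. -/
theorem join_onesFace {M : Type*} [AddCommGroup M] {T U V : Finset (Fin b)} {x : Face b}
    (hx : IsOutputOf T x) (hTU : Disjoint T U) (hTV : Disjoint T V) (hUV : Disjoint U V)
    (A : Finset (Fin b)) (g : M) :
    ((join x (onesFace (T ∪ U ∪ V) V)).sum fun z c => c • (if z.dirs = A then g else 0)) =
      ∑ i ∈ A ∩ U, if x.dirs = A.filter (· < i) ∧ V = A.filter (i < ·) then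
        (-1 : ℤ) ^ (A.filter (· < i)).card • g else 0 := by
  rw [join_sum]
  have hterm : ∀ i : Fin b,
      (if (∀ k, k < i → onesFace (T ∪ U ∪ V) V k ≠ Letter.full) ∧
          (∀ k, i < k → x k ≠ Letter.full) then
        ((-1 : ℤ) ^ x.dim * letterJoin (x i) (onesFace (T ∪ U ∪ V) V i)) •
          (if Face.dirs (fun k => if k < i then x k else if k = i then Letter.full
            else onesFace (T ∪ U ∪ V) V k) = A then g else 0)
      else 0) = if i ∈ A ∩ U then if x.dirs = A.filter (· < i) ∧ V = A.filter (i < ·) then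
        (-1 : ℤ) ^ (A.filter (· < i)).card • g else 0 else 0 := by
    intro i
    have hv1 : ∀ k, onesFace (T ∪ U ∪ V) V k = Letter.full ↔ k ∈ V := fun k => by
      rw [← mem_dirs, dirs_onesFace]
    have hV : ∀ k ∈ V, k ∉ T ∧ k ∉ U := fun k hk =>
      ⟨fun h => Finset.disjoint_left.1 hTV h hk, fun h => Finset.disjoint_left.1 hUV h hk⟩
    have hdirs : Face.dirs (fun k => if k < i then x k else if k = i then Letter.full
            else onesFace (T ∪ U ∪ V) V k) =
        x.dirs.filter (· < i) ∪ {i} ∪ V.filter (i < ·) := by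
      ext k
      simp only [mem_dirs, Finset.mem_union, Finset.mem_filter, Finset.mem_singleton]
      rcases lt_trichotomy k i with h | h | h
      · simp [h, h.ne, h.not_gt]
      · simp [h]
      · simp only [h.not_gt, h.ne', if_false, hv1]; simp [h]
    by_cases hcond : (∀ k, k < i → onesFace (T ∪ U ∪ V) V k ≠ Letter.full) ∧
          (∀ k, i < k → x k ≠ Letter.full)
    · rw [if_pos hcond]
      by_cases hiU : i ∈ U
      · have hxi : x i = Letter.zero := hx.1 i fun h => Finset.disjoint_left.1 hTU h hiU
        have hiV : i ∉ V := fun h => (hV i h).2 hiU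
        have hvi : onesFace (T ∪ U ∪ V) V i = Letter.one := by simp [onesFace, hiU, hiV]
        have hx0 : x.dirs.filter (· < i) = x.dirs := Finset.filter_true_of_mem fun k hk => by
          rcases lt_trichotomy k i with h | h | h
          · exact h
          · rw [mem_dirs, h, hxi] at hk; cases hk
          · exact absurd (mem_dirs.1 hk) (hcond.2 k h)
        have hV0 : V.filter (i < ·) = V := Finset.filter_true_of_mem fun k hk => by
          rcases lt_trichotomy k i with h | h | h
          · exact absurd ((hv1 k).2 hk) (hcond.1 k h)
          · exact absurd (h ▸ hk) hiV
          · exact h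
        have hlt : ∀ k ∈ x.dirs, k < i := fun k hk => by
          rw [← hx0] at hk; exact (Finset.mem_filter.1 hk).2
        have hgt : ∀ k ∈ V, i < k := fun k hk => by
          rw [← hV0] at hk; exact (Finset.mem_filter.1 hk).2
        rw [hdirs, hx0, hV0, hxi, hvi]
        by_cases hA : x.dirs ∪ {i} ∪ V = A
        · have h1 : x.dirs = A.filter (· < i) := by
            ext k; rw [← hA]
            simp only [Finset.mem_filter, Finset.mem_union, Finset.mem_singleton]
            constructor
            · exact fun h => ⟨Or.inl (Or.inl h), hlt k h⟩
            · rintro ⟨(h | h) | h, h'⟩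
              · exact h
              · exact absurd h' (h ▸ lt_irrefl _)
              · exact absurd h' (hgt k h).not_gt
          have h2 : V = A.filter (i < ·) := by
            ext k; rw [← hA]
            simp only [Finset.mem_filter, Finset.mem_union, Finset.mem_singleton]
            constructor
            · exact fun h => ⟨Or.inr h, hgt k h⟩
            · rintro ⟨(h | h) | h, h'⟩
              · exact absurd h' (hlt k h).not_gt
              · exact absurd h' (h ▸ lt_irrefl _)
              · exact h
          have hiA : i ∈ A ∩ U := Finset.mem_inter.2 ⟨hA ▸ by simp, hiU⟩
          rw [if_pos hA, if_pos hiA, if_pos ⟨h1, h2⟩, Face.dim, h1]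
          simp [letterJoin]
        · rw [if_neg hA, smul_zero]
          split_ifs with h1 h2
          · refine absurd ?_ hA
            rw [h2.1, h2.2]
            ext k
            simp only [Finset.mem_filter, Finset.mem_union, Finset.mem_singleton]
            constructor
            · rintro ((h | h) | h)
              · exact h.1
              · exact h ▸ Finset.mem_of_mem_inter_left h1
              · exact h.1
            · intro h
              rcases lt_trichotomy k i with h' | h' | h'
              · exact Or.inl (Or.inl ⟨h, h'⟩)
              · exact Or.inl (Or.inr h')
              · exact Or.inr ⟨h, h'⟩
          · rfl
          · rfl
      · have hj : letterJoin (x i) (onesFace (T ∪ U ∪ V) V i) = 0 := by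
          by_cases hiV : i ∈ V
          · rw [(hv1 i).2 hiV, hx.1 i (hV i hiV).1]; rfl
          · by_cases hiT : i ∈ T
            · have hvi : onesFace (T ∪ U ∪ V) V i = Letter.one := by simp [onesFace, hiT, hiV]
              by_cases hxi : x i = Letter.full
              · rw [hxi, hvi]; rfl
              · rw [hx.2 i hiT, hvi]
                · rfl
                · intro m hm
                  rcases hm.eq_or_lt with rfl | h
                  · exact hxi
                  · exact hcond.2 m h
            · have hvi : onesFace (T ∪ U ∪ V) V i = Letter.zero := by
                simp [onesFace, hiT, hiV, hiU]
              rw [hx.1 i hiT, hvi]; rfl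
        rw [hj, mul_zero, zero_smul, if_neg fun h => hiU (Finset.mem_of_mem_inter_right h)]
    · rw [if_neg hcond]
      split_ifs with h1 h2
      · refine absurd ⟨fun k hk h => ?_, fun k hk h => ?_⟩ hcond
        · rw [hv1, h2.2, Finset.mem_filter] at h
          exact lt_asymm h.2 hk
        · rw [← mem_dirs, h2.1, Finset.mem_filter] at h
          exact lt_asymm h.2 hk
      · rfl
      · rfl
  rw [Finset.sum_congr rfl fun i _ => hterm i, Finset.sum_ite_mem, Finset.univ_inter]

end ChainOp
/-! ### The dual operations on odd basis elements -/

section Dual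

variable {b : ℕ}

/-- The coefficient of the cubes `A` and `B 0, …, B (q - 1)` of the minimal torus in an element of
`C^{⊗ 1} ⊗ C^{⊗ q}`. -/
noncomputable def pairing {q : ℕ} (A : Finset (Fin b)) (B : Fin q → Finset (Fin b)) :
    (((Fin 1 → Face b) × (Fin q → Face b)) →₀ ℤ) →ₗ[ℤ] ℤ :=
  Finsupp.linearCombination ℤ fun o => if (o.1 0).dirs = A ∧ ∀ j, (o.2 j).dirs = B j then 1 else 0

theorem pairing_apply {q : ℕ} (A : Finset (Fin b)) (B : Fin q → Finset (Fin b))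
    (f : ((Fin 1 → Face b) × (Fin q → Face b)) →₀ ℤ) :
    pairing A B f =
      f.sum fun o c => c • if (o.1 0).dirs = A ∧ ∀ j, (o.2 j).dirs = B j then 1 else 0 := rfl

theorem pairing_single {q : ℕ} (A : Finset (Fin b)) (B : Fin q → Finset (Fin b))
    (o : (Fin 1 → Face b) × (Fin q → Face b)) :
    pairing A B (Finsupp.single o 1) =
      if (o.1 0).dirs = A ∧ ∀ j, (o.2 j).dirs = B j then 1 else 0 := by
  rw [pairing, Finsupp.linearCombination_single, one_smul]

/-- The summand of the lower descendant of `e^{1,q}` on the face spanned by `T ∪ U ∪ V` in which the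
input is split into faces with directions `T`, `U` and `V`: the last grey output must be the cube
`U`, and the join at `i` cuts `A` into the black output `A_{<i}` of `e^{1,q}`, the letter `i` and
`V = A_{>i}`. -/
theorem pairing_summand {q : ℕ} (A : Finset (Fin b)) (B : Fin (q + 1) → Finset (Fin b))
    {T U V : Finset (Fin b)} (hTU : Disjoint T U) (hTV : Disjoint T V) (hUV : Disjoint U V)
    (u : Face b) (hu : u.dirs = U) :
    pairing A B ((chainOp b 1 q (faceOf T)).sum fun o c => c •
      (join (o.1 0) (onesFace (T ∪ U ∪ V) V)).sum fun z c' => c' •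
        (((-1 : ℤ) ^ (V.card * (U.card + ∑ j, (o.2 j).dim))) •
          Finsupp.single ((fun _ => z : Fin (0 + 1) → Face b),
            (Fin.snoc o.2 u : Fin (q + 1) → Face b)) 1)) =
      ∑ i ∈ A ∩ U, if U = B (Fin.last q) ∧ V = A.filter (i < ·) then
        (-1 : ℤ) ^ ((A.filter (· < i)).card + V.card * ∑ j, (B j).card) *
          pairing (A.filter (· < i)) (fun j => B j.castSucc) (chainOp b 1 q (faceOf T)) else 0 := by
  have hterm : ∀ (o : (Fin 1 → Face b) × (Fin q → Face b)) (z : Face b),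
      pairing A B (((-1 : ℤ) ^ (V.card * (U.card + ∑ j, (o.2 j).dim))) •
          Finsupp.single ((fun _ => z : Fin (0 + 1) → Face b),
            (Fin.snoc o.2 u : Fin (q + 1) → Face b)) 1) =
        if z.dirs = A then (if U = B (Fin.last q) ∧ ∀ j, (o.2 j).dirs = B j.castSucc then
          (-1 : ℤ) ^ (V.card * ∑ j, (B j).card) else 0) else 0 := by
    intro o z
    rw [map_zsmul]
    refine (congrArg _ (pairing_single A B _)).trans ?_
    simp only [Fin.forall_fin_succ', Fin.snoc_castSucc, Fin.snoc_last, hu]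
    by_cases h1 : z.dirs = A
    · by_cases h2 : U = B (Fin.last q) ∧ ∀ j, (o.2 j).dirs = B j.castSucc
      · rw [if_pos ⟨h1, h2.2, h2.1⟩, if_pos h1, if_pos h2, Fin.sum_univ_castSucc, h2.1]
        simp only [Face.dim, h2.2, smul_eq_mul, mul_one]
        rw [add_comm]
      · rw [if_neg fun h => h2 ⟨h.2.2, h.2.1⟩, if_pos h1, if_neg h2, smul_zero]
    · rw [if_neg fun h => h1 h.1, if_neg h1, smul_zero]
  simp only [map_finsuppSum, map_zsmul, hterm]
  have hsum : ∀ o ∈ (chainOp b 1 q (faceOf T)).support,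
      (chainOp b 1 q (faceOf T)) o •
        ((join (o.1 0) (onesFace (T ∪ U ∪ V) V)).sum fun z c' => c' •
          if z.dirs = A then (if U = B (Fin.last q) ∧ ∀ j, (o.2 j).dirs = B j.castSucc then
            (-1 : ℤ) ^ (V.card * ∑ j, (B j).card) else 0) else 0) =
      ∑ i ∈ A ∩ U, (chainOp b 1 q (faceOf T)) o •
        if (o.1 0).dirs = A.filter (· < i) ∧ V = A.filter (i < ·) then
          (-1 : ℤ) ^ (A.filter (· < i)).card •
            (if U = B (Fin.last q) ∧ ∀ j, (o.2 j).dirs = B j.castSucc then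
              (-1 : ℤ) ^ (V.card * ∑ j, (B j).card) else 0) else 0 := fun o ho => by
    rw [join_onesFace ((isOutputOf_of_mem_support T) ho) hTU hTV hUV, Finset.smul_sum]
  rw [Finsupp.sum, Finset.sum_congr rfl hsum, Finset.sum_comm]
  refine Finset.sum_congr rfl fun i _ => ?_
  rw [pairing_apply, Finsupp.sum]
  by_cases h : U = B (Fin.last q) ∧ V = A.filter (i < ·)
  · rw [if_pos h, Finset.mul_sum _ _ ((-1 : ℤ) ^ _)]
    refine Finset.sum_congr rfl fun o _ => ?_
    by_cases h2 : (o.1 0).dirs = A.filter (· < i) ∧ ∀ j, (o.2 j).dirs = B j.castSucc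
    · rw [if_pos ⟨h2.1, h.2⟩, if_pos ⟨h.1, h2.2⟩, if_pos h2]
      simp only [smul_eq_mul, pow_add]; ring
    · rw [if_neg h2]
      split_ifs with h3 h4
      · exact absurd ⟨h3.1, h4.2⟩ h2
      · simp
      · simp
  · rw [if_neg h]
    refine Finset.sum_eq_zero fun o _ => ?_
    split_ifs with h3 h4
    · exact absurd ⟨h4.1, h3.2⟩ h
    · simp
    · simp

/-- The recursion for the coefficients of `e^{1,q+1}`. The last set `C` of `B` is the last grey
output, so that the input consists of a face `T`, of `C`, and of the part `A_{>i}` which is joined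
to the black output at a point `i ∈ C`. -/
theorem pairing_chainOp_succ {q : ℕ} (A : Finset (Fin b)) (B : Fin (q + 1) → Finset (Fin b))
    (S : Finset (Fin b)) :
    pairing A B (chainOp b 1 (q + 1) (faceOf S)) =
      ∑ T : Finset (Fin b), ∑ i ∈ A ∩ B (Fin.last q),
        if (Disjoint T (B (Fin.last q)) ∧ Disjoint (B (Fin.last q)) (A.filter (i < ·)) ∧
            Disjoint T (A.filter (i < ·))) ∧ T ∪ B (Fin.last q) ∪ A.filter (i < ·) = S then
          shuffleSign T (B (Fin.last q)) *
            shuffleSign (T ∪ B (Fin.last q)) (A.filter (i < ·)) *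
            ((-1 : ℤ) ^ ((A.filter (· < i)).card + (A.filter (i < ·)).card * ∑ j, (B j).card) *
              pairing (A.filter (· < i)) (fun j => B j.castSucc) (chainOp b 1 q (faceOf T)))
        else 0 := by
  set C := B (Fin.last q) with hC
  rw [chainOp_one_succ, lowerDescendant_faceOf, map_sum]
  rw [← Finset.sum_subset (Finset.subset_univ S.powerset) (fun T _ hT => by
    refine Finset.sum_eq_zero fun i _ => if_neg fun h => hT (Finset.mem_powerset.2 ?_)
    rw [← h.2]
    exact Finset.subset_union_left.trans Finset.subset_union_left)]
  refine Finset.sum_congr rfl fun T hT => ?_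
  rw [Finset.mem_powerset] at hT
  rw [map_zsmul, map_sum]
  have hU : ∀ U ∈ (S \ T).powerset,
      pairing A B (shuffleSign U ((S \ T) \ U) • (chainOp b 1 q (faceOf T)).sum fun o c => c •
          (join (o.1 0) (onesFace S ((S \ T) \ U))).sum fun z c' => c' •
            (((-1 : ℤ) ^ ((onesFace S ((S \ T) \ U)).dim *
                ((firstFactor (onesFace S (S \ T)) U).dim + ∑ j, (o.2 j).dim))) •
              Finsupp.single ((fun _ => z : Fin (0 + 1) → Face b),
                (Fin.snoc o.2 (firstFactor (onesFace S (S \ T)) U) : Fin (q + 1) → Face b)) 1)) =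
      if U = C then shuffleSign U ((S \ T) \ U) • ∑ i ∈ A ∩ C,
        if (S \ T) \ U = A.filter (i < ·) then
          (-1 : ℤ) ^ ((A.filter (· < i)).card + ((S \ T) \ U).card * ∑ j, (B j).card) *
          pairing (A.filter (· < i)) (fun j => B j.castSucc) (chainOp b 1 q (faceOf T)) else 0
      else 0 := by
    intro U hU
    rw [Finset.mem_powerset] at hU
    have hTU : Disjoint T U := Finset.disjoint_left.2 fun x h1 h2 =>
      (Finset.mem_sdiff.1 (hU h2)).2 h1
    have hTV : Disjoint T ((S \ T) \ U) := Finset.disjoint_left.2 fun x h1 h2 =>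
      (Finset.mem_sdiff.1 (Finset.mem_sdiff.1 h2).1).2 h1
    have hS : S = T ∪ U ∪ (S \ T) \ U := by
      rw [Finset.union_assoc, Finset.union_sdiff_of_subset hU, Finset.union_sdiff_of_subset hT]
    have key := pairing_summand (q := q) A B hTU hTV Finset.disjoint_sdiff
      (firstFactor (onesFace S (S \ T)) U) (dirs_firstFactor (by rwa [dirs_onesFace]))
    rw [← hS] at key
    rw [map_zsmul, dim_onesFace, dim_firstFactor hU, key]
    split_ifs with h
    · simp only [h, hC, true_and]
    · rw [Finset.sum_eq_zero fun i _ => if_neg fun h' => h h'.1, smul_zero]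
  rw [Finset.sum_congr rfl hU, Finset.sum_ite_eq' (S \ T).powerset C]
  split_ifs with hCmem
  · rw [Finset.mem_powerset] at hCmem
    rw [Finset.smul_sum, Finset.smul_sum]
    refine Finset.sum_congr rfl fun i _ => ?_
    have hTC : Disjoint T C := Finset.disjoint_left.2 fun x h1 h2 =>
      (Finset.mem_sdiff.1 (hCmem h2)).2 h1
    have hST : S \ T = C ∪ (S \ T) \ C := (Finset.union_sdiff_of_subset hCmem).symm
    by_cases h : (S \ T) \ C = A.filter (i < ·)
    · rw [if_pos h, if_pos, h]
      · rw [h] at hST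
        have hd : Disjoint C (A.filter (i < ·)) := by rw [← h]; exact Finset.disjoint_sdiff
        rw [hST, shuffleSign_union_right hd, shuffleSign_union_left hTC]
        simp only [smul_eq_mul]; ring
      · rw [← h]
        refine ⟨⟨hTC, Finset.disjoint_sdiff, ?_⟩, ?_⟩
        · exact Finset.disjoint_sdiff.mono_right Finset.sdiff_subset
        · rw [Finset.union_assoc, Finset.union_sdiff_of_subset hCmem,
            Finset.union_sdiff_of_subset hT]
    · rw [if_neg h, if_neg, smul_zero, smul_zero]
      rintro ⟨⟨h1, h2, h3⟩, h4⟩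
      refine h ?_
      rw [← h4]
      ext x
      have a1 : x ∈ T → x ∉ C := fun h h' => Finset.disjoint_left.1 h1 h h'
      have a2 : x ∈ C → x ∉ A.filter (i < ·) := fun h h' => Finset.disjoint_left.1 h2 h h'
      have a3 : x ∈ T → x ∉ A.filter (i < ·) := fun h h' => Finset.disjoint_left.1 h3 h h'
      simp only [Finset.mem_sdiff, Finset.mem_union]
      tauto
  · rw [smul_zero]
    refine (Finset.sum_eq_zero fun i _ => if_neg ?_).symm
    rintro ⟨⟨h1, h2, h3⟩, h4⟩
    refine hCmem (Finset.mem_powerset.2 fun x hx => Finset.mem_sdiff.2 ⟨?_, fun h =>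
      Finset.disjoint_left.1 h1 h hx⟩)
    rw [← h4]
    exact Finset.mem_union_left _ (Finset.mem_union_right _ hx)

variable (R : Type*) [CommRing R]

/-- The dual of `e^{1,q}`, without the sign `(-1)^ε`, on basis elements. -/
noncomputable def chainDual (q : ℕ) (A : Finset (Fin b)) (B : Fin q → Finset (Fin b)) : Lam b R :=
  ∑ S, pairing A B (chainOp b 1 q (faceOf S)) • stdBasis b R S

theorem chainDual_succ (q : ℕ) (A : Finset (Fin b)) (B : Fin (q + 1) → Finset (Fin b)) :
    chainDual R (q + 1) A B = ∑ i ∈ A ∩ B (Fin.last q),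
      (-1 : ℤ) ^ ((A.filter (· < i)).card + (A.filter (i < ·)).card * ∑ j, (B j).card) •
        (chainDual R q (A.filter (· < i)) (fun j => B j.castSucc) *
          (stdBasis b R (B (Fin.last q)) * stdBasis b R (A.filter (i < ·)))) := by
  simp only [chainDual, pairing_chainOp_succ, Finset.sum_smul, Finset.sum_mul, Finset.smul_sum]
  rw [Finset.sum_comm]
  conv_rhs => rw [Finset.sum_comm]
  refine Finset.sum_congr rfl fun T _ => ?_
  rw [Finset.sum_comm]
  refine Finset.sum_congr rfl fun i _ => ?_
  rw [smul_mul_assoc, stdBasis_mul_mul]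
  simp only [ite_smul, zero_smul]
  by_cases h : Disjoint T (B (Fin.last q)) ∧ Disjoint (B (Fin.last q)) (A.filter (i < ·)) ∧
      Disjoint T (A.filter (i < ·))
  · simp only [h, and_self, true_and, if_true]
    rw [Finset.sum_ite_eq Finset.univ, if_pos (Finset.mem_univ _), smul_smul, smul_smul]
    congr 1
    ring
  · simp only [h, false_and, if_false, Finset.sum_const_zero, smul_zero]

theorem neg_one_pow_congr {m n : ℕ} (h : m % 2 = n % 2) : (-1 : ℤ) ^ m = (-1) ^ n := by
  rw [← Nat.div_add_mod m 2, ← Nat.div_add_mod n 2, h, pow_add, pow_add, pow_mul, pow_mul]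
  simp

/-- The Koszul signs of `e^{1,q}` do not depend on the points of insertion if the grey outputs are
odd. -/
theorem chainDual_eq (q : ℕ) (A : Finset (Fin b)) (B : Fin q → Finset (Fin b))
    (hB : ∀ j, Odd (B j).card) :
    chainDual R q A B =
      (-1 : ℤ) ^ (q * A.card + ∑ k ∈ Finset.range (q + 1), k) •
        simInsert R A (List.ofFn B) := by
  induction q generalizing A with
  | zero =>
    have h : ∀ S : Finset (Fin b), pairing A B (chainOp b 1 0 (faceOf S)) =
        if S = A then 1 else 0 := by
      intro S
      rw [chainOp_one_zero, pairing_single]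
      simp
    simp [chainDual, h, simInsert]
  | succ q ih =>
    rw [chainDual_succ, List.ofFn_succ', List.concat_eq_append, simInsert_append_singleton,
      Finset.smul_sum]
    refine Finset.sum_congr rfl fun i hi => ?_
    have hiA := Finset.mem_of_mem_inter_left hi
    rw [ih _ _ fun j => hB _, smul_mul_assoc, smul_smul, ← pow_add]
    congr 1
    have hcard : A.card = (A.filter (· < i)).card + (A.filter (i < ·)).card + 1 := by
      rw [← Finset.card_erase_add_one hiA, IsFirstBranch.erase_eq, Finset.card_union_of_disjoint]
      exact Finset.disjoint_left.2 fun x h1 h2 =>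
        lt_asymm (Finset.mem_filter.1 h1).2 (Finset.mem_filter.1 h2).2
    have hsum : ∃ m, ∑ j, (B j).card = 2 * m + (q + 1) := by
      choose m hm using hB
      refine ⟨∑ j, m j, ?_⟩
      simp only [hm, Finset.sum_add_distrib, Finset.mul_sum, Finset.sum_const, Finset.card_univ,
        Fintype.card_fin, smul_eq_mul, mul_one]
    obtain ⟨m, hm⟩ := hsum
    rw [hm, hcard, Finset.sum_range_succ (fun k => k) (q + 1)]
    apply neg_one_pow_congr
    generalize (A.filter (· < i)).card = s
    generalize (A.filter (i < ·)).card = t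
    generalize ∑ k ∈ Finset.range (q + 1), k = r
    have : (q + 1) * (s + t + 1) + (r + (q + 1)) =
        s + t * (2 * m + (q + 1)) + (q * s + r) + 2 * (q + 1) - 2 * (t * m) := by
      have : (q + 1) * (s + t + 1) + (r + (q + 1)) + 2 * (t * m) =
        s + t * (2 * m + (q + 1)) + (q * s + r) + 2 * (q + 1) := by ring
      omega
    have h2 : 2 * (t * m) ≤ s + t * (2 * m + (q + 1)) + (q * s + r) + 2 * (q + 1) := by
      nlinarith [Nat.zero_le (t * (q + 1)), Nat.zero_le (q * s)]
    omega

/-- The sign `(-1)^ε` in the definition of `E_{1,q}` cancels the sign of `chainDual_eq` if all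
inputs are odd. -/
theorem neg_one_pow_hirschExponent (q : ℕ) (d : Fin (1 + q) → ℕ) (hd : ∀ k, Odd (d k)) :
    (-1 : ℤ) ^ hirschExponent (1 + q) d = (-1) ^ (q + ∑ k ∈ Finset.range (q + 1), k) := by
  have key : ∀ (n : ℕ) (d : Fin n → ℕ) (P : ℕ → Prop) [DecidablePred P], (∀ k, Odd (d k)) →
      (-1 : ℤ) ^ (∑ k ∈ Finset.univ.filter (fun k : Fin n => P k), d k) =
        (-1) ^ ((Finset.range n).filter P).card := by
    intro n d P _ hd
    rw [← Finset.prod_pow_eq_pow_sum, Finset.prod_congr rfl fun k _ => (hd k).neg_one_pow,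
      Finset.prod_filter, Fin.prod_univ_eq_prod_range (fun k => if P k then (-1 : ℤ) else 1) n,
      ← Finset.prod_filter, Finset.prod_const]
  have hev : ∀ m : ℕ, ((Finset.range (2 * m)).filter Even).card = m ∧
      ((Finset.range (2 * m + 1)).filter Odd).card = m := by
    intro m
    induction m with
    | zero => simp
    | succ m ih =>
      have h1 : Even (2 * m) := even_two_mul m
      have h2 : ¬ Even (2 * m + 1) := by simp
      have h3 : Odd (2 * m + 1) := odd_two_mul_add_one m
      have h4 : ¬ Odd (2 * m + 1 + 1) := by
        rw [Nat.not_odd_iff_even]; exact h3.add_odd odd_one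
      constructor
      · rw [show 2 * (m + 1) = 2 * m + 1 + 1 by ring, Finset.range_add_one, Finset.filter_insert,
          if_neg h2, Finset.range_add_one, Finset.filter_insert, if_pos h1,
          Finset.card_insert_of_notMem (by simp), ih.1]
      · rw [show 2 * (m + 1) + 1 = 2 * m + 1 + 1 + 1 by ring, Finset.range_add_one,
          Finset.filter_insert, if_neg h4, Finset.range_add_one, Finset.filter_insert, if_pos h3,
          Finset.card_insert_of_notMem (by simp), ih.2]
  have hg : (∑ k ∈ Finset.range (q + 1), k) * 2 = (q + 1) * q := Finset.sum_range_id_mul_two _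
  rw [hirschExponent]
  split_ifs with h
  · obtain ⟨m, hm⟩ := h
    rw [pow_add, key _ d Even hd, ← pow_add, hm, ← two_mul, (hev m).1]
    apply neg_one_pow_congr
    have hq : q = 2 * m - 1 := by omega
    have hm1 : 1 ≤ m := by omega
    obtain ⟨k, rfl⟩ := Nat.exists_eq_add_of_le' hm1
    have hq' : q = 2 * k + 1 := by omega
    subst hq'
    have : ∑ i ∈ Finset.range (2 * k + 1 + 1), i = (k + 1) * (2 * k + 1) := by
      apply Nat.eq_of_mul_eq_mul_right (show 0 < 2 by norm_num)
      rw [hg]; ring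
    rw [this, show (k + 1) * (2 * k + 1) = k + 1 + 2 * (k * (k + 1)) by ring]
    omega
  · rw [Nat.not_even_iff_odd] at h
    obtain ⟨m, hm⟩ := h
    rw [key _ d Odd hd, hm, (hev m).2]
    apply neg_one_pow_congr
    have hq' : q = 2 * m := by omega
    subst hq'
    have : ∑ i ∈ Finset.range (2 * m + 1), i = m * (2 * m + 1) := by
      apply Nat.eq_of_mul_eq_mul_right (show 0 < 2 by norm_num)
      rw [hg]; ring
    rw [this, show m * (2 * m + 1) = m + 2 * (m * m) by ring]
    omega

/-- On odd basis elements, `E_{1,q}` is simultaneous insertion. -/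
theorem hirschE_one_stdBasis {q : ℕ} {A : Finset (Fin b)} {B : Fin q → Finset (Fin b)}
    (hA : Odd A.card) (hB : ∀ j, Odd (B j).card) :
    hirschE 1 q (fun _ => stdBasis b R A) (fun j => stdBasis b R (B j)) =
      simInsert R A (List.ofFn B) := by
  have h : hirschE 1 q (fun _ => stdBasis b R A) (fun j => stdBasis b R (B j)) =
      (-1 : ℤ) ^ (q + ∑ k ∈ Finset.range (q + 1), k) • chainDual R q A B := by
    rw [hirschE, chainDual, Finset.smul_sum]
    refine Finset.sum_congr rfl fun S _ => ?_
    rw [smul_smul, ← Int.cast_smul_eq_zsmul R, pairing_apply, Finsupp.sum, Finsupp.sum,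
      Finset.mul_sum, Int.cast_sum]
    congr 1
    refine Finset.sum_congr rfl fun o _ => ?_
    simp only [coeffOn_stdBasis, Finset.univ_unique, Fin.default_eq_zero, Finset.prod_singleton]
    by_cases h1 : (o.1 0).dirs = A
    · by_cases h2 : ∀ j, (o.2 j).dirs = B j
      · have hd : ∀ k, Odd (Fin.append (fun i => (o.1 i).dim) (fun j => (o.2 j).dim) k) := by
          intro k
          refine Fin.addCases (fun i => ?_) (fun j => ?_) k
          · rw [Fin.append_left, Fin.fin_one_eq_zero i, Face.dim, h1]; exact hA
          · rw [Fin.append_right, Face.dim, h2]; exact hB j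
        rw [neg_one_pow_hirschExponent q _ hd, if_pos h1.symm, if_pos ⟨h1, h2⟩,
          Finset.prod_eq_one fun j _ => if_pos (h2 j).symm]
        simp only [smul_eq_mul, mul_one, one_mul, mul_comm]
      · have hn : ¬ ((o.1 0).dirs = A ∧ ∀ j, (o.2 j).dirs = B j) := fun h => h2 h.2
        obtain ⟨j, hj⟩ := not_forall.1 h2
        rw [if_neg hn, Finset.prod_eq_zero (Finset.mem_univ j) (if_neg (Ne.symm hj))]
        simp
    · have hn : ¬ ((o.1 0).dirs = A ∧ ∀ j, (o.2 j).dirs = B j) := fun h => h1 h.1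
      rw [if_neg (Ne.symm h1), if_neg hn]
      simp
  rw [h, chainDual_eq R q A B hB, smul_smul, ← pow_add, Even.neg_one_pow, one_smul]
  obtain ⟨m, hm⟩ := hA
  rw [hm]
  exact ⟨q + q * m + ∑ k ∈ Finset.range (q + 1), k, by ring⟩

end Dual
/-! ### Left multiplication in the bar construction -/

section BarMul

variable {b : ℕ} {R : Type*} [CommRing R]

theorem bracket_stdBasis (I : PosCube b) :
    bracket (stdBasis b R I.1) = TensorAlgebra.ι R (augBasis b R I) := by
  rw [bracket, LinearMap.sum_apply, Finset.sum_eq_single I]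
  · simp
  · intro J _ hJ
    have : ¬ I.1 = J.1 := fun h => hJ (Subtype.ext h.symm)
    simp [this]
  · simp

theorem augBasis_coe (I : PosCube b) : (augBasis b R I : Lam b R) = stdBasis b R I.1 := by
  simp [augBasis]

variable (R)

/-- The element `[e^{B₁} | ⋯ | e^{B_q}]` of the bar construction. -/
noncomputable def barWord (l : List (Finset (Fin b))) : Bar b R :=
  (l.map fun B => bracket (stdBasis b R B)).prod

@[simp] theorem barWord_nil : barWord R ([] : List (Finset (Fin b))) = 1 := rfl

@[simp] theorem barWord_cons (B : Finset (Fin b)) (l : List (Finset (Fin b))) :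
    barWord R (B :: l) = bracket (stdBasis b R B) * barWord R l := by
  simp [barWord]

theorem barBasis_apply (w : List (PosCube b)) :
    barBasis b R (FreeMonoid.ofList w) = barWord R (w.map Subtype.val) := by
  have h : barBasis b R (FreeMonoid.ofList w) =
      (TensorAlgebra.equivFreeAlgebra (augBasis b R)).symm
        (FreeAlgebra.basisFreeMonoid R (PosCube b) (FreeMonoid.ofList w)) := rfl
  rw [h]
  induction w with
  | nil =>
    have : FreeAlgebra.basisFreeMonoid R (PosCube b) (FreeMonoid.ofList []) = 1 := by
      simp [FreeAlgebra.basisFreeMonoid, FreeAlgebra.equivMonoidAlgebraFreeMonoid]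
    rw [this, map_one]; simp
  | cons B w ih =>
    have hB : FreeAlgebra.basisFreeMonoid R (PosCube b) (FreeMonoid.ofList (B :: w)) =
        FreeAlgebra.ι R B * FreeAlgebra.basisFreeMonoid R (PosCube b) (FreeMonoid.ofList w) := by
      simp [FreeAlgebra.basisFreeMonoid, FreeAlgebra.equivMonoidAlgebraFreeMonoid,
        FreeMonoid.ofList_cons]
    rw [hB, map_mul, ih rfl, TensorAlgebra.equivFreeAlgebra_symm_ι, List.map_cons, barWord_cons,
      bracket_stdBasis]

theorem hirschWord_singleton {A : PosCube b} (hA : Odd A.1.card) {v : List (PosCube b)}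
    (hv : ∀ B ∈ v, Odd B.1.card) :
    (hirschWord [A] v : Lam b R) = simInsert R A.1 (v.map Subtype.val) := by
  have h1 : (fun i : Fin 1 => stdBasis b R (([A] : List (PosCube b)).get i).1) =
      fun _ => stdBasis b R A.1 := by
    funext i; rw [Fin.fin_one_eq_zero i]; rfl
  have h2 : List.ofFn (fun j => (v.get j).1) = v.map Subtype.val := by
    conv_rhs => rw [← List.ofFn_get v, List.map_ofFn]
    rfl
  rw [← h2, ← hirschE_one_stdBasis R hA (B := fun j => (v.get j).1)
    fun j => hv _ (List.get_mem v j), ← h1]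
  rfl

theorem hirschE_zero_one (x : Fin 0 → Lam b R) (B : Finset (Fin b)) :
    hirschE 0 1 x (fun _ => stdBasis b R B) = stdBasis b R B := by
  have h : ∀ S : Finset (Fin b), chainOp b 0 1 (faceOf S) =
      Finsupp.single (Fin.elim0, fun _ => faceOf S) 1 := fun S => by rw [chainOp]
  rw [hirschE, Finset.sum_eq_single B]
  · rw [h, Finsupp.sum_single_index]
    · have : hirschExponent (0 + 1)
          (Fin.append (fun i : Fin 0 => (Fin.elim0 i : Face b).dim) fun _ : Fin 1 =>
            (faceOf B).dim) = 0 := by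
        simp [hirschExponent]
      simp only [this]
      simp
    · simp
  · intro S _ hS
    rw [h, Finsupp.sum_single_index]
    · simp [Ne.symm hS]
    · simp
  · simp

theorem hirschE_zero (q : ℕ) (hq : q ≠ 1) (x : Fin 0 → Lam b R) (y : Fin q → Lam b R) :
    hirschE 0 q x y = 0 := by
  have h : ∀ F, chainOp b 0 q F = 0 := by
    intro F
    match q, hq with
    | 0, _ => rw [chainOp]
    | q + 2, _ => rw [chainOp]
  simp [hirschE, h]

theorem hirschWord_nil (v : List (PosCube b)) :
    (hirschWord [] v : Lam b R) =
      match v with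
      | [B] => stdBasis b R B.1
      | _ => 0 := by
  match v with
  | [] => exact hirschE_zero R 0 (by norm_num) _ _
  | [B] =>
    have h1 : (fun i : Fin 1 => stdBasis b R (([B] : List (PosCube b)).get i).1) =
        fun _ => stdBasis b R B.1 := by
      funext i; rw [Fin.fin_one_eq_zero i]; rfl
    have := hirschE_zero_one R (fun i => stdBasis b R (([] : List (PosCube b)).get i).1) B.1
    rw [← h1] at this
    exact this
  | B :: C :: v => exact hirschE_zero R _ (by simp) _ _

/-- Words with odd letters have even degree in `BΛ`, so that moving them causes no signs. -/
theorem even_wordParity {v : List (PosCube b)} (hv : ∀ B ∈ v, Odd B.1.card) :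
    Even (wordParity v) := by
  induction v with
  | nil => simp [wordParity]
  | cons B v ih =>
    simp only [wordParity, List.map_cons, List.sum_cons]
    exact ((hv B (by simp)).add_odd odd_one).add (ih fun C hC => hv C (by simp [hC]))

/-- The empty word is a left unit for `μ`. -/
theorem mulComponent_nil_left {v : List (PosCube b)} (hv : ∀ B ∈ v, Odd B.1.card) (k : ℕ) :
    mulComponent R k [] v = if v.length = k then barWord R (v.map Subtype.val) else 0 := by
  induction k generalizing v with
  | zero =>
    cases v with
    | nil => simp [mulComponent]
    | cons B v => simp [mulComponent]
  | succ k ih =>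
    cases v with
    | nil =>
      simp [mulComponent, hirschWord_nil]
    | cons B v =>
      rw [mulComponent, List.length_nil, Finset.sum_range_one, Finset.sum_eq_single 1]
      · have h1 : Even (wordParity ((B :: v).take 1)) :=
          even_wordParity fun C hC => hv C (List.mem_of_mem_take hC)
        rw [(h1.mul_right _).neg_one_pow, one_smul]
        simp only [List.take_nil, List.drop_nil, List.take_succ_cons, List.take_zero,
          List.drop_succ_cons, List.drop_zero, hirschWord_nil]
        rw [ih fun C hC => hv C (by simp [hC])]
        simp
      · intro j _ hj
        have : (hirschWord [] ((B :: v).take j) : Lam b R) = 0 := by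
          rw [hirschWord_nil]
          match j, hj with
          | 0, _ => rfl
          | j + 2, _ =>
            cases v with
            | nil => simp at *
            | cons C v => simp
        simp [this]
      · simp

/-- The terms of `μ([e^A], [e^{B₁} | ⋯ | e^{B_q}])` in which `A` belongs to the first letter. -/
noncomputable def leadingTerms (A : Finset (Fin b)) (l : List (Finset (Fin b))) : Bar b R :=
  ∑ j ∈ Finset.range (l.length + 1), bracket (simInsert R A (l.take j)) * barWord R (l.drop j)

/-- The product `μ([e^A], [e^{B₁} | ⋯ | e^{B_q}])` for odd sets. -/
noncomputable def leftMulWord (A : Finset (Fin b)) : List (Finset (Fin b)) → Bar b R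
  | [] => leadingTerms R A []
  | B :: l => bracket (stdBasis b R B) * leftMulWord A l + leadingTerms R A (B :: l)

/-- In the first letter of `μ([e^A] ⊗ [v])` either `e^A` does not occur, and the letter is the first
letter of `v`, or it does, and only letters of `v` follow. -/
theorem mulComponent_singleton_succ {A : PosCube b} (hA : Odd A.1.card) {v : List (PosCube b)}
    (hv : ∀ B ∈ v, Odd B.1.card) (k : ℕ) :
    mulComponent R (k + 1) [A] v =
      (match v with
        | [] => 0
        | B :: v => bracket (stdBasis b R B.1) * mulComponent R k [A] v) +
      ∑ j ∈ Finset.range (v.length + 1), if v.length - j = k then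
        bracket (simInsert R A.1 ((v.map Subtype.val).take j)) *
          barWord R ((v.map Subtype.val).drop j) else 0 := by
  rw [mulComponent]
  simp only [List.length_singleton]
  rw [Finset.sum_range_succ, Finset.sum_range_one]
  congr 1
  · simp only [List.take_zero, List.drop_zero, hirschWord_nil]
    cases v with
    | nil => simp
    | cons B v =>
      rw [Finset.sum_eq_single 1]
      · have h1 : Even (wordParity ((B :: v).take 1)) :=
          even_wordParity fun C hC => hv C (List.mem_of_mem_take hC)
        rw [(h1.mul_right _).neg_one_pow, one_smul]
        rfl
      · intro j _ hj
        match j, hj with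
        | 0, _ => simp
        | j + 2, _ =>
          cases v with
          | nil => simp at *
          | cons C v => simp
      · simp
  · refine Finset.sum_congr rfl fun j _ => ?_
    have h1 : Even (wordParity (v.take j)) :=
      even_wordParity fun C hC => hv C (List.mem_of_mem_take hC)
    rw [(h1.mul_right _).neg_one_pow, one_smul]
    simp only [List.take_succ_cons, List.take_zero, List.drop_succ_cons, List.drop_zero]
    rw [hirschWord_singleton R hA fun C hC => hv C (List.mem_of_mem_take hC),
      mulComponent_nil_left R fun C hC => hv C (List.mem_of_mem_drop hC)]
    rw [List.length_drop, mul_ite, mul_zero, List.map_take, List.map_drop]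

theorem sum_mulComponent_singleton {A : PosCube b} (hA : Odd A.1.card) {v : List (PosCube b)}
    (hv : ∀ B ∈ v, Odd B.1.card) :
    ∑ k ∈ Finset.range (1 + v.length + 1), mulComponent R k [A] v =
      leftMulWord R A.1 (v.map Subtype.val) := by
  induction v with
  | nil =>
    simp only [List.length_nil]
    rw [Finset.sum_range_succ', Finset.sum_range_one, mulComponent_singleton_succ R hA hv]
    simp [mulComponent, leftMulWord, leadingTerms]
  | cons B v ih =>
    have h0 : mulComponent R 0 [A] (B :: v) = 0 := by simp [mulComponent]
    have hlead : ∑ k ∈ Finset.range (1 + (B :: v).length),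
        ∑ j ∈ Finset.range ((B :: v).length + 1), (if (B :: v).length - j = k then
          bracket (simInsert R A.1 (((B :: v).map Subtype.val).take j)) *
            barWord R (((B :: v).map Subtype.val).drop j) else 0) =
        leadingTerms R A.1 ((B :: v).map Subtype.val) := by
      rw [Finset.sum_comm, leadingTerms, List.length_map]
      refine Finset.sum_congr rfl fun j _ => ?_
      rw [Finset.sum_ite_eq, if_pos]
      rw [Finset.mem_range]; omega
    rw [Finset.sum_range_succ', h0, add_zero,
      Finset.sum_congr rfl fun k _ => mulComponent_singleton_succ R hA hv k,
      Finset.sum_add_distrib, hlead, List.map_cons, leftMulWord,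
      ← ih fun C hC => hv C (by simp [hC]), Finset.mul_sum]
    rfl

/-- Left multiplication by `[e^A]` on words with odd letters. -/
theorem barMul_bracket_barWord {A : Finset (Fin b)} (hA : Odd A.card) {l : List (Finset (Fin b))}
    (hl : ∀ B ∈ l, Odd B.card) :
    barMul (bracket (stdBasis b R A)) (barWord R l) = leftMulWord R A l := by
  have hne : ∀ B ∈ l, B.Nonempty := fun B hB => Finset.card_pos.1 (hl B hB).pos
  obtain ⟨v, rfl⟩ : ∃ v : List (PosCube b), v.map Subtype.val = l :=
    ⟨l.attachWith Finset.Nonempty hne, by simp⟩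
  set A' : PosCube b := ⟨A, Finset.card_pos.1 hA.pos⟩ with hA'
  have h1 : bracket (stdBasis b R A) = barBasis b R (FreeMonoid.ofList [A']) := by
    rw [barBasis_apply]; simp [hA']
  have h2 : ∀ B ∈ v, Odd B.1.card := fun B hB => hl _ (List.mem_map_of_mem hB)
  rw [h1, ← barBasis_apply, barMul, Module.Basis.constr_basis, Module.Basis.constr_basis]
  exact sum_mulComponent_singleton R (A := A') hA h2

theorem barOne_bracket_mul (x : Lam b R) (y : Bar b R) :
    barOne (bracket x * y) = TensorAlgebra.algebraMapInv y • barOne (bracket x) := by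
  have h : ∀ z : augIdeal b R, TensorAlgebra.ιInv (TensorAlgebra.ι R z * y) =
      TensorAlgebra.algebraMapInv y • z := by
    intro z
    -- `TensorAlgebra.ιInv` is defined by means of these instances, as the second component of the
    -- map to the trivial square-zero extension.
    let _ : Module Rᵐᵒᵖ (augIdeal b R) :=
      Module.compHom _ ((RingHom.id R).fromOpposite mul_comm)
    have _ : IsCentralScalar R (augIdeal b R) := ⟨fun r m => rfl⟩
    have hfst : ∀ y : Bar b R, (TensorAlgebra.toTrivSqZeroExt y).fst =
        TensorAlgebra.algebraMapInv y := by
      intro y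
      have : (TrivSqZeroExt.fstHom R R (augIdeal b R)).comp TensorAlgebra.toTrivSqZeroExt =
          TensorAlgebra.algebraMapInv := by
        ext m
        simp [TensorAlgebra.algebraMapInv]
      exact DFunLike.congr_fun this y
    have h2 : TensorAlgebra.ιInv (TensorAlgebra.ι R z * y) =
        (TensorAlgebra.toTrivSqZeroExt (TensorAlgebra.ι R z * y)).snd := rfl
    rw [h2, map_mul, TensorAlgebra.toTrivSqZeroExt_ι, TrivSqZeroExt.snd_mul, hfst]
    simp
  have hx : ∃ z : augIdeal b R, bracket x = TensorAlgebra.ι R z := by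
    refine ⟨∑ I : PosCube b, coeffOn I.1 x • augBasis b R I, ?_⟩
    simp [bracket, LinearMap.sum_apply]
  obtain ⟨z, hz⟩ := hx
  have h1 : TensorAlgebra.ιInv (TensorAlgebra.ι R z) = z := TensorAlgebra.ι_leftInverse z
  rw [hz, barOne, LinearMap.comp_apply, h, LinearMap.comp_apply, h1, map_smul]

theorem barOne_barWord {l : List (Finset (Fin b))} (hl : ∀ B ∈ l, Odd B.card) :
    barOne (barWord R l) =
      match (generalizing := false) l with
      | [B] => stdBasis b R B
      | _ => 0 := by
  have hscalar : ∀ (x : Lam b R) (y : Bar b R),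
      TensorAlgebra.algebraMapInv (bracket x * y) = (0 : R) := by
    intro x y
    have : TensorAlgebra.algebraMapInv (bracket x) = (0 : R) := by
      simp [bracket, LinearMap.sum_apply, TensorAlgebra.algebraMapInv]
    rw [map_mul, this, zero_mul]
  match l with
  | [] =>
    let _ : Module Rᵐᵒᵖ (augIdeal b R) :=
      Module.compHom _ ((RingHom.id R).fromOpposite mul_comm)
    have _ : IsCentralScalar R (augIdeal b R) := ⟨fun r m => rfl⟩
    have h : TensorAlgebra.ιInv (1 : Bar b R) =
        (TensorAlgebra.toTrivSqZeroExt (1 : Bar b R)).snd := rfl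
    rw [barWord_nil, barOne, LinearMap.comp_apply, h, map_one]
    simp
  | [B] =>
    have hB : B.Nonempty := Finset.card_pos.1 (hl B (by simp)).pos
    have h1 := bracket_stdBasis (R := R) (⟨B, hB⟩ : PosCube b)
    have h2 : TensorAlgebra.ιInv (TensorAlgebra.ι R (augBasis b R ⟨B, hB⟩)) =
      augBasis b R ⟨B, hB⟩ := TensorAlgebra.ι_leftInverse _
    rw [barWord_cons, barOne_bracket_mul, barWord_nil, map_one, one_smul]
    simp only at h1
    rw [h1, barOne, LinearMap.comp_apply, h2]
    exact augBasis_coe _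
  | B :: C :: l =>
    rw [barWord_cons, barOne_bracket_mul, barWord_cons, hscalar, zero_smul]

end BarMul
/-! ### Sums over ordered forests -/

section Forest

variable {b : ℕ} {ι : Type*} [DecidableEq ι] (I : ι → Finset (Fin b))

/-- The sum of `± φ [⋃ S₁, …, ⋃ S_q]` over all ordered partitions `S₁, …, S_q` of `T` into
hypertrees, the sign being the product of the signs of the hypertrees. The empty set, for which the
recursion would not terminate, may be left out because `treeSign I ∅ = 0`. -/
noncomputable def forestSum {X : Type*} [AddCommGroup X] (φ : List (Finset (Fin b)) → X)
    (T : Finset ι) : X :=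
  (if T = ∅ then φ [] else 0) + ∑ S ∈ (T.powerset.erase ∅).attach,
    treeSign I S.1 • forestSum (fun w => φ (S.1.biUnion I :: w)) (T \ S.1)
termination_by T.card
decreasing_by
  obtain ⟨h1, h2⟩ := Finset.mem_erase.1 S.2
  rw [Finset.mem_powerset] at h2
  rw [Finset.card_sdiff_of_subset h2]
  have := Finset.card_pos.2 (Finset.nonempty_iff_ne_empty.2 h1)
  have := Finset.card_le_card h2
  omega

variable {I} {X Y : Type*} [AddCommGroup X] [AddCommGroup Y]

theorem forestSum_eq (φ : List (Finset (Fin b)) → X) (T : Finset ι) :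
    forestSum I φ T = (if T = ∅ then φ [] else 0) + ∑ S ∈ T.powerset,
      treeSign I S • forestSum I (fun w => φ (S.biUnion I :: w)) (T \ S) := by
  rw [forestSum]
  congr 1
  rw [Finset.sum_attach (T.powerset.erase ∅)
    (fun S => treeSign I S • forestSum I (fun w => φ (S.biUnion I :: w)) (T \ S))]
  exact Finset.sum_erase _ (by simp)

theorem card_sdiff_lt {S T : Finset ι} (h : S ⊆ T) (hS : S ≠ ∅) : (T \ S).card < T.card := by
  rw [Finset.card_sdiff_of_subset h]
  have := Finset.card_pos.2 (Finset.nonempty_iff_ne_empty.2 hS)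
  have := Finset.card_le_card h
  omega

theorem forestSum_congr (hodd : ∀ j, Odd (I j).card) {φ ψ : List (Finset (Fin b)) → X}
    (h : ∀ l, (∀ B ∈ l, Odd B.card) → φ l = ψ l) (T : Finset ι) :
    forestSum I φ T = forestSum I ψ T := by
  induction hn : T.card using Nat.strong_induction_on generalizing T φ ψ with
  | _ n ih =>
    rw [forestSum_eq, forestSum_eq, h [] (by simp)]
    congr 1
    refine Finset.sum_congr rfl fun S hS => ?_
    by_cases h0 : treeSign I S = 0
    · rw [h0, zero_smul, zero_smul]
    · have hSe : S ≠ ∅ := by rintro rfl; simp at h0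
      rw [ih _ (hn ▸ card_sdiff_lt (Finset.mem_powerset.1 hS) hSe) _ _ rfl]
      intro l hl
      refine h _ fun B hB => ?_
      rcases List.mem_cons.1 hB with rfl | hB
      · exact odd_card_biUnion hodd h0
      · exact hl B hB

theorem map_forestSum (f : X →+ Y) (φ : List (Finset (Fin b)) → X) (T : Finset ι) :
    f (forestSum I φ T) = forestSum I (fun w => f (φ w)) T := by
  induction hn : T.card using Nat.strong_induction_on generalizing T φ with
  | _ n ih =>
    rw [forestSum_eq, forestSum_eq, map_add, map_sum, apply_ite f, map_zero]
    congr 1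
    refine Finset.sum_congr rfl fun S hS => ?_
    by_cases hSe : S = ∅
    · simp [hSe]
    · rw [map_zsmul, ih _ (hn ▸ card_sdiff_lt (Finset.mem_powerset.1 hS) hSe) _ _ rfl]

theorem forestSum_add (φ ψ : List (Finset (Fin b)) → X) (T : Finset ι) :
    forestSum I (fun w => φ w + ψ w) T = forestSum I φ T + forestSum I ψ T := by
  induction hn : T.card using Nat.strong_induction_on generalizing T φ ψ with
  | _ n ih =>
    rw [forestSum_eq, forestSum_eq, forestSum_eq, add_add_add_comm, ← Finset.sum_add_distrib]
    congr 1
    · split_ifs <;> simp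
    · refine Finset.sum_congr rfl fun S hS => ?_
      by_cases hSe : S = ∅
      · simp [hSe]
      · rw [ih _ (hn ▸ card_sdiff_lt (Finset.mem_powerset.1 hS) hSe) _ _ _ rfl, smul_add]

theorem forestSum_zero (T : Finset ι) : forestSum I (fun _ => (0 : X)) T = 0 := by
  have := map_forestSum (I := I) (0 : X →+ X) (fun _ => 0) T
  simpa using this.symm

theorem forestSum_sum {κ : Type*} (s : Finset κ) (φ : κ → List (Finset (Fin b)) → X)
    (T : Finset ι) :
    forestSum I (fun w => ∑ k ∈ s, φ k w) T = ∑ k ∈ s, forestSum I (φ k) T := by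
  classical
  induction s using Finset.induction_on with
  | empty => simp [forestSum_zero]
  | insert a s ha ih => simp only [Finset.sum_insert ha, forestSum_add, ih]

/-- Cutting an ordered forest in two at all places amounts to splitting its index set. -/
theorem forestSum_cut (β : List (Finset (Fin b)) → List (Finset (Fin b)) → X) (T : Finset ι) :
    forestSum I (fun w => ∑ j ∈ Finset.range (w.length + 1), β (w.take j) (w.drop j)) T =
      ∑ S ∈ T.powerset, forestSum I (fun w₁ => forestSum I (fun w₂ => β w₁ w₂) (T \ S)) S := by
  induction hn : T.card using Nat.strong_induction_on generalizing T β with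
  | _ n ih =>
    have hL : ∀ S ∈ T.powerset,
        treeSign I S • forestSum I (fun w => ∑ j ∈ Finset.range ((S.biUnion I :: w).length + 1),
          β ((S.biUnion I :: w).take j) ((S.biUnion I :: w).drop j)) (T \ S) =
        treeSign I S • forestSum I (fun w => β [] (S.biUnion I :: w)) (T \ S) +
        ∑ S' ∈ (T \ S).powerset, treeSign I S • forestSum I (fun w₁ =>
          forestSum I (fun w₂ => β (S.biUnion I :: w₁) w₂) ((T \ S) \ S')) S' := by
      intro S hS
      by_cases hSe : S = ∅
      · simp [hSe]
      · have h1 : ∀ w : List (Finset (Fin b)),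
            ∑ j ∈ Finset.range ((S.biUnion I :: w).length + 1),
              β ((S.biUnion I :: w).take j) ((S.biUnion I :: w).drop j) =
            β [] (S.biUnion I :: w) + ∑ j ∈ Finset.range (w.length + 1),
              β (S.biUnion I :: w.take j) (w.drop j) := by
          intro w
          rw [List.length_cons, Finset.sum_range_succ', add_comm]
          rfl
        simp only [h1]
        rw [forestSum_add, ih _ (hn ▸ card_sdiff_lt (Finset.mem_powerset.1 hS) hSe)
          (fun w₁ w₂ => β (S.biUnion I :: w₁) w₂) _ rfl, smul_add, Finset.smul_sum]
    have hR : ∀ P ∈ T.powerset,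
        forestSum I (fun w₁ => forestSum I (fun w₂ => β w₁ w₂) (T \ P)) P =
        (if P = ∅ then forestSum I (fun w₂ => β [] w₂) T else 0) +
        ∑ S ∈ P.powerset, treeSign I S • forestSum I (fun w₁ =>
          forestSum I (fun w₂ => β (S.biUnion I :: w₁) w₂) (T \ P)) (P \ S) := by
      intro P _
      rw [forestSum_eq]
      congr 1
      split_ifs with h
      · rw [h, Finset.sdiff_empty]
      · rfl
    rw [forestSum_eq, Finset.sum_congr rfl hL, Finset.sum_congr rfl hR, Finset.sum_add_distrib,
      Finset.sum_add_distrib, ← add_assoc]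
    congr 1
    · rw [Finset.sum_ite_eq', if_pos (Finset.empty_mem_powerset T), forestSum_eq]
      simp
    · rw [Finset.sum_sigma', Finset.sum_sigma']
      refine Finset.sum_bij' (fun p _ => ⟨p.1 ∪ p.2, p.1⟩) (fun p _ => ⟨p.2, p.1 \ p.2⟩)
        ?_ ?_ ?_ ?_ ?_
      · rintro ⟨S, S'⟩ h
        simp only [Finset.mem_sigma, Finset.mem_powerset] at h ⊢
        exact ⟨Finset.union_subset h.1 (h.2.trans Finset.sdiff_subset), Finset.subset_union_left⟩
      · rintro ⟨P, S⟩ h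
        simp only [Finset.mem_sigma, Finset.mem_powerset] at h ⊢
        exact ⟨h.2.trans h.1, Finset.sdiff_subset_sdiff h.1 subset_rfl⟩
      · rintro ⟨S, S'⟩ h
        simp only [Finset.mem_sigma, Finset.mem_powerset] at h
        have hd : Disjoint S' S := Finset.disjoint_left.2 fun x h1 h2 =>
          (Finset.mem_sdiff.1 (h.2 h1)).2 h2
        simp only [Finset.union_sdiff_left, Finset.sdiff_eq_self_of_disjoint hd]
      · rintro ⟨P, S⟩ h
        simp only [Finset.mem_sigma, Finset.mem_powerset] at h
        simp only [Finset.union_sdiff_of_subset h.2]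
      · rintro ⟨S, S'⟩ h
        simp only [Finset.mem_sigma, Finset.mem_powerset] at h
        have hd : Disjoint S' S := Finset.disjoint_left.2 fun x h1 h2 =>
          (Finset.mem_sdiff.1 (h.2 h1)).2 h2
        have e1 : (T \ S) \ S' = T \ (S ∪ S') := by
          ext x; simp only [Finset.mem_sdiff, Finset.mem_union]; tauto
        simp only [Finset.union_sdiff_left, Finset.sdiff_eq_self_of_disjoint hd, e1]

variable (R : Type*) [CommRing R]

/-- Inserting ordered forests into `e^A` in all possible ways yields the hypertrees with root
`A`. -/
theorem forestSum_simInsert (hodd : ∀ j, Odd (I j).card) (A : Finset (Fin b)) (T : Finset ι) :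
    forestSum I (simInsert R A) T = rootedSign I A T • stdBasis b R (A ∪ T.biUnion I) := by
  induction hn : T.card using Nat.strong_induction_on generalizing T A with
  | _ n ih =>
    by_cases hT : T = ∅
    · subst hT
      rw [forestSum_eq]
      simp [simInsert]
    · rw [forestSum_eq, if_neg hT, zero_add,
        ← sum_branches hodd A (Finset.nonempty_iff_ne_empty.2 hT)]
      refine Finset.sum_congr rfl fun S hS => ?_
      by_cases hSe : S = ∅
      · simp [hSe]
      · have hlt := hn ▸ card_sdiff_lt (Finset.mem_powerset.1 hS) hSe
        congr 1
        simp only [simInsert]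
        rw [forestSum_sum]
        refine Finset.sum_congr rfl fun i _ => ?_
        have h1 := map_forestSum (I := I) ((AddMonoidHom.mulLeft
          (stdBasis b R (A.filter (· < i)))).comp (AddMonoidHom.mulLeft
            (stdBasis b R (S.biUnion I)))) (simInsert R (A.filter (i < ·))) (T \ S)
        rw [ih _ hlt _ _ rfl] at h1
        exact h1.symm

/-- The terms in which the set `I a` belongs to the first letter are the ordered forests whose first
hypertree contains `a`. -/
theorem forestSum_leadingTerms (hodd : ∀ j, Odd (I j).card) {a : ι} {T : Finset ι} (ha : a ∉ T) :
    forestSum I (leadingTerms R (I a)) T = ∑ S ∈ T.powerset, treeSign I (insert a S) •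
      (bracket (stdBasis b R ((insert a S).biUnion I)) * forestSum I (barWord R) (T \ S)) := by
  rw [show leadingTerms R (I a) = fun w => ∑ j ∈ Finset.range (w.length + 1),
    bracket (simInsert R (I a) (w.take j)) * barWord R (w.drop j) from rfl,
    forestSum_cut (fun w₁ w₂ => bracket (simInsert R (I a) w₁) * barWord R w₂)]
  refine Finset.sum_congr rfl fun S hS => ?_
  have haS : a ∉ S := fun h => ha (Finset.mem_powerset.1 hS h)
  have h1 : ∀ w₁, forestSum I (fun w₂ => bracket (simInsert R (I a) w₁) * barWord R w₂) (T \ S) =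
      bracket (simInsert R (I a) w₁) * forestSum I (barWord R) (T \ S) := fun w₁ =>
    (map_forestSum (I := I) (AddMonoidHom.mulLeft (bracket (simInsert R (I a) w₁)))
      (barWord R) (T \ S)).symm
  simp only [h1]
  have h2 := map_forestSum (I := I) ((AddMonoidHom.mulRight
    (forestSum I (barWord R) (T \ S))).comp (bracket (R := R) (b := b)).toAddMonoidHom)
      (simInsert R (I a)) S
  rw [forestSum_simInsert R hodd] at h2
  refine h2.symm.trans ?_
  rw [treeSign_insert hodd haS, Finset.biUnion_insert]
  simp only [AddMonoidHom.comp_apply, LinearMap.toAddMonoidHom_coe, map_zsmul,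
    AddMonoidHom.mulRight_apply]

/-- Left multiplication by `[e^{I a}]` adds the index `a` to ordered forests. -/
theorem forestSum_leftMulWord (hodd : ∀ j, Odd (I j).card) {a : ι} {T : Finset ι} (ha : a ∉ T) :
    forestSum I (leftMulWord R (I a)) T = forestSum I (barWord R) (insert a T) := by
  induction hn : T.card using Nat.strong_induction_on generalizing T with
  | _ n ih =>
    have hterm : ∀ S ∈ T.powerset,
        treeSign I S • forestSum I (fun w => leftMulWord R (I a) (S.biUnion I :: w)) (T \ S) =
        treeSign I S • (bracket (stdBasis b R (S.biUnion I)) *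
          forestSum I (barWord R) (insert a T \ S)) +
        treeSign I S • forestSum I (fun w => leadingTerms R (I a) (S.biUnion I :: w)) (T \ S) := by
      intro S hS
      by_cases hSe : S = ∅
      · simp [hSe]
      · have haS : a ∉ S := fun h => ha (Finset.mem_powerset.1 hS h)
        have h1 := map_forestSum (I := I) (AddMonoidHom.mulLeft
          (bracket (stdBasis b R (S.biUnion I)))) (leftMulWord R (I a)) (T \ S)
        rw [ih _ (hn ▸ card_sdiff_lt (Finset.mem_powerset.1 hS) hSe)
          (fun h => ha (Finset.mem_sdiff.1 h).1) rfl, ← Finset.insert_sdiff_of_notMem _ haS] at h1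
        simp only [leftMulWord]
        rw [forestSum_add, smul_add]
        congr 2
        exact h1.symm
    rw [forestSum_eq, Finset.sum_congr rfl hterm, Finset.sum_add_distrib, add_left_comm]
    have hlead := forestSum_eq (I := I) (leadingTerms R (I a)) T
    have hnil : leftMulWord R (I a) [] = leadingTerms R (I a) [] := rfl
    rw [hnil, ← hlead, forestSum_leadingTerms R hodd ha, forestSum_eq (T := insert a T),
      if_neg (Finset.insert_ne_empty a T), zero_add, Finset.sum_powerset_insert ha]
    have hmul : ∀ (B : Finset (Fin b)) (P : Finset ι),
        forestSum I (fun w => barWord R (B :: w)) P =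
          bracket (stdBasis b R B) * forestSum I (barWord R) P := by
      intro B P
      simp only [barWord_cons]
      exact (map_forestSum (I := I) (AddMonoidHom.mulLeft (bracket (stdBasis b R B)))
        (barWord R) P).symm
    simp only [hmul]
    congr 1
    refine Finset.sum_congr rfl fun S hS => ?_
    rw [Finset.insert_sdiff_insert, Finset.sdiff_insert_of_notMem ha]

theorem iterMul_cons (a : Lam b R) (a' : Lam b R) (l : List (Lam b R)) :
    iterMul (a :: a' :: l) = barMul (bracket a) (iterMul (a' :: l)) := rfl

/-- The iterated left product `μ_n` of odd basis elements is the sum over all ordered forests. -/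
theorem iterMul_stdBasis (hodd : ∀ j, Odd (I j).card) {l : List ι} (hl : l.Nodup) :
    iterMul (l.map fun j => stdBasis b R (I j)) = forestSum I (barWord R) l.toFinset := by
  induction l with
  | nil =>
    rw [forestSum_eq]
    simp [iterMul]
  | cons a l ih =>
    obtain ⟨hal, hl⟩ := List.nodup_cons.1 hl
    have hal' : a ∉ l.toFinset := by simpa using hal
    rw [List.toFinset_cons, ← forestSum_leftMulWord R hodd hal']
    cases l with
    | nil =>
      rw [List.toFinset_nil, forestSum_eq]
      simp [iterMul, leftMulWord, leadingTerms, simInsert]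
    | cons a' l =>
      have ih' := ih hl
      rw [List.map_cons] at ih'
      rw [List.map_cons, List.map_cons, iterMul_cons, ih']
      refine (map_forestSum (I := I) (barMul (bracket (stdBasis b R (I a)))).toAddMonoidHom
        (barWord R) _).trans (forestSum_congr hodd (fun w hw => ?_) _)
      exact barMul_bracket_barWord R (hodd a) hw

/-- The component in `(BΛ)₁` of the sum over ordered forests is contributed by the forests which
consist of one hypertree. -/
theorem barOne_forestSum (hodd : ∀ j, Odd (I j).card) (T : Finset ι) :
    barOne (forestSum I (barWord R) T) = treeSign I T • stdBasis b R (T.biUnion I) := by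
  have h1 := map_forestSum (I := I) (barOne (b := b) (R := R)).toAddMonoidHom (barWord R) T
  refine h1.trans ?_
  rw [forestSum_congr hodd (ψ := fun l => match l with
    | [B] => stdBasis b R B
    | _ => 0) fun l hl => barOne_barWord R hl]
  have hempty : ∀ (c : Lam b R) (P : Finset ι), forestSum I (fun w => match w with
      | [] => c
      | _ => 0) P = if P = ∅ then c else 0 := by
    intro c P
    rw [forestSum_eq]
    simp [forestSum_zero]
  have hcons : ∀ (B : Finset (Fin b)), (fun w : List (Finset (Fin b)) => (match B :: w with
      | [B] => stdBasis b R B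
      | _ => 0 : Lam b R)) = fun w => match w with
      | [] => stdBasis b R B
      | _ => 0 := by
    intro B; funext w; cases w <;> rfl
  rw [forestSum_eq]
  simp only [hcons, hempty]
  rw [Finset.sum_eq_single T]
  · simp
  · intro S hS hST
    rw [if_neg, smul_zero]
    rw [Finset.sdiff_eq_empty_iff_subset]
    exact fun h => hST ((Finset.mem_powerset.1 hS).antisymm h)
  · simp

end Forest
/-! ### Reindexing -/

section Reindex

variable {b : ℕ} {ι κ : Type*} [DecidableEq ι] [DecidableEq κ] [Fintype ι] [Fintype κ]
  {I : ι → Finset (Fin b)}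

theorem rootedSign_comp_equiv (hodd : ∀ j, Odd (I j).card) (e : κ ≃ ι) (A : Finset (Fin b)) :
    rootedSign (fun k => I (e k)) A Finset.univ = rootedSign I A Finset.univ := by
  have huniv : ∀ l : List κ, l.toFinset = Finset.univ → (l.map e).toFinset = Finset.univ := by
    intro l hl
    ext j
    have : e.symm j ∈ l := by rw [← List.mem_toFinset, hl]; exact Finset.mem_univ _
    simp only [List.mem_toFinset, List.mem_map, Finset.mem_univ, iff_true]
    exact ⟨_, this, e.apply_symm_apply j⟩
  have hmap : ∀ l : List κ, (l.map e).map I = l.map fun k => I (e k) := fun l => by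
    rw [List.map_map]; rfl
  by_cases h : AttachesTo (fun k => I (e k)) A Finset.univ
  · obtain ⟨l, h1, h2, h3⟩ := h
    rw [← huniv l h2, ← h2, rootedSign_eq (fun k => hodd (e k)) h1 h3,
      rootedSign_eq hodd (h1.map e.injective) (by rwa [hmap]), hmap]
  · rw [rootedSign_eq_zero h, rootedSign_eq_zero]
    rintro ⟨l, h1, h2, h3⟩
    refine h ⟨l.map e.symm, h1.map e.symm.injective, ?_, ?_⟩
    · ext k
      have : e k ∈ l := by rw [← List.mem_toFinset, h2]; exact Finset.mem_univ _
      simp only [List.mem_toFinset, List.mem_map, Finset.mem_univ, iff_true]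
      exact ⟨_, this, e.symm_apply_apply k⟩
    · have hl : (l.map e.symm).map e = l := by simp
      rwa [← hmap, hl]

theorem biUnion_comp_equiv (e : κ ≃ ι) :
    Finset.univ.biUnion (fun k => I (e k)) = Finset.univ.biUnion I := by
  ext x
  simp only [Finset.mem_biUnion, Finset.mem_univ, true_and]
  exact e.exists_congr_left.trans (by simp)

theorem treeSign_comp_equiv (hodd : ∀ j, Odd (I j).card) (e : κ ≃ ι) :
    treeSign (fun k => I (e k)) Finset.univ = treeSign I Finset.univ := by
  by_cases h : (Finset.univ.biUnion I).Nonempty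
  · obtain ⟨i, hi⟩ := h
    rw [treeSign_eq hodd hi, treeSign_eq (I := fun k => I (e k)) (fun k => hodd (e k))
      (by rwa [biUnion_comp_equiv]), rootedSign_comp_equiv hodd]
  · have h' : ¬ (Finset.univ.biUnion fun k => I (e k)).Nonempty := by rwa [biUnion_comp_equiv]
    rw [treeSign, treeSign, dif_neg h, dif_neg h']

theorem insertionOnBasis_comp_equiv [Nonempty ι] {R : Type*} [CommRing R]
    (hodd : ∀ j, Odd (I j).card) (e : κ ≃ ι) :
    insertionOnBasis R (fun k => I (e k)) = insertionOnBasis R I := by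
  have : Nonempty κ := ⟨e.symm (Classical.arbitrary ι)⟩
  rw [insertionOnBasis_eq hodd, insertionOnBasis_eq fun k => hodd (e k), treeSign_comp_equiv hodd,
    biUnion_comp_equiv]

end Reindex

/-! ### Multilinear extension -/

section Multilinear

variable {b : ℕ} {R : Type*} [CommRing R]

theorem coeffOn_eq_zero_of_mem {n : ℕ} {x : Lam b R} (hx : x ∈ ⋀[R]^n (Fin b → R))
    {J : Finset (Fin b)} (hJ : J.card ≠ n) : coeffOn J x = 0 := by
  have h1 := ((Pi.basisFun R (Fin b)).exteriorPower n).sum_repr ⟨x, hx⟩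
  have h2 : x = ∑ s, ((Pi.basisFun R (Fin b)).exteriorPower n).repr ⟨x, hx⟩ s •
      stdBasis b R s.1 := by
    have h3 := congrArg (Subtype.val) h1
    rw [Submodule.coe_sum] at h3
    refine h3.symm.trans (Finset.sum_congr rfl fun s _ => ?_)
    rw [Submodule.coe_smul, stdBasis, ExteriorAlgebra.basis_eq_coe_basis]
  rw [h2, map_sum]
  refine Finset.sum_eq_zero fun s _ => ?_
  have hs : s.1.card = n := s.2
  have : s.1 ≠ J := fun h => hJ (h ▸ hs)
  rw [map_smul, coeffOn_stdBasis, if_neg this, smul_zero]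

theorem stdBasis_mem (J : Finset (Fin b)) :
    stdBasis b R J ∈ ⋀[R]^J.card (Fin b → R) := by
  have := ExteriorAlgebra.basis_eq_coe_basis (Pi.basisFun R (Fin b))
    (⟨J, rfl⟩ : Set.powersetCard (Fin b) J.card)
  rw [stdBasis, this]
  exact Subtype.property _

theorem mem_of_coeffOn {n : ℕ} {x : Lam b R}
    (h : ∀ J : Finset (Fin b), J.card ≠ n → coeffOn J x = 0) : x ∈ ⋀[R]^n (Fin b → R) := by
  rw [← sum_coeffOn x]
  refine Submodule.sum_mem _ fun J _ => ?_
  by_cases hJ : J.card = n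
  · exact Submodule.smul_mem _ _ (hJ ▸ stdBasis_mem J)
  · rw [h J hJ, zero_smul]; exact Submodule.zero_mem _

theorem coeffOn_eq_zero_of_mem_oddPart {x : Lam b R} (hx : x ∈ oddPart b R)
    {J : Finset (Fin b)} (hJ : ¬ Odd J.card) : coeffOn J x = 0 := by
  have h : oddPart b R ≤ LinearMap.ker (coeffOn (R := R) J) := by
    refine iSup_le fun k y hy => LinearMap.mem_ker.2 (coeffOn_eq_zero_of_mem hy fun h => hJ ?_)
    rw [h]; exact odd_two_mul_add_one k
  exact LinearMap.mem_ker.1 (h hx)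

theorem multilinear_expand {M : Type*} [AddCommGroup M] [Module R M] {n : ℕ}
    (f : MultilinearMap R (fun _ : Fin n => Lam b R) M) (a : Fin n → Lam b R) :
    f a = ∑ J : Fin n → Finset (Fin b),
      (∏ k, coeffOn (J k) (a k)) • f (fun k => stdBasis b R (J k)) := by
  classical
  conv_lhs => rw [show a = fun k => ∑ J, coeffOn J (a k) • stdBasis b R J from
    funext fun k => (sum_coeffOn (a k)).symm]
  rw [f.map_sum]
  exact Finset.sum_congr rfl fun J _ => f.map_smul_univ _ _

/-- Multilinear maps which agree on odd basis elements agree on odd elements. -/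
theorem multilinear_ext_odd {M : Type*} [AddCommGroup M] [Module R M] {n : ℕ}
    {f g : MultilinearMap R (fun _ : Fin n => Lam b R) M}
    (h : ∀ J : Fin n → Finset (Fin b), (∀ k, Odd (J k).card) →
      f (fun k => stdBasis b R (J k)) = g (fun k => stdBasis b R (J k)))
    {a : Fin n → Lam b R} (ha : ∀ k, a k ∈ oddPart b R) : f a = g a := by
  rw [multilinear_expand f, multilinear_expand g]
  refine Finset.sum_congr rfl fun J _ => ?_
  by_cases hJ : ∀ k, Odd (J k).card
  · rw [h J hJ]
  · obtain ⟨k, hk⟩ := not_forall.1 hJ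
    rw [Finset.prod_eq_zero (Finset.mem_univ k) (coeffOn_eq_zero_of_mem_oddPart (ha k) hk),
      zero_smul, zero_smul]

/-- The insertion product is symmetric on odd elements. -/
theorem insertionProduct_comp_perm {n : ℕ} {a : Fin n → Lam b R} (ha : ∀ k, a k ∈ oddPart b R)
    (σ : Equiv.Perm (Fin n)) :
    insertionProduct b R n (fun k => a (σ k)) = insertionProduct b R n a := by
  have h := multilinear_ext_odd (f := (insertionProduct b R n).domDomCongr σ)
    (g := insertionProduct b R n) (fun J hJ => by
      rw [MultilinearMap.domDomCongr_apply, insertionProduct_stdBasis J,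
        insertionProduct_stdBasis fun k => J (σ k)]
      cases n with
      | zero => congr 1; funext k; exact k.elim0
      | succ n => exact insertionOnBasis_comp_equiv hJ σ) ha
  simpa using h

/-- The iterated left product, as a multilinear map. -/
noncomputable def iterMulMultilinear (b : ℕ) (R : Type*) [CommRing R] :
    (n : ℕ) → MultilinearMap R (fun _ : Fin (n + 1) => Lam b R) (Bar b R)
  | 0 => (LinearMap.compMultilinearMap (bracket (b := b) (R := R))
      (MultilinearMap.ofSubsingleton R (Lam b R) (Lam b R) (0 : Fin 1) LinearMap.id))
  | n + 1 => LinearMap.uncurryLeft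
      { toFun := fun x => (barMul (bracket x)).compMultilinearMap (iterMulMultilinear b R n)
        map_add' := fun x y => by ext; simp
        map_smul' := fun c x => by ext; simp }

theorem iterMulMultilinear_apply (n : ℕ) (a : Fin (n + 1) → Lam b R) :
    iterMulMultilinear b R n a = iterMul (List.ofFn a) := by
  induction n with
  | zero => simp [iterMulMultilinear, iterMul]
  | succ n ih =>
    rw [List.ofFn_succ, List.ofFn_succ, iterMul_cons, ← List.ofFn_succ (f := fun i => a i.succ),
      ← ih]
    rfl

/-- On odd elements, iterated left multiplication in the bar construction is the insertion
product. -/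
theorem barOne_iterMul {n : ℕ} (hn : 1 ≤ n) {a : Fin n → Lam b R} (ha : ∀ k, a k ∈ oddPart b R) :
    barOne (iterMul (List.ofFn a)) = insertionProduct b R n a := by
  obtain ⟨m, rfl⟩ := Nat.exists_eq_add_of_le' hn
  have h := multilinear_ext_odd (f := (barOne (b := b)).compMultilinearMap
    (iterMulMultilinear b R m)) (g := insertionProduct b R (m + 1)) (fun J hJ => by
      rw [LinearMap.compMultilinearMap_apply, iterMulMultilinear_apply, insertionProduct_stdBasis,
        insertionOnBasis_eq hJ]
      have h1 : List.ofFn (fun k => stdBasis b R (J k)) =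
          (List.finRange (m + 1)).map fun k => stdBasis b R (J k) := List.ofFn_eq_map
      rw [h1, iterMul_stdBasis R hJ (List.nodup_finRange _), barOne_forestSum R hJ,
        List.toFinset_finRange]) ha
  rw [← h, LinearMap.compMultilinearMap_apply, iterMulMultilinear_apply]

theorem cupOne_stdBasis {A B : Finset (Fin b)} (hA : Odd A.card) (hB : Odd B.card)
    (h : (A ∩ B).card = 1) : cupOne (stdBasis b R A) (stdBasis b R B) = insertBasis A B := by
  have h1 := hirschE_one_stdBasis R (q := 1) hA (B := fun _ => B) fun _ => hB
  rw [cupOne, h1, insertBasis, if_pos h]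
  simp [simInsert, mul_assoc]

/-- The cup-1 product of odd basis elements which meet in one point is insertion. -/
theorem cupOne_zsmul_stdBasis (s : ℤ) {A B : Finset (Fin b)} (hA : Odd A.card) (hB : Odd B.card)
    (h : (A ∩ B).card = 1) :
    cupOne (s • stdBasis b R A) (stdBasis b R B) = s • insertBasis A B := by
  rw [← cupOne_stdBasis hA hB h, cupOne, cupOne, hirschE, hirschE, Finset.smul_sum]
  refine Finset.sum_congr rfl fun S _ => ?_
  rw [← smul_assoc, Finsupp.smul_sum]
  congr 1
  refine Finsupp.sum_congr fun o _ => ?_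
  simp only [Finset.univ_unique, Finset.prod_singleton]
  rw [map_zsmul]
  simp only [zsmul_eq_mul]
  ring

end Multilinear
/-! ### Insertion powers -/

section Power

variable {b : ℕ} {R : Type*} [CommRing R]

/-- In a 1-regular family two members with at least two points are distinct, since equal members
would contribute parallel edges. -/
theorem OneRegular.injective {ι : Type*} {I : ι → Finset (Fin b)} (h : OneRegular I)
    (hI : ∀ j, 1 < (I j).card) : Function.Injective I := by
  intro j k hjk
  obtain ⟨x, hx, y, hy, hxy⟩ := Finset.one_lt_card.1 (hI j)
  have key : ∃ u v, Consecutive (I j) u v := by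
    rcases lt_or_gt_of_ne hxy with hlt | hlt
    · exact ⟨_, exists_consecutive hx hy hlt⟩
    · exact ⟨_, exists_consecutive hy hx hlt⟩
  obtain ⟨u, v, huv⟩ := key
  exact h.2 j k u v huv (hjk ▸ huv)

theorem mem_oddPart_of_mem {n : ℕ} (hn : Odd n) {x : Lam b R} (hx : x ∈ ⋀[R]^n (Fin b → R)) :
    x ∈ oddPart b R := by
  obtain ⟨k, rfl⟩ := hn
  exact Submodule.mem_iSup_of_mem k hx

/-- A product of coefficients of a form of degree three vanishes unless all sets have three
elements. -/
theorem prod_coeffOn_eq_zero {κ : Type*} {a : Lam b R} (ha : a ∈ ⋀[R]^3 (Fin b → R))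
    {s : Finset κ} {J : κ → Finset (Fin b)} (h : ¬ ∀ k ∈ s, (J k).card = 3) :
    ∏ k ∈ s, coeffOn (J k) a = 0 := by
  push Not at h
  obtain ⟨k, hk, hJ⟩ := h
  exact Finset.prod_eq_zero hk (coeffOn_eq_zero_of_mem ha hJ)

theorem odd_of_eq_three {n : ℕ} (h : n = 3) : Odd n := h ▸ by decide

/-- Each unordered family of `n` distinct sets is listed by `n!` injective maps, all with the same
insertion product. -/
theorem factorial_smul_insertionPower {a : Lam b R} (ha : a ∈ ⋀[R]^3 (Fin b → R)) {n : ℕ}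
    (hn : 1 ≤ n) :
    (n.factorial : R) • insertionPower a n = insertionProduct b R n fun _ => a := by
  classical
  have : Nonempty (Fin n) := ⟨⟨0, hn⟩⟩
  rw [multilinear_expand, insertionPower, Finset.smul_sum]
  simp only [insertionProduct_stdBasis]
  have hinj : ∀ J : Fin n → Finset (Fin b), J ∈ Finset.univ →
      (∏ k, coeffOn (J k) a) • insertionOnBasis R J ≠ 0 → Function.Injective J := by
    intro J _ hJ
    have h3 : ∀ k ∈ Finset.univ, (J k).card = 3 := by
      by_contra h
      rw [prod_coeffOn_eq_zero ha h, zero_smul] at hJ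
      exact hJ rfl
    refine OneRegular.injective (by_contra fun h => hJ ?_) fun k => by
      rw [h3 k (Finset.mem_univ k)]; decide
    rw [insertionOnBasis, if_neg h, smul_zero]
  rw [← Finset.sum_filter_of_ne hinj, ← Finset.sum_fiberwise_of_maps_to
    (g := fun J : Fin n → Finset (Fin b) => Finset.univ.image J)
    (t := (Finset.univ : Finset (Finset (Fin b))).powersetCard n)]
  swap
  · intro J hJ
    rw [Finset.mem_powersetCard, Finset.card_image_of_injective _ (Finset.mem_filter.1 hJ).2]
    exact ⟨Finset.subset_univ _, by simp⟩
  refine Finset.sum_congr rfl fun s hs => ?_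
  have hcard : Fintype.card s = n := by
    rw [Fintype.card_coe]; exact (Finset.mem_powersetCard.1 hs).2
  let e₀ : Fin n ≃ s := (Fintype.equivFinOfCardEq hcard).symm
  have : Nonempty s := e₀.nonempty_congr.1 inferInstance
  have hconst : ∀ e : Fin n ≃ s, (∏ k, coeffOn (e k).1 a) • insertionOnBasis R (fun k => (e k).1) =
      (∏ I ∈ s, coeffOn I a) • insertionOnBasis R fun I : {I // I ∈ s} => I.1 := by
    intro e
    rw [e.prod_comp (fun I : s => coeffOn I.1 a), Finset.prod_coe_sort s fun I => coeffOn I a]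
    by_cases h : ∀ I ∈ s, I.card = 3
    · rw [insertionOnBasis_comp_equiv (I := fun I : {I // I ∈ s} => I.1)
        (fun I => odd_of_eq_three (h I.1 I.2)) e]
    · rw [prod_coeffOn_eq_zero (J := fun I => I) ha h, zero_smul, zero_smul]
  symm
  calc _ = ∑ e : Fin n ≃ s, (∏ k, coeffOn (e k).1 a) • insertionOnBasis R (fun k => (e k).1) := by
        symm
        refine Finset.sum_bij (fun e _ k => (e k).1) ?_ ?_ ?_ fun _ _ => rfl
        · intro e _
          rw [Finset.mem_filter, Finset.mem_filter]
          refine ⟨⟨Finset.mem_univ _, Subtype.val_injective.comp e.injective⟩, ?_⟩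
          ext I
          simp only [Finset.mem_image, Finset.mem_univ, true_and]
          exact ⟨fun ⟨k, hk⟩ => hk ▸ (e k).2, fun hI => ⟨e.symm ⟨I, hI⟩, by simp⟩⟩
        · intro e _ e' _ h
          ext k : 1
          exact Subtype.ext (congrFun h k)
        · intro J hJ
          rw [Finset.mem_filter, Finset.mem_filter] at hJ
          obtain ⟨⟨-, hJ⟩, rfl⟩ := hJ
          have hmem : ∀ k, J k ∈ Finset.univ.image J := fun k =>
            Finset.mem_image_of_mem J (Finset.mem_univ k)
          refine ⟨Equiv.ofBijective (fun k => ⟨J k, hmem k⟩) ⟨fun k k' h =>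
            hJ (congrArg Subtype.val h), ?_⟩, Finset.mem_univ _, rfl⟩
          rintro ⟨I, hI⟩
          obtain ⟨k, -, rfl⟩ := Finset.mem_image.1 hI
          exact ⟨k, rfl⟩
    _ = _ := by
        rw [Finset.sum_congr rfl fun e _ => hconst e, Finset.sum_const, Finset.card_univ,
          Fintype.card_equiv e₀, Fintype.card_fin, Nat.cast_smul_eq_nsmul]

/-- A hypertree of `n` triples has `2n + 1` points. -/
theorem insertionPower_mem {a : Lam b R} (ha : a ∈ ⋀[R]^3 (Fin b → R)) {n : ℕ} (hn : 1 ≤ n) :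
    insertionPower a n ∈ ⋀[R]^(2 * n + 1) (Fin b → R) := by
  refine Submodule.sum_mem _ fun s hs => ?_
  have hcard := (Finset.mem_powersetCard.1 hs).2
  by_cases h : ∀ I ∈ s, I.card = 3
  · have : Nonempty {I // I ∈ s} := (Finset.card_pos.1 (by omega : 0 < s.card)).to_subtype
    have hodd : ∀ I : {I // I ∈ s}, Odd I.1.card := fun I => odd_of_eq_three (h I.1 I.2)
    rw [insertionOnBasis_eq hodd]
    by_cases h0 : treeSign (fun I : {I // I ∈ s} => I.1) Finset.univ = 0
    · rw [h0, zero_smul, smul_zero]; exact Submodule.zero_mem _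
    · refine Submodule.smul_mem _ _ (zsmul_mem ?_ _)
      obtain ⟨i, hi⟩ := nonempty_of_treeSign_ne_zero h0
      rw [treeSign_eq hodd hi] at h0
      have h1 := ((attachesTo_iff (nonempty_of_odd hodd)).1 (rootedSign_ne_zero_iff.1 h0)).2
      rw [Finset.union_eq_right.2 (Finset.singleton_subset_iff.2 hi), Finset.card_singleton,
        Finset.card_univ, Fintype.card_coe, Finset.sum_congr rfl fun I _ => h I.1 I.2,
        Finset.sum_const, Finset.card_univ, Fintype.card_coe, smul_eq_mul] at h1
      have h2 : (Finset.univ.biUnion fun I : {I // I ∈ s} => I.1).card = 2 * n + 1 := by omega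
      rw [← h2]
      exact stdBasis_mem _
  · rw [prod_coeffOn_eq_zero (J := fun I => I) ha h, zero_smul]
    exact Submodule.zero_mem _

end Power

/-! ### Twisting sequences -/

section Twisting

variable {b : ℕ} {R : Type*} [CommRing R]

theorem dirs_update {F : Face b} {i : Fin b} {l : Letter} (hl : l ≠ Letter.full) :
    Face.dirs (Function.update F i l) = F.dirs.erase i := by
  ext k
  simp only [Face.dirs, Finset.mem_filter, Finset.mem_univ, true_and, Finset.mem_erase,
    Function.update_apply]
  split_ifs with h <;> simp [h, hl]

/-- The opposite faces of a cube are identified in the minimal torus, so its cochains have zero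
differential. -/
theorem coboundary_eq_zero : (coboundary : Lam b R →ₗ[R] Lam b R) = 0 := by
  refine Finset.sum_eq_zero fun S _ => ?_
  let φ : (Face b →₀ ℤ) →+ (Lam b R →ₗ[R] R) := Finsupp.liftAddHom fun F =>
    { toFun := fun c => (c : R) • coeffOn F.dirs
      map_zero' := by simp
      map_add' := fun c c' => by rw [Int.cast_add, add_smul] }
  have hφ : ∀ F c, φ (Finsupp.single F c) = (c : R) • coeffOn F.dirs := fun F c => by
    rw [Finsupp.liftAddHom_apply_single]; rfl
  have h : φ (boundary (faceOf S)) = 0 := by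
    rw [boundary, map_sum]
    refine Finset.sum_eq_zero fun i _ => ?_
    rw [map_zsmul, map_sub, hφ, hφ, dirs_update (by decide), dirs_update (by decide), sub_self,
      smul_zero]
  change (φ (boundary (faceOf S))).smulRight _ = 0
  rw [h]
  ext
  simp

theorem mul_eq_neg_mul_of_mem_oddPart {x y : Lam b R} (hx : x ∈ oddPart b R)
    (hy : y ∈ oddPart b R) : x * y = -(y * x) := by
  rw [← sum_coeffOn x, ← sum_coeffOn y, Finset.sum_mul_sum, Finset.sum_mul_sum, Finset.sum_comm,
    ← Finset.sum_neg_distrib]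
  refine Finset.sum_congr rfl fun J _ => ?_
  rw [← Finset.sum_neg_distrib]
  refine Finset.sum_congr rfl fun I _ => ?_
  by_cases hI : Odd I.card
  swap
  · simp [coeffOn_eq_zero_of_mem_oddPart hx hI]
  by_cases hJ : Odd J.card
  swap
  · simp [coeffOn_eq_zero_of_mem_oddPart hy hJ]
  rw [smul_mul_smul_comm, smul_mul_smul_comm, mul_comm (coeffOn J y), ← smul_neg]
  congr 1
  by_cases h : Disjoint I J
  · have h1 := shuffleSign_mul_swap h
    rw [(hI.mul hJ).neg_one_pow] at h1
    have h2 : shuffleSign I J = -shuffleSign J I := by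
      calc shuffleSign I J = shuffleSign I J * shuffleSign J I * shuffleSign J I := by
            rw [mul_assoc, shuffleSign_mul_self, mul_one]
        _ = -shuffleSign J I := by rw [h1, neg_one_mul]
    rw [stdBasis_mul_of_disjoint h, stdBasis_mul_of_disjoint h.symm, h2, neg_smul,
      Finset.union_comm]
  · rw [stdBasis_mul_of_not_disjoint h, stdBasis_mul_of_not_disjoint fun h' => h h'.symm, neg_zero]

/-- Odd elements anticommute, so the quadratic terms of the twisting equation cancel in pairs. -/
theorem isTwistingSequence_of_mem [NoZeroDivisors R] [CharZero R] {x : ℕ → Lam b R}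
    (hx : ∀ n, 1 ≤ n → x n ∈ ⋀[R]^(2 * n + 1) (Fin b → R)) :
    IsTwistingSequence (fun k => ⋀[R]^k (Fin b → R)) coboundary x := by
  refine fun n hn => ⟨hx n hn, ?_⟩
  rw [coboundary_eq_zero, LinearMap.zero_apply, zero_add]
  set T := (Finset.HasAntidiagonal.antidiagonal n).filter fun ij => 1 ≤ ij.1 ∧ 1 ≤ ij.2 with hT
  have hodd : ∀ n, 1 ≤ n → x n ∈ oddPart b R := fun n hn =>
    mem_oddPart_of_mem (odd_two_mul_add_one n) (hx n hn)
  have h : ∑ ij ∈ T, x ij.1 * x ij.2 = -∑ ij ∈ T, x ij.1 * x ij.2 := by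
    rw [← Finset.sum_neg_distrib]
    refine Finset.sum_nbij' Prod.swap Prod.swap ?_ ?_ (fun _ _ => rfl) (fun _ _ => rfl) ?_
    · simp only [hT, Finset.mem_filter, Finset.HasAntidiagonal.mem_antidiagonal, Prod.fst_swap,
        Prod.snd_swap]
      exact fun ij h => ⟨by rw [add_comm]; exact h.1, h.2.symm⟩
    · simp only [hT, Finset.mem_filter, Finset.HasAntidiagonal.mem_antidiagonal, Prod.fst_swap,
        Prod.snd_swap]
      exact fun ij h => ⟨by rw [add_comm]; exact h.1, h.2.symm⟩
    · intro ij hij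
      have h := (Finset.mem_filter.1 hij).2
      exact mul_eq_neg_mul_of_mem_oddPart (hodd _ h.1) (hodd _ h.2)
  refine (stdBasis b R).ext_elem fun K => ?_
  have hK : coeffOn K (∑ ij ∈ T, x ij.1 * x ij.2) = -coeffOn K (∑ ij ∈ T, x ij.1 * x ij.2) := by
    conv_lhs => rw [h, map_neg]
  have h2 : (2 : R) * coeffOn K (∑ ij ∈ T, x ij.1 * x ij.2) = 0 := by linear_combination hK
  rw [map_zero, Finsupp.zero_apply]
  exact (mul_eq_zero.1 h2).resolve_left two_ne_zero

end Twisting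

/-! ### The Kraines construction -/

section Rational

variable {b : ℕ}

@[simp] theorem coeffOn_rationalize (I : Finset (Fin b)) (x : Lam b ℤ) :
    coeffOn I (rationalize x) = ((coeffOn I x : ℤ) : ℚ) := by
  rw [rationalize, map_sum, Finset.sum_eq_single I]
  · simp
  · intro J _ hJ
    simp [hJ]
  · exact fun h => absurd (Finset.mem_univ I) h

theorem rationalize_mem {n : ℕ} {a : Lam b ℤ} (ha : a ∈ ⋀[ℤ]^n (Fin b → ℤ)) :
    rationalize a ∈ ⋀[ℚ]^n (Fin b → ℚ) :=
  mem_of_coeffOn fun J hJ => by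
    rw [coeffOn_rationalize, coeffOn_eq_zero_of_mem ha hJ, Int.cast_zero]

theorem insertionPower_rationalize {a : Lam b ℤ} (ha : a ∈ ⋀[ℤ]^3 (Fin b → ℤ)) {n : ℕ}
    (hn : 1 ≤ n) : insertionPower (rationalize a) n = rationalize (insertionPower a n) := by
  refine (stdBasis b ℚ).ext_elem fun K => ?_
  change coeffOn K _ = coeffOn K _
  rw [coeffOn_rationalize, insertionPower, insertionPower, map_sum, map_sum, Int.cast_sum]
  refine Finset.sum_congr rfl fun s hs => ?_
  have hcard := (Finset.mem_powersetCard.1 hs).2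
  by_cases h : ∀ I ∈ s, I.card = 3
  · have : Nonempty {I // I ∈ s} := (Finset.card_pos.1 (by omega : 0 < s.card)).to_subtype
    have hodd : ∀ I : {I // I ∈ s}, Odd I.1.card := fun I => odd_of_eq_three (h I.1 I.2)
    rw [insertionOnBasis_eq hodd, insertionOnBasis_eq hodd, ← Int.cast_smul_eq_zsmul ℚ]
    simp only [map_smul, coeffOn_stdBasis, coeffOn_rationalize, smul_eq_mul]
    push_cast
    rfl
  · rw [prod_coeffOn_eq_zero (J := fun I => I) ha h,
      prod_coeffOn_eq_zero (J := fun I => I) (rationalize_mem ha) h]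
    simp

theorem kraines_one_eq_insertionPower {a : Lam b ℚ} (ha : a ∈ ⋀[ℚ]^3 (Fin b → ℚ)) {n : ℕ}
    (hn : 1 ≤ n) : kraines 1 a n = insertionPower a n := by
  have hodd : a ∈ oddPart b ℚ := mem_oddPart_of_mem (by decide) ha
  have hn0 : (n.factorial : ℚ) ≠ 0 := Nat.cast_ne_zero.2 n.factorial_ne_zero
  rw [kraines, krainesExp, PowerSeries.coeff_mk, if_pos (one_dvd n), Nat.div_one, map_smul,
    ← List.ofFn_const, barOne_iterMul hn fun _ => hodd, ← factorial_smul_insertionPower ha hn,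
    smul_smul, inv_mul_cancel₀ hn0, one_smul]

end Rational

end MinimalTorus

open MinimalTorus in
theorem mainTheorem5 (b : ℕ) :
    -- the insertion product is well defined on odd basis elements, and is `± e^{I₁ ∪ ⋯ ∪ Iₙ}` or `0`
    (∀ (n : ℕ), 1 ≤ n → ∀ I : Fin n → Finset (Fin b), (∀ k, Odd (I k).card) →
      (OneRegular I →
        (∃ l : List (Fin n), IsInsertionOrder I l) ∧
        (∀ l : List (Fin n), IsInsertionOrder I l →
          insertionProduct b ℤ n (fun k => stdBasis b ℤ (I k)) = iterProd insertion (l.map I) ∧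
          insertionProduct b ℤ n (fun k => stdBasis b ℤ (I k)) = iterProd cupOne (l.map I)) ∧
        ∃ s : ℤˣ, insertionProduct b ℤ n (fun k => stdBasis b ℤ (I k)) =
          s • stdBasis b ℤ (Finset.univ.biUnion I)) ∧
      (¬ OneRegular I → insertionProduct b ℤ n (fun k => stdBasis b ℤ (I k)) = 0)) ∧
    -- it is symmetric on odd elements
    (∀ (n : ℕ) (a : Fin n → Lam b ℤ), (∀ k, a k ∈ oddPart b ℤ) → ∀ σ : Equiv.Perm (Fin n),
      insertionProduct b ℤ n (fun k => a (σ k)) = insertionProduct b ℤ n a) ∧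
    -- iterated left multiplication on odd elements is the insertion product
    (∀ (n : ℕ), 1 ≤ n → ∀ a : Fin n → Lam b ℤ, (∀ k, a k ∈ oddPart b ℤ) →
      barOne (iterMul (List.ofFn a)) = insertionProduct b ℤ n a) ∧
    -- the Kraines construction on an element of degree three
    (∀ a ∈ ⋀[ℤ]^3 (Fin b → ℤ),
      (∀ n : ℕ, 1 ≤ n →
        (n.factorial : ℤ) • insertionPower a n = insertionProduct b ℤ n (fun _ => a) ∧
        kraines 1 (rationalize a) n = rationalize (insertionPower a n)) ∧
      IsTwistingSequence (fun k => ⋀[ℤ]^k (Fin b → ℤ)) coboundary (insertionPower a) ∧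
      IsTwistingSequence (fun k => ⋀[ℚ]^k (Fin b → ℚ)) coboundary
        (kraines 1 (rationalize a))) := by
  refine ⟨fun n hn I hodd => ?_, fun n a ha σ => insertionProduct_comp_perm ha σ,
    fun n hn a ha => barOne_iterMul hn ha, fun a ha => ⟨fun n hn => ⟨?_, ?_⟩, ?_, ?_⟩⟩
  · have : Nonempty (Fin n) := ⟨⟨0, hn⟩⟩
    rw [insertionProduct_stdBasis]
    refine ⟨fun h => ⟨exists_isInsertionOrder hodd h, fun l hl => ?_, ?_⟩, fun h => if_neg h⟩
    · rw [insertionOnBasis_eq hodd]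
      exact ⟨(iterProd_eq (fun s J K _ _ _ => insertion_zsmul_stdBasis s J K) hodd hl).symm,
        (iterProd_eq (fun s J K hJ hK h1 => cupOne_zsmul_stdBasis s hJ hK h1) hodd hl).symm⟩
    · obtain ⟨i, hi⟩ := nonempty_of_treeSign_ne_zero ((treeSign_univ_ne_zero_iff hodd).2 h)
      obtain ⟨u, hu⟩ := isUnit_rootedSign ((oneRegular_iff (nonempty_of_odd hodd) hi).1 h)
      refine ⟨u, ?_⟩
      rw [insertionOnBasis_eq hodd, treeSign_eq hodd hi, ← hu]
      rfl
  · exact_mod_cast factorial_smul_insertionPower ha hn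
  · rw [kraines_one_eq_insertionPower (rationalize_mem ha) hn, insertionPower_rationalize ha hn]
  · exact isTwistingSequence_of_mem fun n hn => insertionPower_mem ha hn
  · refine isTwistingSequence_of_mem fun n hn => ?_
    rw [kraines_one_eq_insertionPower (rationalize_mem ha) hn]
    exact insertionPower_mem (rationalize_mem ha) hn
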